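/- Let $\pi:\hat G\to C_2=\{\pm1\}$ be a finite $C_2$-graded group with $G=\ker\pi$. For a $\mathbb C$-linear category $\mathcal C$, a Real $2$-representation of $G$ on $\mathcal C$ consists of functors $\rho(\sigma):\mathcal C\to\mathcal C$, $\sigma\in\hat G$, which are $\mathbb C$-linear if $\pi(\sigma)=1$ and $\mathbb C$-antilinear if $\pi(\sigma)=-1$, with natural isomorphisms $\theta_{\sigma_2,\sigma_1}:\rho(\sigma_2)\rho(\sigma_1)\Rightarrow\rho(\sigma_2\sigma_1)$ and $\theta_e:\rho(e)\Rightarrow\mathrm{id}$ satisfying the usual associativity and unit conditions. A Real $G$-equivariant structure on a functor $F:\mathcal C\to\mathcal D$ between Real $2$-representations is a family of natural isomorphisms $\eta_\sigma:F\rho_{\mathcal C}(\sigma)\Rightarrow\rho_{\mathcal D}(\sigma)F$ compatible with the $\theta$'s. The homotopy fixed point category $\mathcal C^{\hat G}$ is the $\mathbb R$-linear category whose objects are pairs $(C,u)$ with isomorphisms $u_\sigma:C\to\rho(\sigma)(C)$, $\sigma\in\hat G$, such that $u_{\sigma_2\sigma_1}=\theta_{\sigma_2,\sigma_1}\circ\rho(\sigma_2)(u_{\sigma_1})\circ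 u_{\sigma_2}$ for all $\sigma_1,\sigma_2\in\hat G$, and whose morphisms $(C,u)\to(C',u')$ are the morphisms $f:C\to C'$ with $u'_\sigma\circ f=\rho(\sigma)(f)\circ u_\sigma$ for all $\sigma$. A Real $G$-equivariant functor $(F,\eta)$ induces $F^{\hat G}:\mathcal C^{\hat G}\to\mathcal D^{\hat G}$, $(C,u)\mapsto(F(C),\{\eta_\sigma\circ F(u_\sigma)\}_\sigma)$, $f\mapsto F(f)$. Let $V$ be a finite dimensional Real representation of $G$, that is, a finite dimensional complex vector space with an action of $\hat G$ in which $\sigma$ acts $\mathbb C$-linearly if $\pi(\sigma)=1$ and $\mathbb C$-antilinearly if $\pi(\sigma)=-1$. Let $q\in\mathrm{Sym}^2V^\vee$ be a non-degenerate quadratic form which is $\hat G$-invariant: $q(\sigma v)=q(v)$ if $\pi(\sigma)=1$ and $q(\sigma v)=\overline{q(v)}$ if $\pi(\sigma)=-1$. Let $R=\widehat{\mathrm{Sym}}\,V^\vee\cong\mathbb C[[x_1,\dots,x_n]]$, where $x_1,\dots,x_n$ are the coordinates dual to a basis $v_1,\dots,v_n$ of $V$. The group $\hat G$ acts by $\mathbb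 C$-linear or $\mathbb C$-antilinear (according to $\pi$) ring automorphisms on $R$ and on the Clifford algebra $\mathrm{Cl}(V,q)=T(V)/(v\otimes v-q(v))$, extending its actions on $V^\vee$ and $V$. Let $\mathrm{Cl}(V,q)\text{-}\mathrm{grmod}$ be the category of finitely generated $\mathbb Z/2$-graded left $\mathrm{Cl}(V,q)$-modules and degree zero $\mathrm{Cl}(V,q)$-linear maps. Let $Z^0(\mathrm{MF}(R,q))$ be the category whose objects are matrix factorizations $(M,d)$ of $q$ (finite rank free $\mathbb Z/2$-graded $R$-modules with an odd $R$-linear endomorphism $d$ satisfying $d^2=q\cdot\mathrm{id}$) and whose morphisms are the degree zero $R$-linear maps commuting with the differentials, and let $\mathrm{HMF}(R,q)=H^0(\mathrm{MF}(R,q))$ be its quotient by the morphisms $d_N h+h d_M$ with $h$ odd and $R$-linear. The twists $M\mapsto M^\sigma$ ($M^\sigma=M$ as a graded abelian group, with the same differential in the case of matrix factorizations, and with scalars acting by $s\cdot m=\sigma^{-1}(s)m$), together with identity maps as coherence isomorphisms, make these three categories Real $2$-representations of $G$. Let $\Phi:\mathrm{Cl}(V,q)\text{-}\mathrm{grmod}\to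 Z^0(\mathrm{MF}(R,q))$ be the Buchweitz--Eisenbud--Herzog functor: $\Phi(A)=A\otimes_{\mathbb C}R$ with differential $a\otimes r\mapsto\sum_j v_j a\otimes x_j r$, and $\Phi(f)=f\otimes\mathrm{id}_R$. Then the maps $$\eta_{\sigma,A}:\Phi(A^\sigma)\to\Phi(A)^\sigma,\qquad a\otimes r\mapsto a\otimes\sigma^{-1}(r),$$ define a Real $G$-equivariant structure on $\Phi$. Let $\widetilde\Phi$ be the composite of $\Phi$ with the canonical functor $Z^0(\mathrm{MF}(R,q))\to\mathrm{HMF}(R,q)$, with the Real $G$-equivariant structure given by $\eta$ and by identity morphisms. Then the induced functor on homotopy fixed points $$\widetilde\Phi^{\hat G}:\ \mathrm{Cl}(V,q)\text{-}\mathrm{grmod}^{\hat G}\longrightarrow\mathrm{HMF}(\widehat{\mathrm{Sym}}\,V^\vee,q)^{\hat G}$$ is an $\mathbb R$-linear equivalence of categories. -/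

import Mathlib

open CategoryTheory TensorProduct

universe u v w v₁ v₂ v₃ u₁ u₂ u₃

noncomputable section

namespace RealMF

/-! ### Groups graded by `C₂ = {±1} = ℤˣ` and (anti)linear actions

A `C₂`-graded group `Ĝ` is a group `Ghat` with a homomorphism `π : Ghat →* ℤˣ`; `G = ker π`. -/

/-- The automorphism of `ℂ` attached to a sign: the identity for `1`, complex conjugation for
`-1`. An additive map `f` with `f (a • v) = conjBy ε a • f v` is `ℂ`-linear if `ε = 1` and
`ℂ`-antilinear if `ε = -1`. -/
def conjBy (ε : ℤˣ) : ℂ →+* ℂ := if ε = 1 then RingHom.id ℂ else starRingEnd ℂ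

theorem conjBy_one : conjBy 1 = RingHom.id ℂ := if_pos rfl

theorem conjBy_neg_one : conjBy (-1) = starRingEnd ℂ := if_neg (by decide)

theorem conjBy_mul (ε δ : ℤˣ) (a : ℂ) : conjBy (ε * δ) a = conjBy ε (conjBy δ a) := by
  rcases Int.units_eq_one_or ε with rfl | rfl <;> rcases Int.units_eq_one_or δ with rfl | rfl <;>
    simp [conjBy_one, conjBy_neg_one]

theorem conjBy_ofReal (ε : ℤˣ) (r : ℝ) : conjBy ε (r : ℂ) = r := by
  rcases Int.units_eq_one_or ε with rfl | rfl <;> simp [conjBy_one, conjBy_neg_one]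

theorem conjBy_conjBy_inv {Ghat : Type*} [Group Ghat] (π : Ghat →* ℤˣ) (σ : Ghat) (a : ℂ) :
    conjBy (π σ) (conjBy (π σ⁻¹) a) = a := by
  rw [← conjBy_mul, ← map_mul, mul_inv_cancel, map_one, conjBy_one]; rfl

theorem conjBy_inv_conjBy {Ghat : Type*} [Group Ghat] (π : Ghat →* ℤˣ) (σ : Ghat) (a : ℂ) :
    conjBy (π σ⁻¹) (conjBy (π σ) a) = a := by
  rw [← conjBy_mul, ← map_mul, inv_mul_cancel, map_one, conjBy_one]; rfl

/-- A Real representation of `G = ker π` (with respect to the `C₂`-graded group `π : Ĝ → C₂`) on a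
complex vector space `V`: an action of `Ĝ` on `V` in which `σ` acts `ℂ`-linearly if `π σ = 1` and
`ℂ`-antilinearly if `π σ = -1`. -/
structure RealRep {Ghat : Type*} [Group Ghat] (π : Ghat →* ℤˣ)
    (V : Type*) [AddCommGroup V] [Module ℂ V] where
  act : Ghat →* AddMonoid.End V
  act_smul : ∀ (σ : Ghat) (a : ℂ) (v : V), act σ (a • v) = conjBy (π σ) a • act σ v

/-- An action of `Ĝ` on a `ℂ`-algebra `S` by generalized algebra automorphisms: `σ` acts by a ring
automorphism of `S`, which is `ℂ`-linear if `π σ = 1` and `ℂ`-antilinear if `π σ = -1`.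
(The ring endomorphisms `act σ` are invertible because `Ĝ` is a group.) -/
structure GenAction {Ghat : Type*} [Group Ghat] (π : Ghat →* ℤˣ)
    (S : Type*) [Ring S] [Algebra ℂ S] where
  act : Ghat →* (S →+* S)
  act_smul : ∀ (σ : Ghat) (a : ℂ) (s : S), act σ (a • s) = conjBy (π σ) a • act σ s

section act

variable {Ghat : Type*} [Group Ghat] {π : Ghat →* ℤˣ}

theorem RealRep.act_inv_act {V : Type*} [AddCommGroup V] [Module ℂ V] (ρ : RealRep π V)
    (σ : Ghat) (v : V) : ρ.act σ⁻¹ (ρ.act σ v) = v := by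
  have h : ρ.act σ⁻¹ * ρ.act σ = 1 := by rw [← map_mul, inv_mul_cancel, map_one]
  exact DFunLike.congr_fun h v

theorem RealRep.act_act_inv {V : Type*} [AddCommGroup V] [Module ℂ V] (ρ : RealRep π V)
    (σ : Ghat) (v : V) : ρ.act σ (ρ.act σ⁻¹ v) = v := by
  have h : ρ.act σ * ρ.act σ⁻¹ = 1 := by rw [← map_mul, mul_inv_cancel, map_one]
  exact DFunLike.congr_fun h v

variable {S : Type*} [Ring S] [Algebra ℂ S] (α : GenAction π S)

theorem GenAction.act_inv_act (σ : Ghat) (s : S) : α.act σ⁻¹ (α.act σ s) = s := by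
  have h : α.act σ⁻¹ * α.act σ = 1 := by rw [← map_mul, inv_mul_cancel, map_one]
  exact DFunLike.congr_fun h s

theorem GenAction.act_act_inv (σ : Ghat) (s : S) : α.act σ (α.act σ⁻¹ s) = s := by
  have h : α.act σ * α.act σ⁻¹ = 1 := by rw [← map_mul, mul_inv_cancel, map_one]
  exact DFunLike.congr_fun h s

theorem GenAction.act_mul_apply (σ τ : Ghat) (s : S) :
    α.act (σ * τ) s = α.act σ (α.act τ s) := by rw [map_mul]; rfl

theorem GenAction.act_one_apply (s : S) : α.act 1 s = s := by rw [map_one]; rfl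

theorem GenAction.act_algebraMap (σ : Ghat) (a : ℂ) :
    α.act σ (algebraMap ℂ S a) = algebraMap ℂ S (conjBy (π σ) a) := by
  rw [Algebra.algebraMap_eq_smul_one, α.act_smul, map_one, Algebra.algebraMap_eq_smul_one]

end act

/-! ### Real 2-representations on linear categories (antilinear approach) -/

/-- A Real 2-representation of `G = ker π` on a `ℂ`-linear category `C`: functors `ρ σ`, which are
`ℂ`-linear if `π σ = 1` and `ℂ`-antilinear if `π σ = -1`, with coherent natural isomorphisms
`θ σ₂ σ₁ : ρ(σ₂) ∘ ρ(σ₁) ⇒ ρ(σ₂ σ₁)` and `θe : ρ(e) ⇒ id`. (The `eqToHom`s identify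
`ρ((σ₃σ₂)σ₁)` with `ρ(σ₃(σ₂σ₁))`, `ρ(eσ)` with `ρ(σ)`, and `ρ(σe)` with `ρ(σ)`.) -/
structure RealTwoRep {Ghat : Type*} [Group Ghat] (π : Ghat →* ℤˣ)
    (C : Type u₁) [Category.{v₁} C] [Preadditive C] [Linear ℂ C] where
  ρ : Ghat → (C ⥤ C)
  map_add : ∀ (σ : Ghat) {X Y : C} (f g : X ⟶ Y), (ρ σ).map (f + g) = (ρ σ).map f + (ρ σ).map g
  map_smul : ∀ (σ : Ghat) {X Y : C} (a : ℂ) (f : X ⟶ Y),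
    (ρ σ).map (a • f) = conjBy (π σ) a • (ρ σ).map f
  θ : ∀ σ₂ σ₁ : Ghat, ρ σ₁ ⋙ ρ σ₂ ≅ ρ (σ₂ * σ₁)
  θe : ρ 1 ≅ 𝟭 C
  assoc : ∀ (σ₃ σ₂ σ₁ : Ghat) (X : C),
    (θ σ₃ σ₂).hom.app ((ρ σ₁).obj X) ≫ (θ (σ₃ * σ₂) σ₁).hom.app X ≫
        eqToHom (by rw [mul_assoc]) =
      (ρ σ₃).map ((θ σ₂ σ₁).hom.app X) ≫ (θ σ₃ (σ₂ * σ₁)).hom.app X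
  unit_left : ∀ (σ : Ghat) (X : C),
    (θ 1 σ).hom.app X ≫ eqToHom (by rw [one_mul]; rfl) = θe.hom.app ((ρ σ).obj X)
  unit_right : ∀ (σ : Ghat) (X : C),
    (θ σ 1).hom.app X ≫ eqToHom (by rw [mul_one]; rfl) = (ρ σ).map (θe.hom.app X)

section TwoRep

variable {Ghat : Type*} [Group Ghat] {π : Ghat →* ℤˣ}
variable {C : Type u₁} [Category.{v₁} C] [Preadditive C] [Linear ℂ C]
variable {D : Type u₂} [Category.{v₂} D] [Preadditive D] [Linear ℂ D]
variable {E : Type u₃} [Category.{v₃} E] [Preadditive E] [Linear ℂ E]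

/-- Homotopy fixed points (Real `G`-equivariant objects) of a Real 2-representation: pairs
`(X, u)` with isomorphisms `u σ : X ≅ ρ(σ) X` such that
`u (σ₂ σ₁) = θ σ₂ σ₁ ∘ ρ(σ₂)(u σ₁) ∘ u σ₂`. -/
structure FixedPoint (P : RealTwoRep π C) where
  obj : C
  u : ∀ σ : Ghat, obj ≅ (P.ρ σ).obj obj
  coh : ∀ σ₂ σ₁ : Ghat,
    (u (σ₂ * σ₁)).hom = (u σ₂).hom ≫ (P.ρ σ₂).map (u σ₁).hom ≫ (P.θ σ₂ σ₁).hom.app obj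

/-- The real vector space of morphisms `f : X → Y` of homotopy fixed points:
`u_Y σ ∘ f = ρ(σ)(f) ∘ u_X σ` for all `σ`. -/
def FixedPoint.homs {P : RealTwoRep π C} (X Y : FixedPoint P) : Submodule ℝ (X.obj ⟶ Y.obj) where
  carrier := {f | ∀ σ : Ghat, f ≫ (Y.u σ).hom = (X.u σ).hom ≫ (P.ρ σ).map f}
  add_mem' {f g} hf hg σ := by
    rw [Preadditive.add_comp, hf σ, hg σ, P.map_add, Preadditive.comp_add]
  zero_mem' σ := by
    have h := P.map_smul σ (0 : ℂ) (0 : X.obj ⟶ Y.obj)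
    rw [map_zero, zero_smul, zero_smul] at h
    rw [h, Limits.zero_comp, Limits.comp_zero]
  smul_mem' r f hf σ := by
    have h : (P.ρ σ).map (r • f) = r • (P.ρ σ).map f := by
      have := P.map_smul σ (r : ℂ) f
      rw [conjBy_ofReal] at this
      exact this
    have h₁ : (r • f) ≫ (Y.u σ).hom = r • (f ≫ (Y.u σ).hom) :=
      Linear.smul_comp _ _ _ (r : ℂ) _ _
    have h₂ : (X.u σ).hom ≫ (r • (P.ρ σ).map f) = r • ((X.u σ).hom ≫ (P.ρ σ).map f) :=
      Linear.comp_smul _ _ _ _ (r : ℂ) _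
    rw [h₁, hf σ, h, h₂]

/-- The homotopy fixed point category `C^Ĝ`. -/
instance (P : RealTwoRep π C) : Category (FixedPoint P) where
  Hom X Y := X.homs Y
  id X := ⟨𝟙 X.obj, fun σ => by simp⟩
  comp {X Y Z} f g := ⟨f.1 ≫ g.1, fun σ => by
    rw [Category.assoc, g.2 σ, ← Category.assoc, f.2 σ, Category.assoc, Functor.map_comp]⟩
  id_comp f := Subtype.ext (Category.id_comp f.1)
  comp_id f := Subtype.ext (Category.comp_id f.1)
  assoc f g h := Subtype.ext (Category.assoc f.1 g.1 h.1)

instance (P : RealTwoRep π C) : Preadditive (FixedPoint P) where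
  homGroup X Y := inferInstanceAs (AddCommGroup (X.homs Y))
  add_comp _ _ _ f f' g := Subtype.ext (Preadditive.add_comp _ _ _ f.1 f'.1 g.1)
  comp_add _ _ _ f g g' := Subtype.ext (Preadditive.comp_add _ _ _ f.1 g.1 g'.1)

instance (P : RealTwoRep π C) : Linear ℝ (FixedPoint P) where
  homModule X Y := inferInstanceAs (Module ℝ (X.homs Y))
  smul_comp _ _ _ r f g := Subtype.ext (Linear.smul_comp _ _ _ (r : ℂ) f.1 g.1)
  comp_smul _ _ _ f r g := Subtype.ext (Linear.comp_smul _ _ _ f.1 (r : ℂ) g.1)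

/-- A Real `G`-equivariant structure on a functor `F` between Real 2-representations: natural
isomorphisms `η σ : F ∘ ρ(σ) ⇒ ρ(σ) ∘ F`, compatible with the `θ σ₂ σ₁`. -/
structure RealEquivariant (P : RealTwoRep π C) (P' : RealTwoRep π D) (F : C ⥤ D) where
  η : ∀ σ : Ghat, P.ρ σ ⋙ F ≅ F ⋙ P'.ρ σ
  coh : ∀ (σ₂ σ₁ : Ghat) (X : C),
    (η σ₂).hom.app ((P.ρ σ₁).obj X) ≫ (P'.ρ σ₂).map ((η σ₁).hom.app X) ≫
        (P'.θ σ₂ σ₁).hom.app (F.obj X) =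
      F.map ((P.θ σ₂ σ₁).hom.app X) ≫ (η (σ₂ * σ₁)).hom.app X

/-- The composite of Real `G`-equivariant functors. -/
def RealEquivariant.comp {P : RealTwoRep π C} {P' : RealTwoRep π D} {P'' : RealTwoRep π E}
    {F : C ⥤ D} {F' : D ⥤ E} (η : RealEquivariant P P' F) (η' : RealEquivariant P' P'' F') :
    RealEquivariant P P'' (F ⋙ F') where
  η σ := NatIso.ofComponents
    (fun X => F'.mapIso ((η.η σ).app X) ≪≫ (η'.η σ).app (F.obj X))
    (fun {X Y} f => by
      have h₁ := (η.η σ).hom.naturality f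
      have h₂ := (η'.η σ).hom.naturality (F.map f)
      simp only [Functor.comp_obj, Functor.comp_map] at h₁ h₂
      simp only [Functor.comp_obj, Functor.comp_map, Iso.trans_hom, Functor.mapIso_hom,
        Iso.app_hom, Category.assoc]
      rw [← h₂, ← Category.assoc, ← Functor.map_comp, h₁, Functor.map_comp, Category.assoc])
  coh σ₂ σ₁ X := by
    have h₁ := η.coh σ₂ σ₁ X
    have h₂ := η'.coh σ₂ σ₁ (F.obj X)
    have h₃ := (η'.η σ₂).hom.naturality ((η.η σ₁).hom.app X)
    simp only [Functor.comp_obj, Functor.comp_map] at h₁ h₂ h₃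
    simp only [Functor.comp_obj, Functor.comp_map, Iso.trans_hom, Functor.mapIso_hom,
      Iso.app_hom, Category.assoc, NatIso.ofComponents_hom_app, Functor.map_comp]
    rw [← reassoc_of% h₃, h₂, ← Functor.map_comp_assoc, ← Functor.map_comp_assoc,
      ← Functor.map_comp_assoc, ← h₁]
    simp

/-- The functor `F^Ĝ : C^Ĝ → D^Ĝ` induced by a Real `G`-equivariant functor `(F, η)`:
`(X, u) ↦ (F X, η σ ∘ F (u σ))` and `f ↦ F f`. -/
def RealEquivariant.fixed {P : RealTwoRep π C} {P' : RealTwoRep π D} {F : C ⥤ D}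
    (η : RealEquivariant P P' F) : FixedPoint P ⥤ FixedPoint P' where
  obj X :=
    { obj := F.obj X.obj
      u := fun σ => F.mapIso (X.u σ) ≪≫ (η.η σ).app X.obj
      coh := fun σ₂ σ₁ => by
        have h₁ := η.coh σ₂ σ₁ X.obj
        have h₂ := (η.η σ₂).hom.naturality (X.u σ₁).hom
        simp only [Functor.comp_obj, Functor.comp_map] at h₁ h₂
        simp only [Iso.trans_hom, Functor.mapIso_hom, Iso.app_hom,
          Category.assoc, Functor.map_comp, X.coh]
        rw [← reassoc_of% h₂, h₁] }
  map {X Y} f := ⟨F.map f.1, fun σ => by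
    have h₂ := (η.η σ).hom.naturality f.1
    simp only [Functor.comp_obj, Functor.comp_map] at h₂
    simp only [Iso.trans_hom, Functor.mapIso_hom, Iso.app_hom, Category.assoc]
    rw [← h₂, ← Functor.map_comp_assoc, ← Functor.map_comp_assoc, f.2 σ]⟩
  map_id X := Subtype.ext (F.map_id X.obj)
  map_comp f g := Subtype.ext (F.map_comp f.1 g.1)

/-! ### Passage to a quotient by an ideal of morphisms -/

/-- A two-sided ideal of a `ℂ`-linear category. -/
structure HomIdeal (C : Type u₁) [Category.{v₁} C] [Preadditive C] [Linear ℂ C] where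
  I : ∀ X Y : C, Submodule ℂ (X ⟶ Y)
  comp_left : ∀ {X Y Z : C} (f : X ⟶ Y) {g : Y ⟶ Z}, g ∈ I Y Z → f ≫ g ∈ I X Z
  comp_right : ∀ {X Y Z : C} {f : X ⟶ Y} (g : Y ⟶ Z), f ∈ I X Y → f ≫ g ∈ I X Z

namespace HomIdeal

variable (J : HomIdeal C)

/-- Two morphisms are identified if their difference lies in the ideal. -/
def rel : HomRel C := fun X Y f g => f - g ∈ J.I X Y

instance : Congruence J.rel where
  comp_left f g g' h := by
    change _ ∈ _
    rw [← Preadditive.comp_sub]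
    exact J.comp_left f h
  comp_right g h := by
    change _ ∈ _
    rw [← Preadditive.sub_comp]
    exact J.comp_right g h
  equivalence {X Y} :=
    { refl := fun f => by change f - f ∈ _; rw [sub_self]; exact zero_mem _
      symm := fun {f g} h => by
        change g - f ∈ _
        rw [← neg_sub]
        exact neg_mem h
      trans := fun {f g h} h₁ h₂ => by
        change f - h ∈ _
        rw [← sub_add_sub_cancel f g h]
        exact add_mem h₁ h₂ }

/-- The quotient of a linear category by an ideal: same objects, morphisms modulo the ideal. -/
abbrev Quot : Type u₁ := CategoryTheory.Quotient J.rel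

theorem rel_add {X Y : C} (f₁ f₂ g₁ g₂ : X ⟶ Y) (h : J.rel f₁ f₂) (h' : J.rel g₁ g₂) :
    J.rel (f₁ + g₁) (f₂ + g₂) := by
  change _ ∈ _
  rw [add_sub_add_comm]
  exact add_mem h h'

instance : Preadditive J.Quot :=
  Quotient.preadditive _ (fun _ _ f₁ f₂ g₁ g₂ h h' => J.rel_add f₁ f₂ g₁ g₂ h h')

instance : (Quotient.functor J.rel).Additive where
  map_add := rfl

instance : Linear ℂ J.Quot :=
  Quotient.linear ℂ _ (fun a X Y f₁ f₂ h => by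
    change _ ∈ _
    rw [← smul_sub]
    exact (J.I X Y).smul_mem a h)

variable (P : RealTwoRep π C)

/-- The functors `ρ σ` preserve the ideal. -/
def Stable : Prop :=
  ∀ (σ : Ghat) {X Y : C} (f : X ⟶ Y), f ∈ J.I X Y → (P.ρ σ).map f ∈ J.I ((P.ρ σ).obj X) ((P.ρ σ).obj Y)

variable {J P}

theorem Stable.rel_map (hJ : J.Stable P) (σ : Ghat) {X Y : C} (f g : X ⟶ Y) (h : J.rel f g) :
    J.rel ((P.ρ σ).map f) ((P.ρ σ).map g) := by
  have h' := hJ σ _ h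
  have e : (P.ρ σ).map (f - g) + (P.ρ σ).map g = (P.ρ σ).map f := by
    rw [← P.map_add, sub_add_cancel]
  rw [← eq_sub_iff_add_eq] at e
  rw [e] at h'
  exact h'

/-- The functor induced by `ρ σ` on the quotient category. -/
def Stable.functor (hJ : J.Stable P) (σ : Ghat) : J.Quot ⥤ J.Quot :=
  CategoryTheory.Quotient.lift _ (P.ρ σ ⋙ Quotient.functor J.rel)
    (fun _ _ f g h => CategoryTheory.Quotient.sound _ (hJ.rel_map σ f g h))

end HomIdeal

/-- The Real 2-representation induced on the quotient by a stable ideal. -/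
def RealTwoRep.quotient (P : RealTwoRep π C) {J : HomIdeal C} (hJ : J.Stable P) :
    RealTwoRep π J.Quot where
  ρ := hJ.functor
  map_add σ {X Y} f g := by
    obtain ⟨f, rfl⟩ := (Quotient.functor J.rel).map_surjective f
    obtain ⟨g, rfl⟩ := (Quotient.functor J.rel).map_surjective g
    exact congrArg (Quotient.functor J.rel).map (P.map_add σ f g)
  map_smul σ {X Y} a f := by
    obtain ⟨f, rfl⟩ := (Quotient.functor J.rel).map_surjective f
    exact congrArg (Quotient.functor J.rel).map (P.map_smul σ a f)
  θ σ₂ σ₁ := Quotient.natIsoLift _ (NatIso.ofComponents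
    (fun X => (Quotient.functor J.rel).mapIso ((P.θ σ₂ σ₁).app X))
    (fun f => congrArg (Quotient.functor J.rel).map ((P.θ σ₂ σ₁).hom.naturality f)))
  θe := Quotient.natIsoLift _ (NatIso.ofComponents
    (fun X => (Quotient.functor J.rel).mapIso (P.θe.app X))
    (fun f => congrArg (Quotient.functor J.rel).map (P.θe.hom.naturality f)))
  assoc σ₃ σ₂ σ₁ X := by
    have h := congrArg (Quotient.functor J.rel).map (P.assoc σ₃ σ₂ σ₁ X.as)
    rw [Functor.map_comp, Functor.map_comp, eqToHom_map] at h
    exact h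
  unit_left σ X := by
    have h := congrArg (Quotient.functor J.rel).map (P.unit_left σ X.as)
    rw [Functor.map_comp, eqToHom_map] at h
    exact h
  unit_right σ X := by
    have h := congrArg (Quotient.functor J.rel).map (P.unit_right σ X.as)
    rw [Functor.map_comp, eqToHom_map] at h
    exact h

/-- The quotient functor is Real `G`-equivariant, by identity morphisms. -/
def RealTwoRep.quotientEquivariant (P : RealTwoRep π C) {J : HomIdeal C} (hJ : J.Stable P) :
    RealEquivariant P (P.quotient hJ) (Quotient.functor J.rel) where
  η σ := NatIso.ofComponents (fun X => Iso.refl ((Quotient.functor J.rel).obj ((P.ρ σ).obj X)))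
    (fun f => (Category.comp_id _).trans (Category.id_comp _).symm)
  coh σ₂ σ₁ X := by
    have h₁ : ((P.quotient hJ).ρ σ₂).map (𝟙 ((Quotient.functor J.rel).obj ((P.ρ σ₁).obj X))) = 𝟙 _ :=
      CategoryTheory.Functor.map_id _ _
    refine (Category.id_comp _).trans ?_
    refine (congrArg (· ≫ _) h₁).trans ?_
    refine (Category.id_comp _).trans ?_
    exact (Category.comp_id _).symm

end TwoRep

/-! ### Twisted modules -/

section Twisted

variable {Ghat : Type*} [Group Ghat] {π : Ghat →* ℤˣ} {S : Type w} [Ring S] [Algebra ℂ S]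

/-- The abelian group underlying an `S`-module `A`, to be equipped with the twisted module
structure `s · a = σ⁻¹(s) a`. -/
def Twisted (_α : GenAction π S) (_σ : Ghat) (A : Type u) : Type u := A

variable (α : GenAction π S) (σ : Ghat) (A : Type u) [AddCommGroup A]

instance : AddCommGroup (Twisted α σ A) := inferInstanceAs (AddCommGroup A)

/-- The identity map, from an abelian group to its twist. -/
def toTwisted : A ≃+ Twisted α σ A := AddEquiv.refl A

instance [Module S A] : Module S (Twisted α σ A) := Module.compHom A (α.act σ⁻¹)

theorem toTwisted_smul [Module S A] (s : S) (a : A) :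
    s • toTwisted α σ A a = toTwisted α σ A (α.act σ⁻¹ s • a) := rfl

theorem toTwisted_smul' [Module S A] (s : S) (a : A) :
    toTwisted α σ A (s • a) = α.act σ s • toTwisted α σ A a := by
  rw [toTwisted_smul, α.act_inv_act]

instance [Module S A] [Module.Finite S A] : Module.Finite S (Twisted α σ A) := by
  obtain ⟨t, ht⟩ := Module.Finite.fg_top (R := S) (M := A)
  refine ⟨Submodule.fg_def.2 ⟨toTwisted α σ A '' t, t.finite_toSet.image _, ?_⟩⟩
  rw [eq_top_iff]
  intro a _
  have ha : (toTwisted α σ A).symm a ∈ Submodule.span S (t : Set A) := by rw [ht]; trivial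
  rw [← (toTwisted α σ A).apply_symm_apply a]
  generalize (toTwisted α σ A).symm a = b at ha
  induction ha using Submodule.span_induction with
  | mem x hx => exact Submodule.subset_span ⟨x, hx, rfl⟩
  | zero => rw [map_zero]; exact zero_mem _
  | add x y _ _ hx hy => rw [map_add]; exact add_mem hx hy
  | smul s x _ hx => rw [toTwisted_smul']; exact Submodule.smul_mem _ _ hx

end Twisted

/-! ### Graded modules over a `ℤ/2`-graded algebra -/

/-- A finitely generated `ℤ/2`-graded left module over a `ℤ/2`-graded `ℂ`-algebra `(S, 𝒮)`: a
module with a decomposition `A = A₀ ⊕ A₁` into complex subspaces such that `𝒮ᵢ Aⱼ ⊆ Aᵢ₊ⱼ`. -/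
structure GrMod {S : Type w} [Ring S] [Algebra ℂ S] (𝒮 : ZMod 2 → Submodule ℂ S) where
  carrier : Type u
  [addCommGroup : AddCommGroup carrier]
  [moduleC : Module ℂ carrier]
  [module : Module S carrier]
  [tower : IsScalarTower ℂ S carrier]
  [finite : Module.Finite S carrier]
  piece : ZMod 2 → Submodule ℂ carrier
  isCompl : IsCompl (piece 0) (piece 1)
  smul_mem : ∀ (i j : ZMod 2) (s : S) (a : carrier), s ∈ 𝒮 i → a ∈ piece j → s • a ∈ piece (i + j)

namespace GrMod

attribute [instance] addCommGroup moduleC module tower finite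

variable {S : Type w} [Ring S] [Algebra ℂ S] {𝒮 : ZMod 2 → Submodule ℂ S}

/-- The `S`-linear maps of degree zero. -/
def homs (A B : GrMod.{u} 𝒮) : Submodule ℂ (A.carrier →ₗ[S] B.carrier) where
  carrier := {f | ∀ (i : ZMod 2) (a : A.carrier), a ∈ A.piece i → f a ∈ B.piece i}
  add_mem' hf hg i a ha := add_mem (hf i a ha) (hg i a ha)
  zero_mem' _ _ _ := zero_mem _
  smul_mem' c _ hf i a ha := (B.piece i).smul_mem c (hf i a ha)

instance : Category (GrMod.{u} 𝒮) where
  Hom A B := A.homs B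
  id A := ⟨LinearMap.id, fun _ _ ha => ha⟩
  comp f g := ⟨g.1.comp f.1, fun i a ha => g.2 i _ (f.2 i a ha)⟩

instance : Preadditive (GrMod.{u} 𝒮) where
  homGroup A B := inferInstanceAs (AddCommGroup (A.homs B))
  add_comp _ _ _ f f' g := Subtype.ext (LinearMap.comp_add f.1 f'.1 g.1)
  comp_add _ _ _ f g g' := Subtype.ext (LinearMap.add_comp f.1 g'.1 g.1)

instance : Linear ℂ (GrMod.{u} 𝒮) where
  homModule A B := inferInstanceAs (Module ℂ (A.homs B))
  smul_comp _ _ _ r f g := Subtype.ext (LinearMap.ext fun a => by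
    change g.1 (r • f.1 a) = r • g.1 (f.1 a)
    rw [← algebraMap_smul S r, map_smul, algebraMap_smul])
  comp_smul _ _ _ f r g := Subtype.ext (LinearMap.ext fun a => rfl)

theorem hom_ext {A B : GrMod.{u} 𝒮} {f g : A ⟶ B} (h : ∀ a, f.1 a = g.1 a) : f = g :=
  Subtype.ext (LinearMap.ext h)

/-- An `S`-linear bijection which preserves degrees is an isomorphism. -/
def mkIso {A B : GrMod.{u} 𝒮} (e : A.carrier ≃ₗ[S] B.carrier)
    (h : ∀ (i : ZMod 2) (a : A.carrier), a ∈ A.piece i → e a ∈ B.piece i)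
    (h' : ∀ (i : ZMod 2) (b : B.carrier), b ∈ B.piece i → e.symm b ∈ A.piece i) : A ≅ B where
  hom := ⟨e, h⟩
  inv := ⟨e.symm, h'⟩
  hom_inv_id := hom_ext fun a => e.symm_apply_apply a
  inv_hom_id := hom_ext fun b => e.apply_symm_apply b

variable {Ghat : Type*} [Group Ghat] {π : Ghat →* ℤˣ}

/-- The complex structure of a twisted module: `c · a = σ⁻¹(c) a`, where `Ĝ` acts on `ℂ` through
`π` by complex conjugation. -/
instance (α : GenAction π S) (σ : Ghat) (A : GrMod.{u} 𝒮) :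
    Module ℂ (Twisted α σ A.carrier) := Module.compHom A.carrier (conjBy (π σ⁻¹))

/-- The twisted module `A^σ`: the abelian group `A` with its grading and with the module structure
`s · a = σ⁻¹(s) a`. -/
def twist (α : GenAction π S) (hα : ∀ σ i s, s ∈ 𝒮 i → α.act σ s ∈ 𝒮 i) (σ : Ghat)
    (A : GrMod.{u} 𝒮) : GrMod.{u} 𝒮 where
  carrier := Twisted α σ A.carrier
  tower := ⟨fun c s a => by
    change α.act σ⁻¹ (c • s) • (show A.carrier from a) =
      conjBy (π σ⁻¹) c • (α.act σ⁻¹ s • (show A.carrier from a))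
    rw [α.act_smul, smul_assoc]⟩
  piece i :=
    { carrier := (A.piece i : Set A.carrier)
      add_mem' := fun ha hb => (A.piece i).add_mem ha hb
      zero_mem' := (A.piece i).zero_mem
      smul_mem' := fun c _ ha => (A.piece i).smul_mem (conjBy (π σ⁻¹) c) ha }
  isCompl := by
    have h := A.isCompl
    refine ⟨?_, ?_⟩
    · rw [Submodule.disjoint_def]
      intro a h₀ h₁
      exact Submodule.disjoint_def.1 h.disjoint a h₀ h₁
    · rw [codisjoint_iff, eq_top_iff]
      intro a _
      obtain ⟨b, c, hb, hc, h⟩ := Submodule.codisjoint_iff_exists_add_eq.1 h.codisjoint a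
      exact Submodule.mem_sup.2 ⟨b, hb, c, hc, h⟩
  smul_mem i j s a hs ha := A.smul_mem i j _ a (hα σ⁻¹ i s hs) ha

variable (α : GenAction π S) (hα : ∀ σ i s, s ∈ 𝒮 i → α.act σ s ∈ 𝒮 i)

/-- The functor `A ↦ A^σ`, `f ↦ f` on graded modules. -/
def twistFunctor (σ : Ghat) : GrMod.{u} 𝒮 ⥤ GrMod.{u} 𝒮 where
  obj A := A.twist α hα σ
  map {A B} f :=
    ⟨{ toFun := fun a => (f.1 : A.carrier → B.carrier) a
       map_add' := fun a b => f.1.map_add a b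
       map_smul' := fun s a => f.1.map_smul (α.act σ⁻¹ s) a }, f.2⟩

theorem twist_eqToHom {σ τ : Ghat} (h : σ = τ) (A : GrMod.{u} 𝒮)
    (h' : A.twist α hα σ = A.twist α hα τ) (a : A.carrier) :
    ((eqToHom h').1 : A.carrier → A.carrier) a = a := by
  subst h; rfl

/-- The identity map of underlying abelian groups, as an isomorphism `(A^σ₁)^σ₂ ≅ A^(σ₂ σ₁)`. -/
def twistIso (σ₂ σ₁ : Ghat) (A : GrMod.{u} 𝒮) :
    (A.twist α hα σ₁).twist α hα σ₂ ≅ A.twist α hα (σ₂ * σ₁) :=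
  mkIso
    { toFun := fun a => (show A.carrier from a)
      invFun := fun a => (show A.carrier from a)
      map_add' := fun _ _ => rfl
      map_smul' := fun s a => by
        change α.act σ₁⁻¹ (α.act σ₂⁻¹ s) • (show A.carrier from a) =
          α.act (σ₂ * σ₁)⁻¹ s • (show A.carrier from a)
        rw [mul_inv_rev, α.act_mul_apply]
      left_inv := fun _ => rfl
      right_inv := fun _ => rfl }
    (fun _ _ h => h) (fun _ _ h => h)

/-- The identity map of underlying abelian groups, as an isomorphism `A^e ≅ A`. -/
def twistOneIso (A : GrMod.{u} 𝒮) : A.twist α hα 1 ≅ A :=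
  mkIso
    { toFun := fun a => (show A.carrier from a)
      invFun := fun a => (show A.carrier from a)
      map_add' := fun _ _ => rfl
      map_smul' := fun s a => by
        change α.act 1⁻¹ s • (show A.carrier from a) = s • (show A.carrier from a)
        rw [inv_one, α.act_one_apply]
      left_inv := fun _ => rfl
      right_inv := fun _ => rfl }
    (fun _ _ h => h) (fun _ _ h => h)

theorem twist_assoc (σ₃ σ₂ σ₁ : Ghat) (A : GrMod.{u} 𝒮)
    (h : A.twist α hα (σ₃ * σ₂ * σ₁) = A.twist α hα (σ₃ * (σ₂ * σ₁))) :
    (twistIso α hα σ₃ σ₂ (A.twist α hα σ₁)).hom ≫ (twistIso α hα (σ₃ * σ₂) σ₁ A).hom ≫ eqToHom h =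
      (twistFunctor α hα σ₃).map (twistIso α hα σ₂ σ₁ A).hom ≫
        (twistIso α hα σ₃ (σ₂ * σ₁) A).hom :=
  hom_ext fun a => twist_eqToHom α hα (mul_assoc σ₃ σ₂ σ₁) A h a

theorem twist_unit_left (σ : Ghat) (A : GrMod.{u} 𝒮)
    (h : A.twist α hα (1 * σ) = A.twist α hα σ) :
    (twistIso α hα 1 σ A).hom ≫ eqToHom h = (twistOneIso α hα (A.twist α hα σ)).hom :=
  hom_ext fun a => twist_eqToHom α hα (one_mul σ) A h a

theorem twist_unit_right (σ : Ghat) (A : GrMod.{u} 𝒮)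
    (h : A.twist α hα (σ * 1) = A.twist α hα σ) :
    (twistIso α hα σ 1 A).hom ≫ eqToHom h = (twistFunctor α hα σ).map (twistOneIso α hα A).hom :=
  hom_ext fun a => twist_eqToHom α hα (mul_one σ) A h a

/-- The Real 2-representation of `G` on graded `S`-modules defined by the functors `A ↦ A^σ`, with
identity maps of underlying abelian groups as coherence isomorphisms. -/
def twoRep : RealTwoRep π (GrMod.{u} 𝒮) where
  ρ := twistFunctor α hα
  map_add _ _ _ _ _ := rfl
  map_smul σ A B a f := hom_ext fun x => by
    change a • f.1 x = conjBy (π σ⁻¹) (conjBy (π σ) a) • f.1 x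
    rw [conjBy_inv_conjBy]
  θ σ₂ σ₁ := NatIso.ofComponents (twistIso α hα σ₂ σ₁) (fun _ => rfl)
  θe := NatIso.ofComponents (twistOneIso α hα) (fun _ => rfl)
  assoc σ₃ σ₂ σ₁ A := twist_assoc α hα σ₃ σ₂ σ₁ A _
  unit_left σ A := twist_unit_left α hα σ A _
  unit_right σ A := twist_unit_right α hα σ A _

end GrMod

/-! ### Matrix factorizations -/

section TwistedFree

variable {Ghat : Type*} [Group Ghat] {π : Ghat →* ℤˣ} {R : Type w} [CommRing R] [Algebra ℂ R]

instance (α : GenAction π R) (σ : Ghat) (M : Type u) [AddCommGroup M] [Module R M]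
    [Module.Free R M] : Module.Free R (Twisted α σ M) := by
  have : RingHomInvPair (α.act σ) (α.act σ⁻¹) :=
    ⟨RingHom.ext fun r => α.act_inv_act σ r, RingHom.ext fun r => α.act_act_inv σ r⟩
  have : RingHomInvPair (α.act σ⁻¹) (α.act σ) :=
    ⟨RingHom.ext fun r => α.act_act_inv σ r, RingHom.ext fun r => α.act_inv_act σ r⟩
  exact Module.Free.of_equiv (M := M) (M' := Twisted α σ M) (σ := α.act σ) (σ' := α.act σ⁻¹)
    { toTwisted α σ M with
      map_smul' := fun r m => toTwisted_smul' α σ M r m }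

end TwistedFree

/-- A matrix factorization of `w ∈ R`: a free `ℤ/2`-graded `R`-module `M = M₀ ⊕ M₁` of finite rank
with an odd `R`-linear endomorphism `d` (the twisted differential) such that `d² = w · id`. -/
structure MF (R : Type w) [CommRing R] (w : R) where
  carrier : Type u
  [addCommGroup : AddCommGroup carrier]
  [module : Module R carrier]
  [free : Module.Free R carrier]
  [finite : Module.Finite R carrier]
  piece : ZMod 2 → Submodule R carrier
  isCompl : IsCompl (piece 0) (piece 1)
  d : carrier →ₗ[R] carrier
  d_mem : ∀ (i : ZMod 2) (m : carrier), m ∈ piece i → d m ∈ piece (i + 1)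
  d_d : ∀ m : carrier, d (d m) = w • m

namespace MF

attribute [instance] addCommGroup module free finite

variable {R : Type w} [CommRing R] {W : R}

/-- The `R`-linear maps `M → N` of degree `k`, that is, the degree `k` part of the complex
`Hom(M, N)`. -/
def degHoms (k : ZMod 2) (M N : MF.{u} R W) : Submodule R (M.carrier →ₗ[R] N.carrier) where
  carrier := {f | ∀ (i : ZMod 2) (m : M.carrier), m ∈ M.piece i → f m ∈ N.piece (i + k)}
  add_mem' hf hg i m hm := add_mem (hf i m hm) (hg i m hm)
  zero_mem' _ _ _ := zero_mem _
  smul_mem' c _ hf i m hm := (N.piece (i + k)).smul_mem c (hf i m hm)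

/-- The closed maps of degree zero: `D f = d_N ∘ f - f ∘ d_M = 0`. -/
def closed (M N : MF.{u} R W) : Submodule R (M.carrier →ₗ[R] N.carrier) where
  carrier := {f | f ∈ degHoms 0 M N ∧ N.d ∘ₗ f - f ∘ₗ M.d = 0}
  add_mem' {f g} hf hg := ⟨add_mem hf.1 hg.1, by
    rw [LinearMap.comp_add, LinearMap.add_comp, add_sub_add_comm, hf.2, hg.2, add_zero]⟩
  zero_mem' := ⟨zero_mem _, by rw [LinearMap.comp_zero, LinearMap.zero_comp, sub_zero]⟩
  smul_mem' c f hf := ⟨Submodule.smul_mem _ c hf.1, by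
    rw [LinearMap.comp_smul, LinearMap.smul_comp, ← smul_sub, hf.2, smul_zero]⟩

theorem closed_comm {M N : MF.{u} R W} {f : M.carrier →ₗ[R] N.carrier} (hf : f ∈ closed M N)
    (m : M.carrier) : N.d (f m) = f (M.d m) :=
  LinearMap.congr_fun (sub_eq_zero.1 hf.2) m

theorem closed_of_comm {M N : MF.{u} R W} {f : M.carrier →ₗ[R] N.carrier}
    (hf : ∀ (i : ZMod 2) (m : M.carrier), m ∈ M.piece i → f m ∈ N.piece i)
    (h : ∀ m, N.d (f m) = f (M.d m)) : f ∈ closed M N :=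
  ⟨fun i m hm => by rw [add_zero]; exact hf i m hm, sub_eq_zero.2 (LinearMap.ext h)⟩

theorem closed_mem {M N : MF.{u} R W} {f : M.carrier →ₗ[R] N.carrier} (hf : f ∈ closed M N)
    (i : ZMod 2) (m : M.carrier) (hm : m ∈ M.piece i) : f m ∈ N.piece i := by
  have h := hf.1 i m hm
  rwa [add_zero] at h

/-- The category `Z⁰(MF(R, w))` of matrix factorizations and closed morphisms of degree zero. -/
instance : Category (MF.{u} R W) where
  Hom M N := closed M N
  id M := ⟨LinearMap.id, closed_of_comm (fun _ _ h => h) (fun _ => rfl)⟩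
  comp f g := ⟨g.1.comp f.1, closed_of_comm
    (fun i m hm => closed_mem g.2 i _ (closed_mem f.2 i m hm))
    (fun m => by
      rw [LinearMap.comp_apply, LinearMap.comp_apply, closed_comm g.2, closed_comm f.2])⟩

instance : Preadditive (MF.{u} R W) where
  homGroup M N := inferInstanceAs (AddCommGroup (closed M N))
  add_comp _ _ _ f f' g := Subtype.ext (LinearMap.comp_add f.1 f'.1 g.1)
  comp_add _ _ _ f g g' := Subtype.ext (LinearMap.add_comp f.1 g'.1 g.1)

instance : Linear R (MF.{u} R W) where
  homModule M N := inferInstanceAs (Module R (closed M N))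
  smul_comp _ _ _ r f g := Subtype.ext (LinearMap.ext fun m => g.1.map_smul r (f.1 m))
  comp_smul _ _ _ _ _ _ := rfl

theorem hom_ext {M N : MF.{u} R W} {f g : M ⟶ N} (h : ∀ m, f.1 m = g.1 m) : f = g :=
  Subtype.ext (LinearMap.ext h)

/-- A closed `R`-linear bijection of degree zero is an isomorphism. -/
def mkIso {M N : MF.{u} R W} (e : M.carrier ≃ₗ[R] N.carrier)
    (h : ∀ (i : ZMod 2) (m : M.carrier), m ∈ M.piece i → e m ∈ N.piece i)
    (h' : ∀ (i : ZMod 2) (n : N.carrier), n ∈ N.piece i → e.symm n ∈ M.piece i)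
    (hd : ∀ m, N.d (e m) = e (M.d m)) : M ≅ N where
  hom := ⟨e, closed_of_comm h hd⟩
  inv := ⟨e.symm, closed_of_comm h' fun n => e.injective (by
    change e (M.d (e.symm n)) = e (e.symm (N.d n))
    rw [← hd, e.apply_symm_apply, e.apply_symm_apply])⟩
  hom_inv_id := hom_ext fun a => e.symm_apply_apply a
  inv_hom_id := hom_ext fun b => e.apply_symm_apply b

variable [Algebra ℂ R]

/-- The `ℂ`-linear structure, by restriction along `ℂ → R`. -/
instance : Linear ℂ (MF.{u} R W) where
  homModule M N := Module.compHom (M ⟶ N) (algebraMap ℂ R)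
  smul_comp _ _ _ r f g := Linear.smul_comp _ _ _ (algebraMap ℂ R r) f g
  comp_smul _ _ _ f r g := Linear.comp_smul _ _ _ f (algebraMap ℂ R r) g

/-- The ideal of null-homotopic morphisms, that is, of the morphisms
`D h = d_N ∘ h + h ∘ d_M` with `h` of odd degree. -/
def nullHomotopic : HomIdeal (MF.{u} R W) where
  I M N :=
    { carrier := {f | ∃ h ∈ degHoms 1 M N, f.1 = N.d ∘ₗ h + h ∘ₗ M.d}
      add_mem' := by
        rintro f g ⟨h, hh, hf⟩ ⟨k, hk, hg⟩
        refine ⟨h + k, add_mem hh hk, ?_⟩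
        change f.1 + g.1 = _
        rw [hf, hg, LinearMap.comp_add, LinearMap.add_comp, add_add_add_comm]
      zero_mem' := ⟨0, zero_mem _, by
        rw [LinearMap.comp_zero, LinearMap.zero_comp, add_zero]; rfl⟩
      smul_mem' := by
        rintro c f ⟨h, hh, hf⟩
        refine ⟨algebraMap ℂ R c • h, Submodule.smul_mem _ _ hh, ?_⟩
        change algebraMap ℂ R c • f.1 = _
        rw [hf, LinearMap.comp_smul, LinearMap.smul_comp, smul_add] }
  comp_left := by
    rintro X Y Z f g ⟨h, hh, hg⟩
    refine ⟨h ∘ₗ f.1, fun i m hm => hh i _ (closed_mem f.2 i m hm), LinearMap.ext fun m => ?_⟩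
    change g.1 (f.1 m) = Z.d (h (f.1 m)) + h (f.1 (X.d m))
    rw [hg, ← closed_comm f.2]
    rfl
  comp_right := by
    rintro X Y Z f g ⟨h, hh, hf⟩
    refine ⟨g.1 ∘ₗ h, fun i m hm => closed_mem g.2 _ _ (hh i m hm), LinearMap.ext fun m => ?_⟩
    change g.1 (f.1 m) = Z.d (g.1 (h m)) + g.1 (h (X.d m))
    rw [hf, closed_comm g.2]
    exact map_add g.1 _ _

variable {Ghat : Type*} [Group Ghat] {π : Ghat →* ℤˣ}

/-- The twisted matrix factorization `(M^σ, d^σ)`: the abelian group `M` with its grading and with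
the module structure `r · m = σ⁻¹(r) m`, and `d^σ = d` as a map. It is a matrix factorization of
`σ(w) = w`. -/
def twist (α : GenAction π R) (hW : ∀ σ, α.act σ W = W) (σ : Ghat) (M : MF.{u} R W) :
    MF.{u} R W where
  carrier := Twisted α σ M.carrier
  piece i :=
    { carrier := (M.piece i : Set M.carrier)
      add_mem' := fun ha hb => (M.piece i).add_mem ha hb
      zero_mem' := (M.piece i).zero_mem
      smul_mem' := fun c _ ha => (M.piece i).smul_mem (α.act σ⁻¹ c) ha }
  isCompl := by
    have h := M.isCompl
    refine ⟨?_, ?_⟩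
    · rw [Submodule.disjoint_def]
      intro a h₀ h₁
      exact Submodule.disjoint_def.1 h.disjoint a h₀ h₁
    · rw [codisjoint_iff, eq_top_iff]
      intro a _
      obtain ⟨b, c, hb, hc, h⟩ := Submodule.codisjoint_iff_exists_add_eq.1 h.codisjoint a
      exact Submodule.mem_sup.2 ⟨b, hb, c, hc, h⟩
  d :=
    { toFun := fun m => M.d (show M.carrier from m)
      map_add' := fun a b => M.d.map_add (show M.carrier from a) (show M.carrier from b)
      map_smul' := fun r m => M.d.map_smul (α.act σ⁻¹ r) (show M.carrier from m) }
  d_mem i m hm := M.d_mem i m hm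
  d_d m := by
    change M.d (M.d (show M.carrier from m)) = α.act σ⁻¹ W • (show M.carrier from m)
    rw [hW, M.d_d]

variable (α : GenAction π R) (hW : ∀ σ, α.act σ W = W)

/-- The functor `M ↦ M^σ`, `f ↦ f` on matrix factorizations. -/
def twistFunctor (σ : Ghat) : MF.{u} R W ⥤ MF.{u} R W where
  obj M := M.twist α hW σ
  map {M N} f :=
    ⟨{ toFun := fun a => (f.1 : M.carrier → N.carrier) a
       map_add' := fun a b => f.1.map_add a b
       map_smul' := fun s a => f.1.map_smul (α.act σ⁻¹ s) a },
      closed_of_comm (fun i m hm => closed_mem f.2 i m hm) (fun m => closed_comm f.2 m)⟩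

theorem twist_eqToHom {σ τ : Ghat} (h : σ = τ) (M : MF.{u} R W)
    (h' : M.twist α hW σ = M.twist α hW τ) (m : M.carrier) :
    ((eqToHom h').1 : M.carrier → M.carrier) m = m := by
  subst h; rfl

/-- The identity map of underlying abelian groups, as an isomorphism `(M^σ₁)^σ₂ ≅ M^(σ₂ σ₁)`. -/
def twistIso (σ₂ σ₁ : Ghat) (M : MF.{u} R W) :
    (M.twist α hW σ₁).twist α hW σ₂ ≅ M.twist α hW (σ₂ * σ₁) :=
  mkIso
    { toFun := fun a => (show M.carrier from a)
      invFun := fun a => (show M.carrier from a)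
      map_add' := fun _ _ => rfl
      map_smul' := fun s a => by
        change α.act σ₁⁻¹ (α.act σ₂⁻¹ s) • (show M.carrier from a) =
          α.act (σ₂ * σ₁)⁻¹ s • (show M.carrier from a)
        rw [mul_inv_rev, α.act_mul_apply]
      left_inv := fun _ => rfl
      right_inv := fun _ => rfl }
    (fun _ _ h => h) (fun _ _ h => h) (fun _ => rfl)

/-- The identity map of underlying abelian groups, as an isomorphism `M^e ≅ M`. -/
def twistOneIso (M : MF.{u} R W) : M.twist α hW 1 ≅ M :=
  mkIso
    { toFun := fun a => (show M.carrier from a)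
      invFun := fun a => (show M.carrier from a)
      map_add' := fun _ _ => rfl
      map_smul' := fun s a => by
        change α.act 1⁻¹ s • (show M.carrier from a) = s • (show M.carrier from a)
        rw [inv_one, α.act_one_apply]
      left_inv := fun _ => rfl
      right_inv := fun _ => rfl }
    (fun _ _ h => h) (fun _ _ h => h) (fun _ => rfl)

theorem twist_assoc (σ₃ σ₂ σ₁ : Ghat) (M : MF.{u} R W)
    (h : M.twist α hW (σ₃ * σ₂ * σ₁) = M.twist α hW (σ₃ * (σ₂ * σ₁))) :
    (twistIso α hW σ₃ σ₂ (M.twist α hW σ₁)).hom ≫ (twistIso α hW (σ₃ * σ₂) σ₁ M).hom ≫ eqToHom h =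
      (twistFunctor α hW σ₃).map (twistIso α hW σ₂ σ₁ M).hom ≫
        (twistIso α hW σ₃ (σ₂ * σ₁) M).hom :=
  hom_ext fun a => twist_eqToHom α hW (mul_assoc σ₃ σ₂ σ₁) M h a

theorem twist_unit_left (σ : Ghat) (M : MF.{u} R W)
    (h : M.twist α hW (1 * σ) = M.twist α hW σ) :
    (twistIso α hW 1 σ M).hom ≫ eqToHom h = (twistOneIso α hW (M.twist α hW σ)).hom :=
  hom_ext fun a => twist_eqToHom α hW (one_mul σ) M h a

theorem twist_unit_right (σ : Ghat) (M : MF.{u} R W)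
    (h : M.twist α hW (σ * 1) = M.twist α hW σ) :
    (twistIso α hW σ 1 M).hom ≫ eqToHom h = (twistFunctor α hW σ).map (twistOneIso α hW M).hom :=
  hom_ext fun a => twist_eqToHom α hW (mul_one σ) M h a

/-- The Real 2-representation of `G` on `Z⁰(MF(R, w))` defined by the functors `M ↦ M^σ`, with
identity maps of underlying abelian groups as coherence isomorphisms. -/
def twoRep : RealTwoRep π (MF.{u} R W) where
  ρ := twistFunctor α hW
  map_add _ _ _ _ _ := rfl
  map_smul σ M N a f := hom_ext fun x => by
    change algebraMap ℂ R a • (show N.carrier from f.1 x) =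
      α.act σ⁻¹ (algebraMap ℂ R (conjBy (π σ) a)) • (show N.carrier from f.1 x)
    rw [α.act_algebraMap, conjBy_inv_conjBy]
  θ σ₂ σ₁ := NatIso.ofComponents (twistIso α hW σ₂ σ₁) (fun _ => rfl)
  θe := NatIso.ofComponents (twistOneIso α hW) (fun _ => rfl)
  assoc σ₃ σ₂ σ₁ M := twist_assoc α hW σ₃ σ₂ σ₁ M _
  unit_left σ M := twist_unit_left α hW σ M _
  unit_right σ M := twist_unit_right α hW σ M _

theorem nullHomotopic_stable : (nullHomotopic (R := R) (W := W)).Stable (twoRep.{u} α hW) := by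
  rintro σ M N f ⟨h, hh, hf⟩
  refine ⟨{ toFun := fun a => (h : M.carrier → N.carrier) a
            map_add' := fun a b => h.map_add a b
            map_smul' := fun s a => h.map_smul (α.act σ⁻¹ s) a },
    fun i m hm => hh i m hm, LinearMap.ext fun m => ?_⟩
  exact LinearMap.congr_fun hf m

end MF

/-- The homotopy category `HMF(R, w) = H⁰(MF(R, w))` of matrix factorizations. -/
abbrev HMF (R : Type w) [CommRing R] [Algebra ℂ R] (W : R) :=
  (MF.nullHomotopic.{u} (R := R) (W := W)).Quot

/-- The Real 2-representation of `G` on `HMF(R, w)` induced by the one on `MF(R, w)`. -/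
def HMF.twoRep {R : Type w} [CommRing R] [Algebra ℂ R] {W : R} {Ghat : Type*} [Group Ghat]
    {π : Ghat →* ℤˣ} (α : GenAction π R) (hW : ∀ σ, α.act σ W = W) : RealTwoRep π (HMF.{u} R W) :=
  (MF.twoRep.{u} α hW).quotient (MF.nullHomotopic_stable.{u} α hW)

/-! ### Clifford algebras -/

section Clifford

variable {V : Type v} [AddCommGroup V] [Module ℂ V] (Q : QuadraticForm ℂ V)

/-- The ring homomorphism `Cl(V, Q) → T` which restricts to `φ` on scalars and to the
`φ`-semilinear map `f` on `V`. -/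
def semiLift {T : Type*} [Ring T] (φ : ℂ →+* T) (hφ : ∀ c t, φ c * t = t * φ c) (f : V →+ T)
    (hf : ∀ c v, f (c • v) = φ c * f v) (hQ : ∀ v, f v * f v = φ (Q v)) :
    CliffordAlgebra Q →+* T :=
  letI : Algebra ℂ T := φ.toAlgebra' hφ
  (CliffordAlgebra.lift Q ⟨{ f with map_smul' := hf }, hQ⟩ : CliffordAlgebra Q →ₐ[ℂ] T).toRingHom

theorem semiLift_algebraMap {T : Type*} [Ring T] (φ : ℂ →+* T) (hφ : ∀ c t, φ c * t = t * φ c)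
    (f : V →+ T) (hf : ∀ c v, f (c • v) = φ c * f v) (hQ : ∀ v, f v * f v = φ (Q v)) (c : ℂ) :
    semiLift Q φ hφ f hf hQ (algebraMap ℂ _ c) = φ c :=
  letI : Algebra ℂ T := φ.toAlgebra' hφ
  AlgHom.commutes (CliffordAlgebra.lift Q ⟨{ f with map_smul' := hf }, hQ⟩) c

theorem semiLift_ι {T : Type*} [Ring T] (φ : ℂ →+* T) (hφ : ∀ c t, φ c * t = t * φ c)
    (f : V →+ T) (hf : ∀ c v, f (c • v) = φ c * f v) (hQ : ∀ v, f v * f v = φ (Q v)) (v : V) :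
    semiLift Q φ hφ f hf hQ (CliffordAlgebra.ι Q v) = f v :=
  letI : Algebra ℂ T := φ.toAlgebra' hφ
  CliffordAlgebra.lift_ι_apply (Q := Q) { f with map_smul' := hf } hQ v

theorem clifford_ringHom_ext {T : Type*} [Ring T] {f g : CliffordAlgebra Q →+* T}
    (h : ∀ c, f (algebraMap ℂ _ c) = g (algebraMap ℂ _ c))
    (h' : ∀ v, f (CliffordAlgebra.ι Q v) = g (CliffordAlgebra.ι Q v)) : f = g := by
  ext x
  induction x using CliffordAlgebra.induction with
  | algebraMap c => exact h c
  | ι v => exact h' v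
  | mul a b ha hb => rw [map_mul, map_mul, ha, hb]
  | add a b ha hb => rw [map_add, map_add, ha, hb]

variable {Ghat : Type*} [Group Ghat] {π : Ghat →* ℤˣ} (ρ : RealRep π V)

/-- The quadratic form `Q` is `Ĝ`-invariant: `Q(σ v)` is `Q(v)` if `π σ = 1` and the complex
conjugate of `Q(v)` if `π σ = -1`. -/
def RealRep.Invariant : Prop := ∀ (σ : Ghat) (v : V), Q (ρ.act σ v) = conjBy (π σ) (Q v)

variable {Q ρ}

/-- The generalized algebra automorphism of `Cl(V, Q)` which extends the action of `σ` on `V`. -/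
def cliffordMap (hQ : ρ.Invariant Q) (σ : Ghat) : CliffordAlgebra Q →+* CliffordAlgebra Q :=
  semiLift Q ((algebraMap ℂ (CliffordAlgebra Q)).comp (conjBy (π σ)))
    (fun c t => Algebra.commutes (conjBy (π σ) c) t)
    ((CliffordAlgebra.ι Q).toAddMonoidHom.comp (ρ.act σ))
    (fun c v => by
      change CliffordAlgebra.ι Q (ρ.act σ (c • v)) =
        algebraMap ℂ _ (conjBy (π σ) c) * CliffordAlgebra.ι Q (ρ.act σ v)
      rw [ρ.act_smul, map_smul, Algebra.smul_def])
    (fun v => by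
      change CliffordAlgebra.ι Q (ρ.act σ v) * CliffordAlgebra.ι Q (ρ.act σ v) =
        algebraMap ℂ _ (conjBy (π σ) (Q v))
      rw [CliffordAlgebra.ι_sq_scalar, hQ])

theorem cliffordMap_algebraMap (hQ : ρ.Invariant Q) (σ : Ghat) (c : ℂ) :
    cliffordMap hQ σ (algebraMap ℂ _ c) = algebraMap ℂ _ (conjBy (π σ) c) :=
  semiLift_algebraMap ..

theorem cliffordMap_ι (hQ : ρ.Invariant Q) (σ : Ghat) (v : V) :
    cliffordMap hQ σ (CliffordAlgebra.ι Q v) = CliffordAlgebra.ι Q (ρ.act σ v) :=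
  semiLift_ι ..

/-- The action of `Ĝ` on `Cl(V, Q)` by generalized algebra automorphisms. -/
def cliffordAction (hQ : ρ.Invariant Q) : GenAction π (CliffordAlgebra Q) where
  act :=
    { toFun := cliffordMap hQ
      map_one' := clifford_ringHom_ext Q
        (fun c => by rw [cliffordMap_algebraMap, map_one, conjBy_one]; rfl)
        (fun v => by rw [cliffordMap_ι, map_one]; rfl)
      map_mul' := fun σ τ => clifford_ringHom_ext Q
        (fun c => by
          change _ = cliffordMap hQ σ (cliffordMap hQ τ _)
          rw [cliffordMap_algebraMap, cliffordMap_algebraMap, cliffordMap_algebraMap, map_mul,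
            conjBy_mul])
        (fun v => by
          change _ = cliffordMap hQ σ (cliffordMap hQ τ _)
          rw [cliffordMap_ι, cliffordMap_ι, cliffordMap_ι, map_mul]
          rfl) }
  act_smul σ a s := by
    change cliffordMap hQ σ (a • s) = _ • cliffordMap hQ σ s
    rw [Algebra.smul_def, map_mul, cliffordMap_algebraMap, ← Algebra.smul_def]

theorem cliffordAction_evenOdd (hQ : ρ.Invariant Q) (σ : Ghat) (i : ZMod 2) (s : CliffordAlgebra Q)
    (hs : s ∈ CliffordAlgebra.evenOdd Q i) :
    (cliffordAction hQ).act σ s ∈ CliffordAlgebra.evenOdd Q i := by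
  change cliffordMap hQ σ s ∈ _
  have key : ∀ (m₁ m₂ : V) (j : ZMod 2) (x : CliffordAlgebra Q),
      cliffordMap hQ σ x ∈ CliffordAlgebra.evenOdd Q j →
      cliffordMap hQ σ (CliffordAlgebra.ι Q m₁ * CliffordAlgebra.ι Q m₂ * x) ∈
        CliffordAlgebra.evenOdd Q j := by
    intro m₁ m₂ j x hx
    rw [map_mul, map_mul, cliffordMap_ι, cliffordMap_ι]
    have h := SetLike.mul_mem_graded
      (CliffordAlgebra.ι_mul_ι_mem_evenOdd_zero Q (ρ.act σ m₁) (ρ.act σ m₂)) hx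
    rwa [zero_add] at h
  have hi : ∀ k : ZMod 2, k = 0 ∨ k = 1 := by decide
  rcases hi i with rfl | rfl
  · induction s, hs using CliffordAlgebra.even_induction with
    | algebraMap c =>
      rw [cliffordMap_algebraMap]
      exact SetLike.algebraMap_mem_graded _ _
    | add x y _ _ hx hy => rw [map_add]; exact add_mem hx hy
    | ι_mul_ι_mul m₁ m₂ x _ hx => exact key m₁ m₂ 0 x hx
  · induction s, hs using CliffordAlgebra.odd_induction with
    | ι v =>
      rw [cliffordMap_ι]
      exact CliffordAlgebra.ι_mem_evenOdd_one _ _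
    | add x y _ _ hx hy => rw [map_add]; exact add_mem hx hy
    | ι_mul_ι_mul m₁ m₂ x _ hx => exact key m₁ m₂ 1 x hx

variable (Q) in
/-- The category `Cl(V, Q)-grmod` of finitely generated `ℤ/2`-graded left `Cl(V, Q)`-modules and
`Cl(V, Q)`-linear maps of degree zero. -/
abbrev ClMod := GrMod.{u} (CliffordAlgebra.evenOdd Q)

/-- The Real 2-representation of `G` on `Cl(V, Q)-grmod`. -/
def ClMod.twoRep (hQ : ρ.Invariant Q) : RealTwoRep π (ClMod.{u} Q) :=
  GrMod.twoRep (cliffordAction hQ) (cliffordAction_evenOdd hQ)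

/-- The Clifford algebra of a finite dimensional vector space is finite dimensional. -/
theorem finite_clifford [FiniteDimensional ℂ V] : Module.Finite ℂ (CliffordAlgebra Q) := by
  have step : ∀ l : List V, ∃ W : Submodule ℂ (CliffordAlgebra Q), W.FG ∧ 1 ∈ W ∧
      ∀ v ∈ l, ∀ x ∈ W, CliffordAlgebra.ι Q v * x ∈ W := by
    intro l
    induction l with
    | nil => exact ⟨Submodule.span ℂ {1}, Submodule.fg_span_singleton 1,
        Submodule.subset_span rfl, fun v hv => absurd hv List.not_mem_nil⟩
    | cons v l ih =>
      obtain ⟨W, hW, h1, hl⟩ := ih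
      let f := LinearMap.mulLeft ℂ (CliffordAlgebra.ι Q v)
      refine ⟨W ⊔ W.map f, hW.sup (hW.map f), Submodule.mem_sup_left h1, ?_⟩
      have hin : ∀ x ∈ W, CliffordAlgebra.ι Q v * x ∈ W ⊔ W.map f := fun x hx =>
        Submodule.mem_sup_right ⟨x, hx, rfl⟩
      intro u hu x hx
      obtain ⟨y, hy, _, ⟨z, hz, rfl⟩, rfl⟩ := Submodule.mem_sup.1 hx
      change CliffordAlgebra.ι Q u * (y + CliffordAlgebra.ι Q v * z) ∈ _
      rw [mul_add]
      rcases List.mem_cons.1 hu with rfl | hu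
      · refine add_mem (hin y hy) (Submodule.mem_sup_left ?_)
        rw [← mul_assoc, CliffordAlgebra.ι_sq_scalar, ← Algebra.smul_def]
        exact W.smul_mem _ hz
      · refine add_mem (Submodule.mem_sup_left (hl u hu y hy)) ?_
        rw [← mul_assoc, CliffordAlgebra.ι_mul_ι_comm, sub_mul, ← Algebra.smul_def, mul_assoc]
        exact sub_mem (Submodule.mem_sup_left (W.smul_mem _ hz)) (hin _ (hl u hu z hz))
  let b := Module.finBasis ℂ V
  obtain ⟨W, hW, h1, hl⟩ := step (List.ofFn b)
  have hι : ∀ (v : V) (x : CliffordAlgebra Q), x ∈ W → CliffordAlgebra.ι Q v * x ∈ W := by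
    intro v x hx
    rw [← b.sum_repr v, map_sum, Finset.sum_mul]
    refine sum_mem fun i _ => ?_
    rw [map_smul, smul_mul_assoc]
    exact W.smul_mem _ (hl _ (List.mem_ofFn.2 ⟨i, rfl⟩) x hx)
  refine ⟨?_⟩
  have : W = ⊤ := by
    rw [eq_top_iff]
    intro x _
    induction x using CliffordAlgebra.left_induction with
    | algebraMap c => rw [Algebra.algebraMap_eq_smul_one]; exact W.smul_mem _ h1
    | add x y hx hy => exact add_mem (hx trivial) (hy trivial)
    | ι_mul x v hx => exact hι v x (hx trivial)
  rwa [this] at hW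

end Clifford

/-! ### The completed symmetric algebra of `V^∨` -/

section CompletedSym

variable {V : Type v} [AddCommGroup V] [Module ℂ V] {n : ℕ} (b : Module.Basis (Fin n) ℂ V)

/-- The completed symmetric algebra of `V^∨` in the coordinates dual to a basis of `V`, that is,
the power series ring `ℂ⟦x₁, …, xₙ⟧`. -/
abbrev CSym (n : ℕ) : Type := MvPowerSeries (Fin n) ℂ

/-- The canonical inclusion `V^∨ → Ŝym V^∨`: a linear form `L` is sent to `∑ j, L(bⱼ) xⱼ`. -/
def linForm : Module.Dual ℂ V →ₗ[ℂ] CSym n where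
  toFun L := ∑ j, L (b j) • MvPowerSeries.X j
  map_add' L L' := by
    rw [← Finset.sum_add_distrib]
    exact Finset.sum_congr rfl fun j _ => add_smul _ _ _
  map_smul' c L := by
    rw [Finset.smul_sum]
    exact Finset.sum_congr rfl fun j _ => mul_smul _ _ _

/-- The quadratic form `Q ∈ Sym² V^∨` as a power series: `∑ i j, B(bᵢ, bⱼ) xᵢ xⱼ` where `B` is the
symmetric bilinear form with `B(v, v) = Q(v)`. -/
def quadSeries (Q : QuadraticForm ℂ V) : CSym n :=
  ∑ i, ∑ j, QuadraticMap.associated (R := ℂ) Q (b i) (b j) •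
    (MvPowerSeries.X i * MvPowerSeries.X j : CSym n)

variable {Ghat : Type*} [Group Ghat] {π : Ghat →* ℤˣ}

/-- The dual Real representation: `(σ L)(v)` is `L(σ⁻¹ v)` if `π σ = 1` and its complex conjugate if
`π σ = -1`. -/
def RealRep.dual (ρ : RealRep π V) : RealRep π (Module.Dual ℂ V) where
  act :=
    { toFun := fun σ =>
        { toFun := fun L =>
            { toFun := fun v => conjBy (π σ) (L (ρ.act σ⁻¹ v))
              map_add' := fun v v' => by rw [map_add, map_add, map_add]
              map_smul' := fun c v => by
                rw [ρ.act_smul, map_smul, smul_eq_mul, map_mul, conjBy_conjBy_inv]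
                rfl }
          map_zero' := LinearMap.ext fun v => map_zero (conjBy (π σ))
          map_add' := fun L L' => LinearMap.ext fun v => map_add (conjBy (π σ)) _ _ }
      map_one' := AddMonoidHom.ext fun L => LinearMap.ext fun v => by
        change conjBy (π 1) (L (ρ.act 1⁻¹ v)) = L v
        rw [inv_one, map_one, map_one, conjBy_one]
        rfl
      map_mul' := fun σ τ => AddMonoidHom.ext fun L => LinearMap.ext fun v => by
        change conjBy (π (σ * τ)) (L (ρ.act (σ * τ)⁻¹ v)) =
          conjBy (π σ) (conjBy (π τ) (L (ρ.act τ⁻¹ (ρ.act σ⁻¹ v))))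
        rw [mul_inv_rev, map_mul, map_mul, conjBy_mul]
        rfl }
  act_smul σ a L := LinearMap.ext fun v => map_mul (conjBy (π σ)) a _

variable (ρ : RealRep π V)

theorem RealRep.dual_apply (σ : Ghat) (L : Module.Dual ℂ V) (v : V) :
    ρ.dual.act σ L v = conjBy (π σ) (L (ρ.act σ⁻¹ v)) := rfl

theorem constantCoeff_linForm (L : Module.Dual ℂ V) :
    MvPowerSeries.constantCoeff (linForm b L) = 0 := by
  change MvPowerSeries.constantCoeff (∑ j, L (b j) • MvPowerSeries.X j) = 0
  rw [map_sum]
  refine Finset.sum_eq_zero fun j _ => ?_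
  rw [MvPowerSeries.smul_eq_C_mul, map_mul, MvPowerSeries.constantCoeff_X, mul_zero]

theorem hasSubst_linForm (L : Fin n → Module.Dual ℂ V) :
    MvPowerSeries.HasSubst (fun i => linForm b (L i)) :=
  MvPowerSeries.hasSubst_of_constantCoeff_zero fun i => constantCoeff_linForm b (L i)

/-- The generalized algebra automorphism of `Ŝym V^∨` which extends the action of `σ` on `V^∨`:
it applies `conjBy (π σ)` to the coefficients of a power series and replaces each coordinate `xᵢ`
by the linear form `σ(xᵢ)`. -/
def csymMap (σ : Ghat) : CSym n →+* CSym n :=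
  (MvPowerSeries.substAlgHom (R := ℂ)
    (hasSubst_linForm b fun i => ρ.dual.act σ (b.coord i))).toRingHom.comp
    (MvPowerSeries.map (conjBy (π σ)))

theorem csymMap_apply (σ : Ghat) (f : CSym n) :
    csymMap b ρ σ f = MvPowerSeries.subst (fun i => linForm b (ρ.dual.act σ (b.coord i)))
      (MvPowerSeries.map (conjBy (π σ)) f) :=
  MvPowerSeries.substAlgHom_apply (hasSubst_linForm b _) _

theorem csymMap_smul (σ : Ghat) (c : ℂ) (f : CSym n) :
    csymMap b ρ σ (c • f) = conjBy (π σ) c • csymMap b ρ σ f := by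
  have h : MvPowerSeries.map (conjBy (π σ)) (c • f) =
      conjBy (π σ) c • MvPowerSeries.map (conjBy (π σ)) f := by
    rw [MvPowerSeries.smul_eq_C_mul, map_mul, MvPowerSeries.map_C, MvPowerSeries.smul_eq_C_mul]
  rw [csymMap_apply, h, csymMap_apply, MvPowerSeries.subst_smul (hasSubst_linForm b _)]

theorem csymMap_X (σ : Ghat) (i : Fin n) :
    csymMap b ρ σ (MvPowerSeries.X i) = linForm b (ρ.dual.act σ (b.coord i)) := by
  rw [csymMap_apply, MvPowerSeries.map_X, MvPowerSeries.subst_X (hasSubst_linForm b _)]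

theorem dual_eq_sum (L : Module.Dual ℂ V) : L = ∑ i, L (b i) • b.coord i :=
  (b.sum_dual_apply_smul_coord L).symm

theorem csymMap_linForm (σ : Ghat) (L : Module.Dual ℂ V) :
    csymMap b ρ σ (linForm b L) = linForm b (ρ.dual.act σ L) := by
  conv_rhs => rw [dual_eq_sum b L]
  change csymMap b ρ σ (∑ j, L (b j) • MvPowerSeries.X j) = _
  rw [map_sum, map_sum, map_sum]
  refine Finset.sum_congr rfl fun i _ => ?_
  rw [csymMap_smul, csymMap_X, ρ.dual.act_smul, map_smul]

theorem csymMap_mul (σ τ : Ghat) (f : CSym n) :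
    csymMap b ρ (σ * τ) f = csymMap b ρ σ (csymMap b ρ τ f) := by
  rw [csymMap_apply, csymMap_apply b ρ τ, csymMap_apply b ρ σ,
    MvPowerSeries.map_subst (hasSubst_linForm b _),
    MvPowerSeries.subst_comp_subst_apply ((hasSubst_linForm b _).map _) (hasSubst_linForm b _)]
  congr 1
  · funext i
    rw [← csymMap_apply, csymMap_linForm, map_mul]
    rfl
  · ext m
    rw [MvPowerSeries.coeff_map, MvPowerSeries.coeff_map, MvPowerSeries.coeff_map, map_mul,
      conjBy_mul]

theorem linForm_coord (i : Fin n) : linForm b (b.coord i) = MvPowerSeries.X i := by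
  change ∑ j, b.coord i (b j) • MvPowerSeries.X j = _
  rw [Finset.sum_eq_single i]
  · rw [b.coord_apply, b.repr_self, Finsupp.single_eq_same, one_smul]
  · intro j _ hj
    rw [b.coord_apply, b.repr_self, Finsupp.single_eq_of_ne hj.symm, zero_smul]
  · exact fun h => absurd (Finset.mem_univ i) h

theorem csymMap_one (f : CSym n) : csymMap b ρ 1 f = f := by
  have h : (fun i => linForm b (ρ.dual.act 1 (b.coord i))) = MvPowerSeries.X := by
    funext i
    rw [map_one]
    exact linForm_coord b i
  rw [csymMap_apply, h, MvPowerSeries.subst_self, map_one, conjBy_one, MvPowerSeries.map_id]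
  rfl

/-- The action of `Ĝ` on `Ŝym V^∨` by generalized algebra automorphisms. -/
def csymAction : GenAction π (CSym n) where
  act :=
    { toFun := csymMap b ρ
      map_one' := RingHom.ext fun f => csymMap_one b ρ f
      map_mul' := fun σ τ => RingHom.ext fun f => csymMap_mul b ρ σ τ f }
  act_smul := csymMap_smul b ρ

variable {ρ} {Q : QuadraticForm ℂ V}

theorem associated_invariant (hQ : ρ.Invariant Q) (σ : Ghat) (v v' : V) :
    QuadraticMap.associated (R := ℂ) Q (ρ.act σ v) (ρ.act σ v') =
      conjBy (π σ) (QuadraticMap.associated (R := ℂ) Q v v') := by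
  have h : ∀ x y : V, QuadraticMap.associated (R := ℂ) Q x y =
      (1 / 2 : ℂ) * (Q (x + y) - Q x - Q y) := by
    intro x y
    have := DFunLike.congr_fun (DFunLike.congr_fun (QuadraticMap.two_nsmul_associated ℂ Q) x) y
    change 2 • QuadraticMap.associated (R := ℂ) Q x y = Q (x + y) - Q x - Q y at this
    rw [← this, two_nsmul]
    ring
  have h2 : conjBy (π σ) (1 / 2 : ℂ) = 1 / 2 := by
    have := conjBy_ofReal (π σ) (1 / 2)
    simpa using this
  rw [h, h, ← map_add, hQ, hQ, hQ, map_mul, map_sub, map_sub, h2]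

/-- An invariant quadratic form is an invariant element of `Ŝym V^∨`. -/
theorem csymAction_quadSeries (hQ : ρ.Invariant Q) (σ : Ghat) :
    (csymAction b ρ).act σ (quadSeries b Q) = quadSeries b Q := by
  change csymMap b ρ σ (quadSeries b Q) = _
  set B := QuadraticMap.associated (R := ℂ) Q with hB
  have hv : ∀ v : V, v = ∑ i, (ρ.dual.act σ (b.coord i) v) • ρ.act σ (b i) := by
    intro v
    conv_lhs => rw [← ρ.act_act_inv σ v, ← b.sum_repr (ρ.act σ⁻¹ v), map_sum]
    exact Finset.sum_congr rfl fun i _ => ρ.act_smul σ _ _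
  have hl : csymMap b ρ σ (quadSeries b Q) = ∑ i, ∑ j, ∑ k, ∑ l,
      (B (ρ.act σ (b i)) (ρ.act σ (b j)) * (ρ.dual.act σ (b.coord i) (b k) *
        ρ.dual.act σ (b.coord j) (b l))) •
        (MvPowerSeries.X k * MvPowerSeries.X l : CSym n) := by
    rw [quadSeries, map_sum]
    refine Finset.sum_congr rfl fun i _ => ?_
    rw [map_sum]
    refine Finset.sum_congr rfl fun j _ => ?_
    rw [csymMap_smul, map_mul, csymMap_X, csymMap_X, ← associated_invariant hQ]
    change _ • ((∑ k, _ • MvPowerSeries.X k) * ∑ l, _ • MvPowerSeries.X l) = _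
    rw [Finset.sum_mul_sum, Finset.smul_sum]
    refine Finset.sum_congr rfl fun k _ => ?_
    rw [Finset.smul_sum]
    refine Finset.sum_congr rfl fun l _ => ?_
    rw [smul_mul_smul_comm, smul_smul]
  have hr : quadSeries b Q = ∑ k, ∑ l, ∑ i, ∑ j,
      (B (ρ.act σ (b i)) (ρ.act σ (b j)) * (ρ.dual.act σ (b.coord i) (b k) *
        ρ.dual.act σ (b.coord j) (b l))) •
        (MvPowerSeries.X k * MvPowerSeries.X l : CSym n) := by
    rw [quadSeries]
    refine Finset.sum_congr rfl fun k _ => Finset.sum_congr rfl fun l _ => ?_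
    conv_lhs => rw [← hB, hv (b k), hv (b l), LinearMap.map_sum₂, Finset.sum_smul]
    refine Finset.sum_congr rfl fun i _ => ?_
    rw [map_sum, Finset.sum_smul]
    refine Finset.sum_congr rfl fun j _ => ?_
    rw [map_smul, map_smul, LinearMap.smul_apply, smul_eq_mul, smul_eq_mul]
    congr 1
    ring
  rw [hl, hr]
  have e₁ : ∀ F : Fin n → Fin n → Fin n → Fin n → CSym n,
      ∑ i, ∑ j, ∑ k, ∑ l, F i j k l = ∑ k, ∑ l, ∑ i, ∑ j, F i j k l := by
    intro F
    calc ∑ i, ∑ j, ∑ k, ∑ l, F i j k l = ∑ i, ∑ k, ∑ j, ∑ l, F i j k l :=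
          Finset.sum_congr rfl fun i _ => Finset.sum_comm
      _ = ∑ k, ∑ i, ∑ j, ∑ l, F i j k l := Finset.sum_comm
      _ = ∑ k, ∑ i, ∑ l, ∑ j, F i j k l :=
          Finset.sum_congr rfl fun k _ => Finset.sum_congr rfl fun i _ => Finset.sum_comm
      _ = ∑ k, ∑ l, ∑ i, ∑ j, F i j k l := Finset.sum_congr rfl fun k _ => Finset.sum_comm
  exact e₁ _

end CompletedSym

/-! ### The Buchweitz–Eisenbud–Herzog functor -/

section BEH

theorem isCompl_baseChange (R : Type w) [CommRing R] [Algebra ℂ R] {A : Type u} [AddCommGroup A]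
    [Module ℂ A] {p q : Submodule ℂ A} (h : IsCompl p q) :
    IsCompl (p.baseChange R) (q.baseChange R) := by
  refine ⟨?_, ?_⟩
  · let f : A →ₗ[ℂ] A := p.subtype ∘ₗ p.projectionOnto q h
    have hp : f ∘ₗ p.subtype = p.subtype := LinearMap.ext fun x => by
      change ((p.projectionOnto q h (x : A) : p) : A) = x
      rw [Submodule.projectionOnto_apply_left]
    have hq : f ∘ₗ q.subtype = 0 := LinearMap.ext fun x => by
      change ((p.projectionOnto q h (x : A) : p) : A) = 0
      rw [Submodule.projectionOnto_apply_right]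
      rfl
    rw [Submodule.disjoint_def]
    rintro _ ⟨x, rfl⟩ ⟨y, hy⟩
    have h₁ : f.baseChange R (p.subtype.baseChange R x) = p.subtype.baseChange R x := by
      rw [← LinearMap.comp_apply, ← LinearMap.baseChange_comp, hp]
    have h₂ : f.baseChange R (q.subtype.baseChange R y) = 0 := by
      rw [← LinearMap.comp_apply, ← LinearMap.baseChange_comp, hq, LinearMap.baseChange_zero]
      rfl
    rw [← h₁, ← hy, h₂]
  · rw [codisjoint_iff, eq_top_iff]
    intro x _
    induction x using TensorProduct.induction_on with
    | zero => exact zero_mem _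
    | add x y hx hy => exact add_mem (hx trivial) (hy trivial)
    | tmul r a =>
      obtain ⟨a₀, a₁, h₀, h₁, rfl⟩ := Submodule.codisjoint_iff_exists_add_eq.1 h.codisjoint a
      rw [TensorProduct.tmul_add]
      exact add_mem (Submodule.mem_sup_left (Submodule.tmul_mem_baseChange_of_mem r h₀))
        (Submodule.mem_sup_right (Submodule.tmul_mem_baseChange_of_mem r h₁))

variable {V : Type v} [AddCommGroup V] [Module ℂ V] {n : ℕ} (b : Module.Basis (Fin n) ℂ V)
variable (Q : QuadraticForm ℂ V)

/-- The twisted differential of `Ŝym V^∨ ⊗ A`, that is, the image of the identity map of `V`,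
viewed as the element `∑ j, bⱼ ⊗ xⱼ` of `V ⊗ V^∨`: multiplication by `∑ j, xⱼ ⊗ bⱼ`. -/
def behD (A : ClMod.{u} Q) : (CSym n ⊗[ℂ] A.carrier) →ₗ[CSym n] (CSym n ⊗[ℂ] A.carrier) :=
  ∑ j, (MvPowerSeries.X j : CSym n) •
    (Algebra.lsmul ℂ ℂ A.carrier (CliffordAlgebra.ι Q (b j))).baseChange (CSym n)

theorem behD_tmul (A : ClMod.{u} Q) (r : CSym n) (a : A.carrier) :
    behD b Q A (r ⊗ₜ a) = ∑ j, (MvPowerSeries.X j * r) ⊗ₜ[ℂ] (CliffordAlgebra.ι Q (b j) • a) := by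
  rw [behD, LinearMap.sum_apply]
  rfl

theorem behD_behD (A : ClMod.{u} Q) (x : CSym n ⊗[ℂ] A.carrier) :
    behD b Q A (behD b Q A x) = quadSeries b Q • x := by
  induction x using TensorProduct.induction_on with
  | zero => rw [map_zero, map_zero, smul_zero]
  | add x y hx hy => rw [map_add, map_add, hx, hy, smul_add]
  | tmul r a =>
    let T : Fin n → Fin n → CSym n ⊗[ℂ] A.carrier := fun i j =>
      (MvPowerSeries.X i * (MvPowerSeries.X j * r)) ⊗ₜ[ℂ]
        (CliffordAlgebra.ι Q (b i) • CliffordAlgebra.ι Q (b j) • a)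
    let U : Fin n → Fin n → CSym n ⊗[ℂ] A.carrier := fun i j =>
      (QuadraticMap.associated (R := ℂ) Q (b i) (b j) •
        (MvPowerSeries.X i * MvPowerSeries.X j : CSym n)) • (r ⊗ₜ[ℂ] a)
    have hT : ∀ i j, T i j + T j i = (2 : ℂ) • U i j := by
      intro i j
      have h := DFunLike.congr_fun (DFunLike.congr_fun
        (QuadraticMap.two_nsmul_associated ℂ Q) (b i)) (b j)
      change 2 • QuadraticMap.associated (R := ℂ) Q (b i) (b j) =
        QuadraticMap.polar Q (b i) (b j) at h
      have e : T j i = (MvPowerSeries.X i * (MvPowerSeries.X j * r)) ⊗ₜ[ℂ]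
          (CliffordAlgebra.ι Q (b j) • CliffordAlgebra.ι Q (b i) • a) := by
        change (MvPowerSeries.X j * (MvPowerSeries.X i * r)) ⊗ₜ[ℂ] _ = _
        rw [mul_left_comm]
      rw [e]
      change _ ⊗ₜ[ℂ] _ + _ ⊗ₜ[ℂ] _ = _
      rw [← TensorProduct.tmul_add, smul_smul, smul_smul, ← add_smul,
        CliffordAlgebra.ι_mul_ι_add_swap, ← h, algebraMap_smul]
      change _ = (2 : ℂ) • ((_ • (MvPowerSeries.X i * MvPowerSeries.X j : CSym n) * r) ⊗ₜ[ℂ] a)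
      rw [TensorProduct.tmul_smul, smul_mul_assoc, TensorProduct.smul_tmul',
        TensorProduct.smul_tmul', smul_smul, nsmul_eq_mul, mul_assoc, Nat.cast_ofNat]
    have hS : (2 : ℂ) • ∑ i, ∑ j, T i j = (2 : ℂ) • ∑ i, ∑ j, U i j := by
      have h₁ : ∑ i, ∑ j, T i j = ∑ i, ∑ j, T j i := Finset.sum_comm
      calc (2 : ℂ) • ∑ i, ∑ j, T i j = ∑ i, ∑ j, T i j + ∑ i, ∑ j, T j i := by
            rw [two_smul, ← h₁]
        _ = ∑ i, ∑ j, (T i j + T j i) := by simp only [Finset.sum_add_distrib]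
        _ = (2 : ℂ) • ∑ i, ∑ j, U i j := by simp only [hT, Finset.smul_sum]
    have hTU : ∑ i, ∑ j, T i j = ∑ i, ∑ j, U i j :=
      smul_right_injective _ (two_ne_zero' ℂ) hS
    calc behD b Q A (behD b Q A (r ⊗ₜ a)) = ∑ j, ∑ i, T i j := by
          rw [behD_tmul, map_sum]
          exact Finset.sum_congr rfl fun j _ => behD_tmul b Q A _ _
      _ = ∑ i, ∑ j, U i j := by rw [← hTU]; exact Finset.sum_comm
      _ = quadSeries b Q • (r ⊗ₜ a) := by
          rw [quadSeries, Finset.sum_smul]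
          exact Finset.sum_congr rfl fun i _ => (Finset.sum_smul ..).symm

theorem behD_mem (A : ClMod.{u} Q) (i : ZMod 2) (x : CSym n ⊗[ℂ] A.carrier)
    (hx : x ∈ (A.piece i).baseChange (CSym n)) :
    behD b Q A x ∈ (A.piece (i + 1)).baseChange (CSym n) := by
  obtain ⟨y, rfl⟩ := hx
  induction y using TensorProduct.induction_on with
  | zero => rw [map_zero, map_zero]; exact zero_mem _
  | add x y hx hy => rw [map_add, map_add]; exact add_mem hx hy
  | tmul r a =>
    change behD b Q A (r ⊗ₜ[ℂ] (a : A.carrier)) ∈ _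
    rw [behD_tmul]
    refine sum_mem fun j _ => Submodule.tmul_mem_baseChange_of_mem _ ?_
    rw [add_comm]
    exact A.smul_mem 1 i _ _ (CliffordAlgebra.ι_mem_evenOdd_one _ _) a.2

/-- The matrix factorization `Φ(A) = Ŝym V^∨ ⊗ A` of `Q` attached to a graded `Cl(V, Q)`-module
`A`. -/
def behObj (A : ClMod.{u} Q) : MF.{u} (CSym n) (quadSeries b Q) :=
  haveI : Module.Finite ℂ V := .of_basis b
  haveI : Module.Finite ℂ (CliffordAlgebra Q) := finite_clifford
  haveI : Module.Finite ℂ A.carrier := .trans (CliffordAlgebra Q) _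
  { carrier := CSym n ⊗[ℂ] A.carrier
    piece := fun i => (A.piece i).baseChange (CSym n)
    isCompl := isCompl_baseChange _ A.isCompl
    d := behD b Q A
    d_mem := behD_mem b Q A
    d_d := behD_behD b Q A }

variable {Q} in
/-- The `Ŝym V^∨`-linear map `id ⊗ f`. -/
def behMap {A B : ClMod.{u} Q} (f : A ⟶ B) :
    (CSym n ⊗[ℂ] A.carrier) →ₗ[CSym n] (CSym n ⊗[ℂ] B.carrier) :=
  (f.1.restrictScalars ℂ).baseChange (CSym n)

theorem behMap_mem {A B : ClMod.{u} Q} (f : A ⟶ B) (i : ZMod 2) (x : CSym n ⊗[ℂ] A.carrier)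
    (hx : x ∈ (A.piece i).baseChange (CSym n)) :
    behMap f x ∈ (B.piece i).baseChange (CSym n) := by
  obtain ⟨y, rfl⟩ := hx
  induction y using TensorProduct.induction_on with
  | zero => rw [map_zero, map_zero]; exact zero_mem _
  | add x y hx hy => rw [map_add, map_add]; exact add_mem hx hy
  | tmul r a => exact Submodule.tmul_mem_baseChange_of_mem r (f.2 i _ a.2)

theorem behMap_behD {A B : ClMod.{u} Q} (f : A ⟶ B) (x : CSym n ⊗[ℂ] A.carrier) :
    behD b Q B (behMap f x) = behMap f (behD b Q A x) := by
  induction x using TensorProduct.induction_on with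
  | zero => rw [map_zero, map_zero, map_zero, map_zero]
  | add x y hx hy => rw [map_add, map_add, map_add, map_add, hx, hy]
  | tmul r a =>
    change behD b Q B (r ⊗ₜ[ℂ] f.1 a) = _
    rw [behD_tmul, behD_tmul, map_sum]
    refine Finset.sum_congr rfl fun j _ => ?_
    change _ = (MvPowerSeries.X j * r) ⊗ₜ[ℂ] f.1 (CliffordAlgebra.ι Q (b j) • a)
    rw [map_smul]

/-- The Buchweitz–Eisenbud–Herzog functor `Φ : Cl(V, Q)-grmod ⥤ Z⁰(MF(Ŝym V^∨, Q))`,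
`Φ(f) = id ⊗ f`. -/
def beh : ClMod.{u} Q ⥤ MF.{u} (CSym n) (quadSeries b Q) where
  obj A := behObj b Q A
  map {A B} f := ⟨behMap f, MF.closed_of_comm (M := behObj b Q A) (N := behObj b Q B)
    (behMap_mem Q f) (behMap_behD b Q f)⟩
  map_id A := MF.hom_ext fun x => by
    change (LinearMap.id : A.carrier →ₗ[ℂ] A.carrier).baseChange (CSym n) x = x
    rw [LinearMap.baseChange_id]
    rfl
  map_comp {A B C} f g := MF.hom_ext fun x => by
    change ((g.1.restrictScalars ℂ) ∘ₗ (f.1.restrictScalars ℂ)).baseChange (CSym n) x = _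
    rw [LinearMap.baseChange_comp]
    rfl

variable {Ghat : Type*} [Group Ghat] {π : Ghat →* ℤˣ} {ρ : RealRep π V} {Q}

/-- The Real 2-representation of `G` on `Z⁰(MF(Ŝym V^∨, Q))`. -/
def mfTwoRep (hQ : ρ.Invariant Q) : RealTwoRep π (MF.{u} (CSym n) (quadSeries b Q)) :=
  MF.twoRep (csymAction b ρ) (csymAction_quadSeries b hQ)

/-- The Real 2-representation of `G` on `HMF(Ŝym V^∨, Q)`. -/
def hmfTwoRep (hQ : ρ.Invariant Q) : RealTwoRep π (HMF.{u} (CSym n) (quadSeries b Q)) :=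
  HMF.twoRep (csymAction b ρ) (csymAction_quadSeries b hQ)

/-- The Real `G`-equivariant structure, by identity morphisms, on the canonical functor
`Z⁰(MF(Ŝym V^∨, Q)) ⥤ HMF(Ŝym V^∨, Q)`. -/
def toHMFEquivariant (hQ : ρ.Invariant Q) :
    RealEquivariant (mfTwoRep.{u} b hQ) (hmfTwoRep b hQ) (CategoryTheory.Quotient.functor _) :=
  (mfTwoRep.{u} b hQ).quotientEquivariant _

end BEH

end RealMF

end

open RealMF

/-! Homotopy fixed points preserve equivalences: if a Real equivariant functor is fully faithful and
essentially surjective after forgetting equivariance, fixed-point data can be pulled back along it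
(`RealEquivariant.fixed_isEquivalence`). Two tasks remain: to check that `r ⊗ a ↦ σ⁻¹(r) ⊗ a` is
equivariance data (`behEquivariant`), which rests on the invariance of `∑ xⱼ ⊗ bⱼ`, and to prove the
non-equivariant Buchweitz–Eisenbud–Herzog theorem (`behHMF_isEquivalence`).

For the latter, maps `Φ(A) → Φ(B)` are regarded as power series with coefficients in `K = Hom_ℂ(A,
B)`. The supercommutator with the twisted differentials becomes `δ = ∑ xᵢ cᵢ`, where `cᵢ` is the
supercommutator with `bᵢ`. Nondegeneracy provides dual vectors, hence operators `aᵢ` satisfying the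
canonical anticommutation relations with the `cᵢ` (`isCAR_clifford`). With `h = ∑ aᵢ ∂ᵢ` one finds
`δh + hδ = deg + ∑ aᵢ cᵢ`. Each `aᵢ cᵢ` is idempotent and they commute, so the right side is
invertible in positive degree and `δ` is contractible there (`exists_koszul_contraction`).

Full faithfulness: the constant term of a closed map is Clifford linear (`homCoeff_zero_smul`), a
null-homotopic map has constant term zero because the differentials have none, and a closed even map
with constant term zero is null-homotopic by the contraction.

Essential surjectivity: over a local ring, contractible summands of rank two can be split off until
no matrix coefficient of `d` is a unit (`MF.exists_minimal`). For a minimal factorization the linear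
part of `d` satisfies the Clifford relations, by comparing quadratic terms in `d² = q`, and so
defines a graded Clifford module `C`. The terms of order at least two are removed by conjugation:
the complex comparing `d` with its linear part is a perturbation of the Koszul complex, and the
contraction extends the cocycle `id` to a cocycle of the perturbed complex
(`exists_perturbed_cocycle`, `exists_conjugation`). Its constant term is the identity, so it is an
isomorphism `Φ(C) ≅ M`. -/

namespace RealMF

/-! ### Homotopy fixed points of an equivariant equivalence -/

section FixedEquivalence

variable {Ghat : Type*} [Group Ghat] {π : Ghat →* ℤˣ}
variable {C : Type u₁} [Category.{v₁} C] [Preadditive C] [Linear ℂ C]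
variable {D : Type u₂} [Category.{v₂} D] [Preadditive D] [Linear ℂ D]
variable {P : RealTwoRep π C} {P' : RealTwoRep π D} {F : C ⥤ D}

theorem FixedPoint.hom_ext {X Y : FixedPoint P} {f g : X ⟶ Y} (h : f.1 = g.1) : f = g :=
  Subtype.ext h

/-- An isomorphism of underlying objects compatible with the equivariance data. -/
def FixedPoint.mkIso {X Y : FixedPoint P} (e : X.obj ≅ Y.obj)
    (h : ∀ σ : Ghat, e.hom ≫ (Y.u σ).hom = (X.u σ).hom ≫ (P.ρ σ).map e.hom) : X ≅ Y where
  hom := ⟨e.hom, h⟩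
  inv := ⟨e.inv, fun σ => by
    rw [Iso.inv_comp_eq, ← Category.assoc, h σ, Category.assoc, ← Functor.map_comp,
      e.hom_inv_id, CategoryTheory.Functor.map_id, Category.comp_id]⟩
  hom_inv_id := FixedPoint.hom_ext e.hom_inv_id
  inv_hom_id := FixedPoint.hom_ext e.inv_hom_id

theorem RealEquivariant.fixed_faithful (η : RealEquivariant P P' F) [F.Faithful] :
    η.fixed.Faithful where
  map_injective {_ _ _ _} h := FixedPoint.hom_ext (F.map_injective (congrArg Subtype.val h))

theorem RealEquivariant.fixed_full (η : RealEquivariant P P' F) [F.Faithful] [F.Full] :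
    η.fixed.Full where
  map_surjective {X Y} f := by
    obtain ⟨g, hg⟩ := F.map_surjective f.1
    -- Faithfulness moves the equivariance of the preimage `g` to `D`, where it is that of `f` up to
    -- the invertible component of `η σ`.
    refine ⟨⟨g, fun σ => F.map_injective ?_⟩, FixedPoint.hom_ext hg⟩
    have h₂ := (η.η σ).hom.naturality g
    have h : F.map g ≫ F.map (Y.u σ).hom ≫ (η.η σ).hom.app Y.obj =
        (F.map (X.u σ).hom ≫ (η.η σ).hom.app X.obj) ≫ (P'.ρ σ).map (F.map g) := by
      rw [hg]
      exact f.2 σ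
    simp only [Functor.comp_obj, Functor.comp_map] at h₂
    rw [Category.assoc, ← h₂, ← Category.assoc, ← Category.assoc] at h
    rw [F.map_comp, F.map_comp]
    exact (cancel_mono _).1 h

/-- Transport of structure: the maps `u σ` of `Y` are carried along `F X ≅ Y` and `η`, then lifted
through the fully faithful `F`. -/
theorem RealEquivariant.fixed_essSurj (η : RealEquivariant P P' F) [F.Faithful] [F.Full]
    [F.EssSurj] : η.fixed.EssSurj where
  mem_essImage Y := by
    let X := F.objPreimage Y.obj
    let e : F.obj X ≅ Y.obj := F.objObjPreimageIso Y.obj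
    let w : ∀ σ : Ghat, F.obj X ≅ F.obj ((P.ρ σ).obj X) := fun σ =>
      e ≪≫ Y.u σ ≪≫ ((P'.ρ σ).mapIso e).symm ≪≫ ((η.η σ).app X).symm
    -- This square characterizes `w σ`; later steps use only it. It is also the compatibility of `e`
    -- with the two fixed-point structures.
    have hw : ∀ σ : Ghat, (w σ).hom ≫ (η.η σ).hom.app X ≫ (P'.ρ σ).map e.hom =
        e.hom ≫ (Y.u σ).hom := fun σ => by
      simp [w, ← Functor.map_comp]
    let Z : FixedPoint P :=
      { obj := X
        u := fun σ => F.preimageIso (w σ)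
        coh := fun σ₂ σ₁ => F.map_injective (by
          have h₁ := η.coh σ₂ σ₁ X
          have h₂ := (η.η σ₂).hom.naturality (F.preimageIso (w σ₁)).hom
          have h₃ := (P'.θ σ₂ σ₁).hom.naturality e.hom
          simp only [Functor.comp_obj, Functor.comp_map, Functor.preimageIso_hom,
            Functor.map_preimage] at h₁ h₂ h₃
          simp only [Functor.preimageIso_hom, F.map_comp, Functor.map_preimage]
          -- After composing with two isomorphisms, both sides can be compared with the cocycle
          -- identity for `Y.u`.
          rw [← cancel_mono ((η.η (σ₂ * σ₁)).hom.app X),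
            ← cancel_mono ((P'.ρ (σ₂ * σ₁)).map e.hom), Category.assoc, hw, Y.coh]
          simp only [Category.assoc]
          rw [← reassoc_of% h₁, reassoc_of% h₂, ← h₃, ← Functor.map_comp_assoc,
            ← Functor.map_comp_assoc, Category.assoc, hw, Functor.map_comp, Category.assoc,
            reassoc_of% (hw σ₂)]) }
    refine ⟨Z, ⟨FixedPoint.mkIso e fun σ => ?_⟩⟩
    change e.hom ≫ (Y.u σ).hom =
      (F.map (F.preimage (w σ).hom) ≫ (η.η σ).hom.app X) ≫ (P'.ρ σ).map e.hom
    rw [Functor.map_preimage, Category.assoc, hw]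

/-- A Real equivariant functor whose underlying functor is an equivalence induces an equivalence
on homotopy fixed points. -/
theorem RealEquivariant.fixed_isEquivalence (η : RealEquivariant P P' F) [F.IsEquivalence] :
    η.fixed.IsEquivalence :=
  haveI := η.fixed_faithful
  haveI := η.fixed_full
  haveI := η.fixed_essSurj
  {}

end FixedEquivalence

/-! ### The Real equivariant structure on the functor `Φ` -/

section Equivariance

variable {Ghat : Type*} [Group Ghat] {π : Ghat →* ℤˣ}
variable {V : Type v} [AddCommGroup V] [Module ℂ V] {n : ℕ} (b : Module.Basis (Fin n) ℂ V)
variable {ρ : RealRep π V} {Q : QuadraticForm ℂ V} (hQ : ρ.Invariant Q)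

/-- The twisting maps are only semilinear over `ℂ`, so identities between them are tested as
identities of additive maps. -/
theorem tensorProduct_addHom_ext {M N L : Type*} [AddCommGroup M] [Module ℂ M] [AddCommGroup N]
    [Module ℂ N] [AddCommGroup L] {f g : (M ⊗[ℂ] N) →+ L}
    (h : ∀ x y, f (x ⊗ₜ y) = g (x ⊗ₜ y)) : f = g :=
  AddMonoidHom.ext fun x => by
    induction x using TensorProduct.induction_on with
    | zero => rw [map_zero, map_zero]
    | add x y hx hy => rw [map_add, map_add, hx, hy]
    | tmul x y => exact h x y

/-- The twist of a graded Clifford module. -/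
noncomputable abbrev ClMod.twist (σ : Ghat) (A : ClMod.{u} Q) : ClMod.{u} Q :=
  GrMod.twist (cliffordAction hQ) (cliffordAction_evenOdd hQ) σ A

/-- The twist of a matrix factorization of `Q`. -/
noncomputable abbrev mfTwist (σ : Ghat) (M : MF.{u} (CSym n) (quadSeries b Q)) :
    MF.{u} (CSym n) (quadSeries b Q) :=
  M.twist (csymAction b ρ) (csymAction_quadSeries b hQ) σ

/-- The identity map from a graded Clifford module to its twist. -/
noncomputable def toTwist (σ : Ghat) (A : ClMod.{u} Q) :
    A.carrier ≃+ (ClMod.twist hQ σ A).carrier :=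
  toTwisted (cliffordAction hQ) σ A.carrier

/-- The additive map `r ⊗ a ↦ σ⁻¹(r) ⊗ a` from `Φ(A^σ)` to `Φ(A)`. -/
noncomputable def untwist (σ : Ghat) (A : ClMod.{u} Q) :
    (CSym n ⊗[ℂ] (ClMod.twist hQ σ A).carrier) →+ (CSym n ⊗[ℂ] A.carrier) :=
  TensorProduct.liftAddHom
    { toFun := fun r =>
        { toFun := fun a => (csymAction b ρ).act σ⁻¹ r ⊗ₜ[ℂ] (toTwist hQ σ A).symm a
          map_zero' := by rw [map_zero, TensorProduct.tmul_zero]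
          map_add' := fun a a' => by rw [map_add, TensorProduct.tmul_add] }
      map_zero' := AddMonoidHom.ext fun a => by
        change (csymAction b ρ).act σ⁻¹ 0 ⊗ₜ[ℂ] _ = 0
        rw [map_zero, TensorProduct.zero_tmul]
      map_add' := fun r r' => AddMonoidHom.ext fun a => by
        change (csymAction b ρ).act σ⁻¹ (r + r') ⊗ₜ[ℂ] _ = _
        rw [map_add, TensorProduct.add_tmul]
        rfl }
    -- The map is balanced over `ℂ`: `σ⁻¹` conjugates the scalar acting on `r`, and the module
    -- structure of the twist conjugates the one acting on `a` in the same way.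
    (fun c r a => by
      change (csymAction b ρ).act σ⁻¹ (c • r) ⊗ₜ[ℂ] (toTwist hQ σ A).symm a =
        (csymAction b ρ).act σ⁻¹ r ⊗ₜ[ℂ] (conjBy (π σ⁻¹) c • (toTwist hQ σ A).symm a)
      rw [(csymAction b ρ).act_smul, TensorProduct.smul_tmul])

/-- The additive map `r ⊗ a ↦ σ(r) ⊗ a` from `Φ(A)` to `Φ(A^σ)`. -/
noncomputable def retwist (σ : Ghat) (A : ClMod.{u} Q) :
    (CSym n ⊗[ℂ] A.carrier) →+ (CSym n ⊗[ℂ] (ClMod.twist hQ σ A).carrier) :=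
  TensorProduct.liftAddHom
    { toFun := fun r =>
        { toFun := fun a => (csymAction b ρ).act σ r ⊗ₜ[ℂ] toTwist hQ σ A a
          map_zero' := by rw [map_zero, TensorProduct.tmul_zero]
          map_add' := fun a a' => by rw [map_add, TensorProduct.tmul_add] }
      map_zero' := AddMonoidHom.ext fun a => by
        change (csymAction b ρ).act σ 0 ⊗ₜ[ℂ] _ = 0
        rw [map_zero, TensorProduct.zero_tmul]
      map_add' := fun r r' => AddMonoidHom.ext fun a => by
        change (csymAction b ρ).act σ (r + r') ⊗ₜ[ℂ] _ = _
        rw [map_add, TensorProduct.add_tmul]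
        rfl }
    (fun c r a => by
      change (csymAction b ρ).act σ (c • r) ⊗ₜ[ℂ] toTwist hQ σ A a =
        (csymAction b ρ).act σ r ⊗ₜ[ℂ] toTwist hQ σ A (c • a)
      have h : toTwist hQ σ A (c • a) =
          conjBy (π σ) c • toTwist hQ σ A a := by
        change c • a = conjBy (π σ⁻¹) (conjBy (π σ) c) • a
        rw [conjBy_inv_conjBy]
      rw [(csymAction b ρ).act_smul, TensorProduct.smul_tmul, h])

theorem retwist_untwist (σ : Ghat) (A : ClMod.{u} Q)
    (x : CSym n ⊗[ℂ] (ClMod.twist hQ σ A).carrier) :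
    retwist b hQ σ A (untwist b hQ σ A x) = x := by
  induction x using TensorProduct.induction_on with
  | zero => rw [map_zero, map_zero]
  | add x y hx hy => rw [map_add, map_add, hx, hy]
  | tmul r a =>
    change (csymAction b ρ).act σ ((csymAction b ρ).act σ⁻¹ r) ⊗ₜ[ℂ] a = _
    rw [GenAction.act_act_inv]

theorem untwist_retwist (σ : Ghat) (A : ClMod.{u} Q) (x : CSym n ⊗[ℂ] A.carrier) :
    untwist b hQ σ A (retwist b hQ σ A x) = x := by
  induction x using TensorProduct.induction_on with
  | zero => rw [map_zero, map_zero]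
  | add x y hx hy => rw [map_add, map_add, hx, hy]
  | tmul r a =>
    change (csymAction b ρ).act σ⁻¹ ((csymAction b ρ).act σ r) ⊗ₜ[ℂ] a = _
    rw [GenAction.act_inv_act]

theorem untwist_smul (σ : Ghat) (A : ClMod.{u} Q) (s : CSym n)
    (x : CSym n ⊗[ℂ] (ClMod.twist hQ σ A).carrier) :
    untwist b hQ σ A (s • x) = (csymAction b ρ).act σ⁻¹ s • untwist b hQ σ A x := by
  induction x using TensorProduct.induction_on with
  | zero => rw [smul_zero, map_zero, smul_zero]
  | add x y hx hy => rw [smul_add, map_add, map_add, hx, hy, smul_add]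
  | tmul r a =>
    change (csymAction b ρ).act σ⁻¹ (s * r) ⊗ₜ[ℂ] _ =
      ((csymAction b ρ).act σ⁻¹ s * (csymAction b ρ).act σ⁻¹ r) ⊗ₜ[ℂ] _
    rw [map_mul]

theorem untwist_mem (σ : Ghat) (A : ClMod.{u} Q) (i : ZMod 2)
    (x : CSym n ⊗[ℂ] (ClMod.twist hQ σ A).carrier)
    (hx : x ∈ ((ClMod.twist hQ σ A).piece i).baseChange (CSym n)) :
    untwist b hQ σ A x ∈ (A.piece i).baseChange (CSym n) := by
  obtain ⟨y, rfl⟩ := hx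
  induction y using TensorProduct.induction_on with
  | zero => rw [map_zero, map_zero]; exact zero_mem _
  | add x y hx hy => rw [map_add, map_add]; exact add_mem hx hy
  | tmul r a => exact Submodule.tmul_mem_baseChange_of_mem ((csymAction b ρ).act σ⁻¹ r) a.2

theorem retwist_mem (σ : Ghat) (A : ClMod.{u} Q) (i : ZMod 2) (x : CSym n ⊗[ℂ] A.carrier)
    (hx : x ∈ (A.piece i).baseChange (CSym n)) :
    retwist b hQ σ A x ∈ ((ClMod.twist hQ σ A).piece i).baseChange (CSym n) := by
  obtain ⟨y, rfl⟩ := hx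
  induction y using TensorProduct.induction_on with
  | zero => rw [map_zero, map_zero]; exact zero_mem _
  | add x y hx hy => rw [map_add, map_add]; exact add_mem hx hy
  | tmul r a =>
    exact Submodule.tmul_mem_baseChange_of_mem (p := (ClMod.twist hQ σ A).piece i)
      ((csymAction b ρ).act σ r) a.2

/-- The twisted differential is invariant, because `∑ bⱼ ⊗ xⱼ` is. -/
theorem untwist_behD (σ : Ghat) (A : ClMod.{u} Q)
    (x : CSym n ⊗[ℂ] (ClMod.twist hQ σ A).carrier) :
    untwist b hQ σ A (behD b Q (ClMod.twist hQ σ A) x) = behD b Q A (untwist b hQ σ A x) := by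
  refine DFunLike.congr_fun (tensorProduct_addHom_ext
    (f := (untwist b hQ σ A).comp (behD b Q (ClMod.twist hQ σ A)).toAddMonoidHom)
    (g := (behD b Q A).toAddMonoidHom.comp (untwist b hQ σ A)) fun r a => ?_) x
  change untwist b hQ σ A (behD b Q (ClMod.twist hQ σ A) (r ⊗ₜ[ℂ] a)) =
    behD b Q A (untwist b hQ σ A (r ⊗ₜ[ℂ] a))
  have h₁ : behD b Q (ClMod.twist hQ σ A) (r ⊗ₜ[ℂ] a) = ∑ j, (MvPowerSeries.X j * r) ⊗ₜ[ℂ]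
    (toTwist hQ σ A
      (cliffordMap hQ σ⁻¹ (CliffordAlgebra.ι Q (b j)) • (toTwist hQ σ A).symm a)) :=
    behD_tmul b Q (ClMod.twist hQ σ A) r a
  rw [h₁, map_sum]
  change ∑ j, csymMap b ρ σ⁻¹ (MvPowerSeries.X j * r) ⊗ₜ[ℂ]
    (cliffordMap hQ σ⁻¹ (CliffordAlgebra.ι Q (b j)) • (toTwist hQ σ A).symm a) =
    behD b Q A (csymMap b ρ σ⁻¹ r ⊗ₜ[ℂ] (toTwist hQ σ A).symm a)
  generalize (toTwist hQ σ A).symm a = a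
  generalize hr : csymMap b ρ σ⁻¹ r = r'
  -- The transformed coordinates are dual to the transformed basis, also in the antilinear case.
  -- This is the invariance of `∑ xⱼ ⊗ bⱼ` in coordinates.
  have hv : ∀ v : V, ∑ j, (ρ.dual.act σ⁻¹ (b.coord j) v) • ρ.act σ⁻¹ (b j) = v := by
    intro v
    conv_rhs => rw [← ρ.act_act_inv σ⁻¹ v, ← b.sum_repr (ρ.act σ⁻¹⁻¹ v), map_sum]
    exact Finset.sum_congr rfl fun i _ => (ρ.act_smul σ⁻¹ _ _).symm
  rw [behD_tmul]
  -- Expand the transformed variable in the `xₖ` and move the scalars across the tensor sign onto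
  -- the vectors. Summing over `j` first then restores `bₖ` by `hv`.
  have h₂ : ∀ j, csymMap b ρ σ⁻¹ (MvPowerSeries.X j * r) ⊗ₜ[ℂ]
      (cliffordMap hQ σ⁻¹ (CliffordAlgebra.ι Q (b j)) • a) =
      ∑ k, (MvPowerSeries.X k * r') ⊗ₜ[ℂ] (CliffordAlgebra.ι Q
        (ρ.dual.act σ⁻¹ (b.coord j) (b k) • ρ.act σ⁻¹ (b j)) • a) := by
    intro j
    rw [map_mul, hr, csymMap_X, cliffordMap_ι]
    change ((∑ k, _ • MvPowerSeries.X k) * r') ⊗ₜ[ℂ] _ = _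
    rw [Finset.sum_mul, TensorProduct.sum_tmul]
    refine Finset.sum_congr rfl fun k _ => ?_
    rw [smul_mul_assoc, TensorProduct.smul_tmul, map_smul, smul_assoc]
  rw [Finset.sum_congr rfl fun j _ => h₂ j, Finset.sum_comm]
  refine Finset.sum_congr rfl fun k _ => ?_
  rw [← TensorProduct.tmul_sum, ← Finset.sum_smul, ← map_sum, hv]

/-- The isomorphism `Φ(A^σ) ≅ Φ(A)^σ`, `r ⊗ a ↦ σ⁻¹(r) ⊗ a`. -/
noncomputable def behTwistIso (σ : Ghat) (A : ClMod.{u} Q) :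
    behObj b Q (ClMod.twist hQ σ A) ≅ mfTwist b hQ σ (behObj b Q A) :=
  MF.mkIso (M := behObj b Q (ClMod.twist hQ σ A)) (N := mfTwist b hQ σ (behObj b Q A))
    { toFun := fun x => untwist b hQ σ A x
      invFun := fun x => retwist b hQ σ A x
      map_add' := fun x y => map_add (untwist b hQ σ A) x y
      map_smul' := fun s x => untwist_smul b hQ σ A s x
      left_inv := fun x => retwist_untwist b hQ σ A x
      right_inv := fun x => untwist_retwist b hQ σ A x }
    (fun i x hx => untwist_mem b hQ σ A i x hx) (fun i x hx => retwist_mem b hQ σ A i x hx)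
    (fun x => (untwist_behD b hQ σ A x).symm)

theorem behTwistIso_naturality (σ : Ghat) {A B : ClMod.{u} Q} (f : A ⟶ B) :
    (beh b Q).map (((ClMod.twoRep hQ).ρ σ).map f) ≫ (behTwistIso b hQ σ B).hom =
      (behTwistIso b hQ σ A).hom ≫ ((mfTwoRep b hQ).ρ σ).map ((beh b Q).map f) :=
  MF.hom_ext fun x => by
    change untwist b hQ σ B (behMap (((ClMod.twoRep hQ).ρ σ).map f) x) =
      behMap f (untwist b hQ σ A x)
    exact DFunLike.congr_fun (tensorProduct_addHom_ext
      (f := (untwist b hQ σ B).comp (behMap (((ClMod.twoRep hQ).ρ σ).map f)).toAddMonoidHom)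
      (g := (behMap f).toAddMonoidHom.comp (untwist b hQ σ A)) fun r a => rfl) x

theorem behTwistIso_coh (σ₂ σ₁ : Ghat) (A : ClMod.{u} Q) :
    (behTwistIso b hQ σ₂ (ClMod.twist hQ σ₁ A)).hom ≫
        ((mfTwoRep b hQ).ρ σ₂).map (behTwistIso b hQ σ₁ A).hom ≫
        ((mfTwoRep b hQ).θ σ₂ σ₁).hom.app (behObj b Q A) =
      (beh b Q).map (((ClMod.twoRep hQ).θ σ₂ σ₁).hom.app A) ≫
        (behTwistIso b hQ (σ₂ * σ₁) A).hom :=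
  MF.hom_ext fun x => by
    change untwist b hQ σ₁ A (untwist b hQ σ₂ (ClMod.twist hQ σ₁ A) x) =
      untwist b hQ (σ₂ * σ₁) A (behMap (((ClMod.twoRep hQ).θ σ₂ σ₁).hom.app A) x)
    refine DFunLike.congr_fun (tensorProduct_addHom_ext
      (f := (untwist b hQ σ₁ A).comp (untwist b hQ σ₂ (ClMod.twist hQ σ₁ A)))
      (g := (untwist b hQ (σ₂ * σ₁) A).comp
        (behMap (((ClMod.twoRep hQ).θ σ₂ σ₁).hom.app A)).toAddMonoidHom) fun r a => ?_) x
    change (csymAction b ρ).act σ₁⁻¹ ((csymAction b ρ).act σ₂⁻¹ r) ⊗ₜ[ℂ] _ =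
      (csymAction b ρ).act (σ₂ * σ₁)⁻¹ r ⊗ₜ[ℂ] _
    rw [mul_inv_rev, GenAction.act_mul_apply]
    rfl

/-- The Real `G`-equivariant structure on `Φ`. -/
noncomputable def behEquivariant :
    RealEquivariant (ClMod.twoRep.{u} hQ) (mfTwoRep.{u} b hQ) (beh.{u} b Q) where
  η σ := NatIso.ofComponents (fun A => behTwistIso b hQ σ A)
    (fun f => behTwistIso_naturality b hQ σ f)
  coh σ₂ σ₁ A := behTwistIso_coh b hQ σ₂ σ₁ A

end Equivariance

/-! ### A contraction of the Koszul complex -/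

section Koszul

variable {ι : Type*} {K : Type*} [AddCommGroup K] [Module ℂ K]

/-- Multiplication of a power series with coefficients in `K` by the variable `xᵢ`. -/
noncomputable def mulVar (i : ι) : ((ι →₀ ℕ) → K) →ₗ[ℂ] ((ι →₀ ℕ) → K) where
  toFun F m := if m i = 0 then 0 else F (m - Finsupp.single i 1)
  map_add' _ _ := funext fun m => by by_cases h : m i = 0 <;> simp [h]
  map_smul' _ _ := funext fun m => by by_cases h : m i = 0 <;> simp [h]

/-- The partial derivative of a power series with coefficients in `K`. -/
noncomputable def partialDeriv (i : ι) : ((ι →₀ ℕ) → K) →ₗ[ℂ] ((ι →₀ ℕ) → K) where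
  toFun F m := ((m i : ℂ) + 1) • F (m + Finsupp.single i 1)
  map_add' _ _ := funext fun _ => smul_add _ _ _
  map_smul' _ _ := funext fun _ => smul_comm _ _ _

theorem mulVar_apply (i : ι) (F : (ι →₀ ℕ) → K) (m : ι →₀ ℕ) :
    mulVar i F m = if m i = 0 then 0 else F (m - Finsupp.single i 1) := rfl

theorem partialDeriv_apply (i : ι) (F : (ι →₀ ℕ) → K) (m : ι →₀ ℕ) :
    partialDeriv i F m = ((m i : ℂ) + 1) • F (m + Finsupp.single i 1) := rfl

theorem mulVar_partialDeriv (i : ι) (F : (ι →₀ ℕ) → K) (m : ι →₀ ℕ) :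
    mulVar i (partialDeriv i F) m = (m i : ℂ) • F m := by
  rw [mulVar_apply]
  split_ifs with h
  · rw [h, Nat.cast_zero, zero_smul]
  · have hle : Finsupp.single i 1 ≤ m := by
      rw [Finsupp.single_le_iff]; omega
    rw [partialDeriv_apply, tsub_add_cancel_of_le hle, Finsupp.tsub_apply, Finsupp.single_eq_same,
      Nat.cast_sub (by omega), Nat.cast_one, sub_add_cancel]

/-- The Weyl relation `[∂ᵢ, xᵢ] = 1`, the source of the number operator in `koszul_homotopy_add`. -/
theorem partialDeriv_mulVar_self (i : ι) (F : (ι →₀ ℕ) → K) :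
    partialDeriv i (mulVar i F) = mulVar i (partialDeriv i F) + F := by
  funext m
  rw [Pi.add_apply, mulVar_partialDeriv, partialDeriv_apply, mulVar_apply, if_neg (by simp),
    add_tsub_cancel_right, add_smul, one_smul]

theorem partialDeriv_mulVar_of_ne {i j : ι} (h : j ≠ i) (F : (ι →₀ ℕ) → K) :
    partialDeriv j (mulVar i F) = mulVar i (partialDeriv j F) := by
  funext m
  rw [partialDeriv_apply, mulVar_apply, mulVar_apply, Finsupp.add_apply,
    Finsupp.single_eq_of_ne h.symm, add_zero]
  split_ifs with hm
  · rw [smul_zero]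
  · have hle : Finsupp.single i 1 ≤ m := by
      rw [Finsupp.single_le_iff]; omega
    rw [partialDeriv_apply, tsub_add_eq_add_tsub hle, Finsupp.tsub_apply,
      Finsupp.single_eq_of_ne h, tsub_zero]

theorem mulVar_comm (i j : ι) (F : (ι →₀ ℕ) → K) :
    mulVar i (mulVar j F) = mulVar j (mulVar i F) := by
  obtain rfl | h := eq_or_ne i j
  · rfl
  funext m
  simp only [mulVar_apply, Finsupp.tsub_apply, Finsupp.single_eq_of_ne h,
    Finsupp.single_eq_of_ne h.symm, tsub_zero]
  split_ifs
  · rfl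
  · rfl
  · rfl
  · rw [tsub_right_comm]

theorem mulVar_compLeft (i : ι) (c : K →ₗ[ℂ] K) (F : (ι →₀ ℕ) → K) :
    mulVar i (c.compLeft (ι →₀ ℕ) F) = c.compLeft (ι →₀ ℕ) (mulVar i F) := by
  funext m
  change (if m i = 0 then 0 else c _) = c (if m i = 0 then 0 else _)
  split_ifs
  · rw [map_zero]
  · rfl

theorem partialDeriv_compLeft (i : ι) (c : K →ₗ[ℂ] K) (F : (ι →₀ ℕ) → K) :
    partialDeriv i (c.compLeft (ι →₀ ℕ) F) = c.compLeft (ι →₀ ℕ) (partialDeriv i F) :=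
  funext fun _ => (c.map_smul _ _).symm

/-- The equation `φ = φ₀ + Z φ` has a solution if `Z` raises the degree. -/
theorem exists_fixedPoint (Z : ((ι →₀ ℕ) → K) →ₗ[ℂ] ((ι →₀ ℕ) → K))
    (hZ : ∀ F m, (∀ m' : ι →₀ ℕ, m'.degree < m.degree → F m' = 0) → Z F m = 0)
    (φ₀ : (ι →₀ ℕ) → K) : ∃ φ, φ = φ₀ + Z φ := by
  have hZ' : ∀ F G m, (∀ m' : ι →₀ ℕ, m'.degree < m.degree → F m' = G m') → Z F m = Z G m := by
    intro F G m hFG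
    have := hZ (F - G) m fun m' hm' => sub_eq_zero.2 (hFG m' hm')
    rw [map_sub] at this
    exact sub_eq_zero.1 this
  -- Picard iteration: each application of `Z` fixes the coefficients of one more degree.
  let s : ℕ → ((ι →₀ ℕ) → K) := fun k => (fun F => φ₀ + Z F)^[k] φ₀
  have hs : ∀ k, s (k + 1) = φ₀ + Z (s k) := fun k => Function.iterate_succ_apply' _ _ _
  have h₁ : ∀ k m, m.degree < k → s k m = s (k + 1) m := by
    intro k
    induction k with
    | zero => exact fun m hm => absurd hm (Nat.not_lt_zero _)
    | succ k ih =>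
      intro m hm
      rw [hs, hs (k + 1), Pi.add_apply, Pi.add_apply,
        hZ' (s k) (s (k + 1)) m fun m' hm' => ih m' (by omega)]
  have h₂ : ∀ l k m, m.degree < k → s k m = s (k + l) m := by
    intro l
    induction l with
    | zero => exact fun _ _ _ => rfl
    | succ l ih => exact fun k m hm => (ih k m hm).trans (h₁ (k + l) m (by omega))
  -- Coefficients of degree `d` are constant from the iterate `d + 1` onwards, so this is the limit
  -- of the sequence.
  refine ⟨fun m => s (m.degree + 1) m, funext fun m => ?_⟩
  rw [hs, Pi.add_apply, Pi.add_apply]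
  congr 1
  refine hZ' _ _ m fun m' hm' => ?_
  obtain ⟨l, hl⟩ := Nat.exists_eq_add_of_lt hm'
  have := h₂ l (m'.degree + 1) m' (by omega)
  rw [this, hl]
  congr 1
  omega

/-- The uniqueness companion of `exists_fixedPoint`: a nonzero coefficient of lowest degree would be
produced from vanishing ones. -/
theorem eq_zero_of_fixedPoint (Z : ((ι →₀ ℕ) → K) →ₗ[ℂ] ((ι →₀ ℕ) → K))
    (hZ : ∀ F m, (∀ m' : ι →₀ ℕ, m'.degree < m.degree → F m' = 0) → Z F m = 0)
    (φ : (ι →₀ ℕ) → K) (h : φ = Z φ) : φ = 0 := by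
  have : ∀ k (m : ι →₀ ℕ), m.degree < k → φ m = 0 := by
    intro k
    induction k with
    | zero => exact fun m hm => absurd hm (Nat.not_lt_zero _)
    | succ k ih =>
      intro m hm
      rw [h]
      exact hZ _ _ fun m' hm' => ih m' (by omega)
  exact funext fun m => this _ m (Nat.lt_succ_self _)

section

variable [DecidableEq ι] {c a : ι → Module.End ℂ K}

/-- Operators `cᵢ` and `aᵢ` which satisfy the canonical anticommutation relations. -/
structure IsCAR (c a : ι → Module.End ℂ K) : Prop where
  cc : ∀ i j φ, c i (c j φ) + c j (c i φ) = 0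
  aa : ∀ i j φ, a i (a j φ) + a j (a i φ) = 0
  ca : ∀ i j φ, c i (a j φ) + a j (c i φ) = if i = j then φ else 0

/-- Since `cᵢ² = 0`, the relation `cᵢ aᵢ + aᵢ cᵢ = 1` gives `cᵢ aᵢ cᵢ = cᵢ`. -/
theorem IsCAR.isIdempotentElem (h : IsCAR c a) (i : ι) : IsIdempotentElem (a i * c i) := by
  refine LinearMap.ext fun φ => ?_
  have h₁ := h.ca i i (c i φ)
  have h₂ := h.cc i i φ
  rw [← two_smul ℂ] at h₂
  rw [(smul_eq_zero_iff_right (two_ne_zero' ℂ)).1 h₂, map_zero, add_zero, if_pos rfl] at h₁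
  change a i (c i (a i (c i φ))) = a i (c i φ)
  rw [h₁]

/-- For `i ≠ j` all four operators anticommute, and an even number of signs arises in exchanging the
two products. -/
theorem IsCAR.commute (h : IsCAR c a) (i j : ι) : Commute (a i * c i) (a j * c j) := by
  obtain rfl | hij := eq_or_ne i j
  · exact Commute.refl _
  refine LinearMap.ext fun φ => ?_
  change a i (c i (a j (c j φ))) = a j (c j (a i (c i φ)))
  have h₁ := h.ca i j (c j φ)
  have h₂ := h.ca j i (c i φ)
  rw [if_neg hij] at h₁
  rw [if_neg hij.symm] at h₂
  rw [eq_neg_of_add_eq_zero_left h₁, eq_neg_of_add_eq_zero_left h₂,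
    eq_neg_of_add_eq_zero_left (h.cc i j φ), map_neg, map_neg, map_neg, map_neg, neg_neg,
    eq_neg_of_add_eq_zero_left (h.aa i j _)]

/-- A sum of commuting idempotents has only natural numbers as eigenvalues, so adding `k` leaves it
injective as long as `-k` is not a natural number. The induction peels off one idempotent at a time
and needs no finiteness of `K`. -/
theorem IsCAR.eq_zero_of_sum (h : IsCAR c a) (s : Finset ι) :
    ∀ (k : ℂ), (∀ j : ℕ, k + j ≠ 0) → ∀ φ : K, k • φ + (∑ i ∈ s, a i * c i) φ = 0 → φ = 0 := by
  induction s using Finset.induction_on with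
  | empty =>
    intro k hk φ hφ
    rw [Finset.sum_empty, LinearMap.zero_apply, add_zero] at hφ
    refine (smul_eq_zero_iff_right ?_).1 hφ
    simpa using hk 0
  | insert i s hi ih =>
    intro k hk φ hφ
    rw [Finset.sum_insert hi, LinearMap.add_apply] at hφ
    -- On the image of the idempotent `aᵢ cᵢ` it acts as `1`, so the equation for `k` becomes one
    -- for `k + 1` over the smaller set.
    have hp : (a i * c i) φ = 0 := by
      refine ih (k + 1) (fun j => ?_) _ ?_
      · have := hk (j + 1)
        push_cast at this
        rwa [add_right_comm, add_assoc]
      · have h₁ := congrArg (a i * c i) hφ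
        have h₂ : (a i * c i) ((a i * c i) φ) = (a i * c i) φ :=
          DFunLike.congr_fun (h.isIdempotentElem i) φ
        have h₃ : (a i * c i) ((∑ i ∈ s, a i * c i) φ) = (∑ i ∈ s, a i * c i) ((a i * c i) φ) :=
          DFunLike.congr_fun (Commute.sum_right s _ _ fun j _ => h.commute i j) φ
        rw [map_add, map_add, map_smul, h₂, h₃, map_zero] at h₁
        rw [add_smul, one_smul, add_assoc]
        exact h₁
    rw [hp, zero_add] at hφ
    exact ih k hk φ hφ

end

variable {c a : ι → Module.End ℂ K} [Fintype ι]

/-- The Koszul differential `∑ xᵢ cᵢ`. -/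
noncomputable def koszul (c : ι → Module.End ℂ K) : ((ι →₀ ℕ) → K) →ₗ[ℂ] ((ι →₀ ℕ) → K) :=
  ∑ i, mulVar i ∘ₗ (c i).compLeft (ι →₀ ℕ)

/-- The operator `∑ aᵢ ∂ᵢ`. -/
noncomputable def koszulHomotopy (a : ι → Module.End ℂ K) : ((ι →₀ ℕ) → K) →ₗ[ℂ] ((ι →₀ ℕ) → K) :=
  ∑ i, (a i).compLeft (ι →₀ ℕ) ∘ₗ partialDeriv i

theorem koszul_apply (c : ι → Module.End ℂ K) (F : (ι →₀ ℕ) → K) :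
    koszul c F = ∑ i, mulVar i ((c i).compLeft (ι →₀ ℕ) F) := by
  simp [koszul]

theorem koszulHomotopy_apply (a : ι → Module.End ℂ K) (F : (ι →₀ ℕ) → K) :
    koszulHomotopy a F = ∑ i, (a i).compLeft (ι →₀ ℕ) (partialDeriv i F) := by
  simp [koszulHomotopy]

variable [DecidableEq ι]

/-- The `xᵢ xⱼ` are symmetric and the `cᵢ cⱼ` antisymmetric, so the double sum is its own negative.
-/
theorem koszul_koszul (h : IsCAR c a) (F : (ι →₀ ℕ) → K) : koszul c (koszul c F) = 0 := by
  have e : koszul c (koszul c F) = ∑ i, ∑ j,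
      mulVar i (mulVar j ((c i * c j).compLeft (ι →₀ ℕ) F)) := by
    rw [koszul_apply]
    refine Finset.sum_congr rfl fun i _ => ?_
    rw [koszul_apply, map_sum, map_sum]
    refine Finset.sum_congr rfl fun j _ => ?_
    rw [← mulVar_compLeft]
    rfl
  have e' : koszul c (koszul c F) + koszul c (koszul c F) = 0 := by
    conv_lhs => rw [e]; arg 2; rw [Finset.sum_comm]
    rw [← Finset.sum_add_distrib]
    refine Finset.sum_eq_zero fun i _ => ?_
    rw [← Finset.sum_add_distrib]
    refine Finset.sum_eq_zero fun j _ => ?_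
    rw [mulVar_comm j i, ← map_add, ← map_add]
    have : (c i * c j).compLeft (ι →₀ ℕ) F + (c j * c i).compLeft (ι →₀ ℕ) F = 0 :=
      funext fun m => h.cc i j (F m)
    rw [this, map_zero, map_zero]
  rw [← two_smul ℂ] at e'
  exact (smul_eq_zero_iff_right (two_ne_zero' ℂ)).1 e'

/-- The number operator of the canonical anticommutation relations. -/
noncomputable def numberOp (c a : ι → Module.End ℂ K) : Module.End ℂ K := ∑ i, a i * c i

/-- A Bochner-type formula: `δh + hδ` is the Euler operator `∑ xᵢ ∂ᵢ`, which multiplies by the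
degree, plus the number operator. -/
theorem koszul_homotopy_add (h : IsCAR c a) (F : (ι →₀ ℕ) → K) (m : ι →₀ ℕ) :
    koszul c (koszulHomotopy a F) m + koszulHomotopy a (koszul c F) m =
      (m.degree : ℂ) • F m + numberOp c a (F m) := by
  have e : koszul c (koszulHomotopy a F) + koszulHomotopy a (koszul c F) =
      ∑ i, (mulVar i (partialDeriv i F) + (a i * c i).compLeft (ι →₀ ℕ) F) := by
    have e₁ : koszul c (koszulHomotopy a F) = ∑ i, ∑ j,
        (c i * a j).compLeft (ι →₀ ℕ) (mulVar i (partialDeriv j F)) := by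
      rw [koszul_apply]
      refine Finset.sum_congr rfl fun i _ => ?_
      rw [koszulHomotopy_apply, map_sum, map_sum]
      refine Finset.sum_congr rfl fun j _ => ?_
      rw [mulVar_compLeft, mulVar_compLeft]
      rfl
    have e₂ : koszulHomotopy a (koszul c F) = ∑ i, ∑ j,
        (a j * c i).compLeft (ι →₀ ℕ) (partialDeriv j (mulVar i F)) := by
      rw [koszulHomotopy_apply, Finset.sum_comm]
      refine Finset.sum_congr rfl fun i _ => ?_
      rw [koszul_apply, map_sum, map_sum]
      refine Finset.sum_congr rfl fun j _ => ?_
      rw [mulVar_compLeft, partialDeriv_compLeft]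
      rfl
    rw [e₁, e₂, ← Finset.sum_add_distrib]
    refine Finset.sum_congr rfl fun i _ => ?_
    -- For `j ≠ i` the operators `∂ⱼ` and `xᵢ` commute and the anticommutator of `cᵢ` with `aⱼ` is
    -- zero. On the diagonal the anticommutator is `1`, and `[∂ᵢ, xᵢ] = 1` leaves the extra `aᵢ cᵢ`.
    rw [← Finset.sum_add_distrib, Finset.sum_eq_single i]
    · rw [partialDeriv_mulVar_self, map_add, ← add_assoc]
      congr 1
      funext m
      exact (h.ca i i _).trans (if_pos rfl)
    · intro j _ hj
      rw [partialDeriv_mulVar_of_ne hj]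
      funext m
      exact (h.ca i j _).trans (if_neg hj.symm)
    · exact fun hi => absurd (Finset.mem_univ i) hi
  have := congrFun e m
  rw [Pi.add_apply] at this
  rw [this, Finset.sum_apply, numberOp, LinearMap.sum_apply, Finsupp.degree_eq_sum, Nat.cast_sum,
    Finset.sum_smul, ← Finset.sum_add_distrib]
  refine Finset.sum_congr rfl fun i _ => ?_
  rw [Pi.add_apply, mulVar_partialDeriv]
  rfl

/-- The Koszul complex is contractible in positive degrees, by a homotopy which lowers the degree
by one. -/
theorem exists_koszul_contraction [FiniteDimensional ℂ K] (h : IsCAR c a) :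
    ∃ S : ((ι →₀ ℕ) → K) →ₗ[ℂ] ((ι →₀ ℕ) → K),
      (∀ F m, (∀ m' : ι →₀ ℕ, m'.degree = m.degree + 1 → F m' = 0) → S F m = 0) ∧
      ∀ F, F 0 = 0 → koszul c (S F) + S (koszul c F) = F := by
  let A : ℕ → Module.End ℂ K := fun k => (k : ℂ) • LinearMap.id + numberOp c a
  have hA : ∀ k : ℕ, k ≠ 0 → Function.Injective (A k) := fun k hk => by
    rw [injective_iff_map_eq_zero]
    refine fun φ hφ => h.eq_zero_of_sum Finset.univ k (fun j => ?_) φ hφ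
    rw [← Nat.cast_add, Nat.cast_ne_zero]
    omega
  -- Injectivity of `A k` gives an inverse because `K` is finite dimensional. The operator in degree
  -- zero is irrelevant: it is only ever applied to zero.
  have hU : ∀ k : ℕ, ∃ U : Module.End ℂ K, k ≠ 0 → ∀ φ, A k (U φ) = φ := fun k => by
    by_cases hk : k = 0
    · exact ⟨0, fun h => absurd hk h⟩
    · exact ⟨(LinearEquiv.ofInjectiveEndo (A k) (hA k hk)).symm, fun _ φ =>
        (LinearEquiv.ofInjectiveEndo (A k) (hA k hk)).apply_symm_apply φ⟩
  choose U hU using hU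
  let Tinv : ((ι →₀ ℕ) → K) →ₗ[ℂ] ((ι →₀ ℕ) → K) :=
    LinearMap.pi fun m => U m.degree ∘ₗ LinearMap.proj m
  have hT : ∀ F : (ι →₀ ℕ) → K, F 0 = 0 →
      koszul c (koszulHomotopy a (Tinv F)) + koszulHomotopy a (koszul c (Tinv F)) = F := by
    intro F hF
    funext m
    rw [Pi.add_apply, koszul_homotopy_add h]
    change A m.degree (U m.degree (F m)) = F m
    by_cases hm : m = 0
    · rw [hm, hF, map_zero, map_zero, map_zero]
    · exact hU _ (by rwa [Ne, Finsupp.degree_eq_zero_iff]) _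
  have hk0 : ∀ F : (ι →₀ ℕ) → K, koszul c F 0 = 0 := by
    intro F
    rw [koszul_apply, Finset.sum_apply]
    exact Finset.sum_eq_zero fun i _ => (mulVar_apply i _ 0).trans (if_pos rfl)
  -- The operator `δh + hδ` commutes with `δ` as `δ² = 0`; hence so does its inverse in positive
  -- degrees.
  have hδ : ∀ F : (ι →₀ ℕ) → K, F 0 = 0 → Tinv (koszul c F) = koszul c (Tinv F) := by
    intro F hF
    have h₁ := congrArg (koszul c) (hT F hF)
    rw [map_add, koszul_koszul h, zero_add] at h₁
    funext m
    by_cases hm : m = 0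
    · rw [hm, hk0]
      change U _ (koszul c F 0) = 0
      rw [hk0, map_zero]
    · have hm' : m.degree ≠ 0 := by rwa [Ne, Finsupp.degree_eq_zero_iff]
      refine hA m.degree hm' ?_
      change A _ (U _ (koszul c F m)) = _
      rw [hU _ hm', ← h₁]
      have h₂ := koszul_homotopy_add h (koszul c (Tinv F)) m
      rw [koszul_koszul h, map_zero, Pi.zero_apply, add_zero] at h₂
      exact h₂
  refine ⟨koszulHomotopy a ∘ₗ Tinv, fun F m hF => ?_, fun F hF => ?_⟩
  · rw [LinearMap.comp_apply, koszulHomotopy_apply, Finset.sum_apply]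
    refine Finset.sum_eq_zero fun i _ => ?_
    change a i (((m i : ℂ) + 1) • U (m + Finsupp.single i 1).degree
      (F (m + Finsupp.single i 1))) = 0
    rw [hF _ (by rw [map_add, Finsupp.degree_single]), map_zero, smul_zero, map_zero]
  · rw [LinearMap.comp_apply, LinearMap.comp_apply, hδ F hF]
    exact hT F hF

/-- A cocycle of a perturbation of the Koszul complex with prescribed constant term. -/
theorem exists_perturbed_cocycle [FiniteDimensional ℂ K] (h : IsCAR c a)
    (E : ((ι →₀ ℕ) → K) →ₗ[ℂ] ((ι →₀ ℕ) → K))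
    (hE : ∀ F m, (∀ m' : ι →₀ ℕ, m'.degree + 2 ≤ m.degree → F m' = 0) → E F m = 0)
    (hsq : ∀ F, koszul c (koszul c F + E F) + E (koszul c F + E F) = 0)
    (φ₀ : (ι →₀ ℕ) → K) (hφ₀ : koszul c φ₀ = 0) :
    ∃ φ, koszul c φ + E φ = 0 ∧ φ 0 = φ₀ 0 := by
  obtain ⟨S, hS, hS'⟩ := exists_koszul_contraction h
  have hE0 : ∀ F, E F 0 = 0 := fun F => hE F 0 fun m' hm' => by
    rw [map_zero] at hm'
    omega
  -- `E` raises the degree by at least two and `S` lowers it by one, so `-SE` raises it by at least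
  -- one.
  have hZ : ∀ F m, (∀ m' : ι →₀ ℕ, m'.degree < m.degree → F m' = 0) → (-(S ∘ₗ E)) F m = 0 := by
    intro F m hF
    change -(S (E F) m) = 0
    rw [hS, neg_zero]
    exact fun m' hm' => hE _ _ fun m'' hm'' => hF _ (by omega)
  obtain ⟨φ, hφ⟩ := exists_fixedPoint _ hZ φ₀
  -- With `φ = φ₀ - SEφ`, put `ψ = δφ + Eφ`. The contraction identity gives `ψ = SδEφ = Sδψ`, and
  -- `δψ = -Eψ` since the perturbed differential has square zero. So `ψ = -SEψ`, which forces `ψ =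
  -- 0`.
  refine ⟨φ, eq_zero_of_fixedPoint _ hZ _ ?_, ?_⟩
  · have h₁ : koszul c φ = -(E φ - S (koszul c (E φ))) := by
      have h₁ := hS' (E φ) (hE0 φ)
      conv_lhs => rw [hφ]
      rw [map_add, hφ₀, zero_add]
      change koszul c (-(S (E φ))) = _
      rw [map_neg]
      congr 1
      exact eq_sub_of_add_eq h₁
    have h₂ : koszul c φ + E φ = S (koszul c (E φ)) := by rw [h₁]; abel
    have h₃ : koszul c (koszul c φ + E φ) = koszul c (E φ) := by
      rw [map_add, koszul_koszul h, zero_add]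
    change _ = -(S (E (koszul c φ + E φ)))
    rw [← eq_neg_of_add_eq_zero_left (hsq φ) |> fun e => (congrArg S e).trans (map_neg S _), h₃, h₂]
  · conv_lhs => rw [hφ]
    rw [Pi.add_apply, hZ φ 0 (fun m' hm' => by rw [map_zero] at hm'; omega), add_zero]

end Koszul

/-! ### Coefficients of linear maps between free modules over a power series ring -/

section Coefficients

variable {n : ℕ} {A B C : Type*} [AddCommGroup A] [Module ℂ A] [AddCommGroup B] [Module ℂ B]
  [AddCommGroup C] [Module ℂ C]

/-- The coefficients of an element of `ℂ⟦x₁, …, xₙ⟧ ⊗ A`. -/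
noncomputable def tensorCoeff : (CSym n ⊗[ℂ] A) →ₗ[ℂ] ((Fin n →₀ ℕ) → A) :=
  LinearMap.pi fun m => TensorProduct.lift
    (LinearMap.lsmul ℂ A ∘ₗ (MvPowerSeries.coeff m : CSym n →ₗ[ℂ] ℂ))

theorem tensorCoeff_tmul (r : CSym n) (a : A) (m : Fin n →₀ ℕ) :
    tensorCoeff (r ⊗ₜ[ℂ] a) m = MvPowerSeries.coeff m r • a := rfl

theorem tensorCoeff_one_tmul (a : A) : tensorCoeff ((1 : CSym n) ⊗ₜ[ℂ] a) 0 = a := by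
  rw [tensorCoeff_tmul, MvPowerSeries.coeff_zero_one, one_smul]

theorem tensorCoeff_one_tmul_of_ne {m : Fin n →₀ ℕ} (hm : m ≠ 0) (a : A) :
    tensorCoeff ((1 : CSym n) ⊗ₜ[ℂ] a) m = 0 := by
  classical
  rw [tensorCoeff_tmul, MvPowerSeries.coeff_one, if_neg hm, zero_smul]

theorem tensorCoeff_smul (r : CSym n) (y : CSym n ⊗[ℂ] A) (m : Fin n →₀ ℕ) :
    tensorCoeff (r • y) m = ∑ p ∈ Finset.HasAntidiagonal.antidiagonal m,
      MvPowerSeries.coeff p.1 r • tensorCoeff y p.2 := by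
  induction y using TensorProduct.induction_on with
  | zero => simp
  | add x y hx hy =>
    rw [smul_add, map_add, Pi.add_apply, hx, hy, ← Finset.sum_add_distrib]
    refine Finset.sum_congr rfl fun p _ => ?_
    rw [map_add, Pi.add_apply, smul_add]
  | tmul s a =>
    rw [TensorProduct.smul_tmul', tensorCoeff_tmul, smul_eq_mul, MvPowerSeries.coeff_mul,
      Finset.sum_smul]
    exact Finset.sum_congr rfl fun p _ => mul_smul _ _ _

theorem tensorCoeff_X_smul (i : Fin n) (y : CSym n ⊗[ℂ] A) :
    tensorCoeff ((MvPowerSeries.X i : CSym n) • y) = mulVar i (tensorCoeff y) := by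
  funext m
  rw [mulVar_apply]
  induction y using TensorProduct.induction_on with
  | zero => simp
  | add x y hx hy =>
    rw [smul_add, map_add, Pi.add_apply, hx, hy, map_add, Pi.add_apply]
    split_ifs
    · rw [add_zero]
    · rfl
  | tmul s a =>
    rw [TensorProduct.smul_tmul', tensorCoeff_tmul, smul_eq_mul, MvPowerSeries.X_def,
      MvPowerSeries.coeff_monomial_mul, one_mul, tensorCoeff_tmul]
    by_cases h : m i = 0
    · rw [if_pos h, if_neg (by rw [Finsupp.single_le_iff]; omega), zero_smul]
    · rw [if_neg h, if_pos (by rw [Finsupp.single_le_iff]; omega)]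

/-- The tensor product needs no completion when `A` is finite dimensional: a basis identifies both
sides with finite tuples of power series. -/
theorem tensorCoeff_bijective [FiniteDimensional ℂ A] :
    Function.Bijective (tensorCoeff : (CSym n ⊗[ℂ] A) →ₗ[ℂ] ((Fin n →₀ ℕ) → A)) := by
  let β := Module.finBasis ℂ A
  have key : ∀ (r : Fin (Module.finrank ℂ A) → CSym n) (m : Fin n →₀ ℕ),
      tensorCoeff (∑ i, r i ⊗ₜ[ℂ] β i) m = ∑ i, MvPowerSeries.coeff m (r i) • β i := by
    intro r m
    rw [map_sum, Finset.sum_apply]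
    rfl
  refine ⟨?_, fun F => ?_⟩
  · rw [injective_iff_map_eq_zero]
    intro x hx
    have hx' : x = ∑ i, ((β.baseChange (CSym n)).repr x i) ⊗ₜ[ℂ] β i := by
      conv_lhs => rw [← (β.baseChange (CSym n)).sum_repr x]
      refine Finset.sum_congr rfl fun i _ => ?_
      rw [Module.Basis.baseChange_apply, TensorProduct.smul_tmul', smul_eq_mul, mul_one]
    rw [hx']
    refine Finset.sum_eq_zero fun i _ => ?_
    have : (β.baseChange (CSym n)).repr x i = 0 := MvPowerSeries.ext fun m => by
      have h := congrFun hx m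
      rw [hx', key, Pi.zero_apply] at h
      rw [map_zero]
      exact Fintype.linearIndependent_iff.1 β.linearIndependent _ h i
    rw [this, TensorProduct.zero_tmul]
  · let r : Fin (Module.finrank ℂ A) → CSym n := fun i m => β.repr (F m) i
    exact ⟨∑ i, r i ⊗ₜ[ℂ] β i, funext fun m => (key r m).trans (β.sum_repr (F m))⟩

/-- The coefficients of a linear map `ℂ⟦x₁, …, xₙ⟧ ⊗ A → ℂ⟦x₁, …, xₙ⟧ ⊗ B`. -/
noncomputable def homCoeff :
    ((CSym n ⊗[ℂ] A) →ₗ[CSym n] (CSym n ⊗[ℂ] B)) →ₗ[ℂ] ((Fin n →₀ ℕ) → (A →ₗ[ℂ] B)) where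
  toFun f m := LinearMap.proj m ∘ₗ tensorCoeff ∘ₗ f.restrictScalars ℂ ∘ₗ
    TensorProduct.mk ℂ (CSym n) A 1
  map_add' f g := funext fun m => LinearMap.ext fun a => by
    change tensorCoeff (f (1 ⊗ₜ a) + g (1 ⊗ₜ a)) m = _
    rw [map_add]
    rfl
  map_smul' c f := funext fun m => LinearMap.ext fun a => by
    change tensorCoeff (c • f (1 ⊗ₜ a)) m = _
    rw [map_smul]
    rfl

theorem homCoeff_apply (f : (CSym n ⊗[ℂ] A) →ₗ[CSym n] (CSym n ⊗[ℂ] B)) (m : Fin n →₀ ℕ) (a : A) :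
    homCoeff f m a = tensorCoeff (f (1 ⊗ₜ a)) m := rfl

theorem homCoeff_sub (f g : (CSym n ⊗[ℂ] A) →ₗ[CSym n] (CSym n ⊗[ℂ] B)) :
    homCoeff (f - g) = homCoeff f - homCoeff g :=
  map_sub homCoeff f g

/-- An `R`-linear map out of `R ⊗ A` is the same as a `ℂ`-linear map out of `A`, whose values are
then read off coefficientwise. This is how maps of factorizations become series with values in
`Hom_ℂ(A, B)`. -/
theorem homCoeff_bijective [FiniteDimensional ℂ B] :
    Function.Bijective (homCoeff (n := n) (A := A) (B := B)) := by
  refine ⟨?_, fun F => ?_⟩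
  · rw [injective_iff_map_eq_zero]
    intro f hf
    refine (LinearMap.liftBaseChangeEquiv (CSym n)).symm.injective (LinearMap.ext fun a => ?_)
    exact tensorCoeff_bijective.1 (funext fun m => DFunLike.congr_fun (congrFun hf m) a)
  · let Ω := LinearEquiv.ofBijective _ (tensorCoeff_bijective (n := n) (A := B))
    refine ⟨LinearMap.liftBaseChange (CSym n) (Ω.symm.toLinearMap ∘ₗ LinearMap.pi F),
      funext fun m => LinearMap.ext fun a => ?_⟩
    rw [homCoeff_apply, LinearMap.liftBaseChange_one_tmul]
    exact congrFun (Ω.apply_symm_apply _) m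

theorem homCoeff_X_smul (i : Fin n) (f : (CSym n ⊗[ℂ] A) →ₗ[CSym n] (CSym n ⊗[ℂ] B)) :
    homCoeff ((MvPowerSeries.X i : CSym n) • f) = mulVar i (homCoeff f) := by
  funext m
  refine LinearMap.ext fun a => ?_
  rw [homCoeff_apply, LinearMap.smul_apply, tensorCoeff_X_smul, mulVar_apply, mulVar_apply]
  split_ifs
  · rfl
  · rfl

theorem tensorCoeff_hom_apply (f : (CSym n ⊗[ℂ] A) →ₗ[CSym n] (CSym n ⊗[ℂ] B))
    (y : CSym n ⊗[ℂ] A) (m : Fin n →₀ ℕ) :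
    tensorCoeff (f y) m =
      ∑ p ∈ Finset.HasAntidiagonal.antidiagonal m, homCoeff f p.1 (tensorCoeff y p.2) := by
  induction y using TensorProduct.induction_on with
  | zero => simp
  | add x y hx hy =>
    rw [map_add, map_add, Pi.add_apply, hx, hy, ← Finset.sum_add_distrib]
    refine Finset.sum_congr rfl fun p _ => ?_
    rw [map_add, Pi.add_apply, map_add]
  | tmul r a =>
    have h : r ⊗ₜ[ℂ] a = r • ((1 : CSym n) ⊗ₜ[ℂ] a) := by
      rw [TensorProduct.smul_tmul', smul_eq_mul, mul_one]
    rw [h, map_smul, tensorCoeff_smul, ← h]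
    -- In the expansion of `r • f (1 ⊗ a)` the scalar's exponent comes first, whereas the statement
    -- puts that of `f` first.
    conv_lhs => rw [← Finset.HasAntidiagonal.map_swap_antidiagonal, Finset.sum_map]
    refine Finset.sum_congr rfl fun p _ => ?_
    rw [tensorCoeff_tmul, map_smul]
    rfl

theorem homCoeff_comp (f : (CSym n ⊗[ℂ] B) →ₗ[CSym n] (CSym n ⊗[ℂ] C))
    (g : (CSym n ⊗[ℂ] A) →ₗ[CSym n] (CSym n ⊗[ℂ] B)) (m : Fin n →₀ ℕ) :
    homCoeff (f ∘ₗ g) m =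
      ∑ p ∈ Finset.HasAntidiagonal.antidiagonal m, homCoeff f p.1 ∘ₗ homCoeff g p.2 := by
  refine LinearMap.ext fun a => ?_
  rw [homCoeff_apply, LinearMap.comp_apply, tensorCoeff_hom_apply, LinearMap.sum_apply]
  rfl

theorem homCoeff_baseChange (φ : A →ₗ[ℂ] B) (m : Fin n →₀ ℕ) :
    homCoeff (φ.baseChange (CSym n)) m = if m = 0 then φ else 0 := by
  refine LinearMap.ext fun a => ?_
  rw [homCoeff_apply, LinearMap.baseChange_tmul]
  split_ifs with h
  · rw [h, tensorCoeff_one_tmul]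
  · rw [tensorCoeff_one_tmul_of_ne h, LinearMap.zero_apply]

theorem homCoeff_id (m : Fin n →₀ ℕ) :
    homCoeff (LinearMap.id : (CSym n ⊗[ℂ] A) →ₗ[CSym n] (CSym n ⊗[ℂ] A)) m =
      if m = 0 then LinearMap.id else 0 := by
  rw [← homCoeff_baseChange, LinearMap.baseChange_id]

theorem homCoeff_baseChange_comp (φ : B →ₗ[ℂ] C)
    (g : (CSym n ⊗[ℂ] A) →ₗ[CSym n] (CSym n ⊗[ℂ] B)) (m : Fin n →₀ ℕ) :
    homCoeff (φ.baseChange (CSym n) ∘ₗ g) m = φ ∘ₗ homCoeff g m := by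
  rw [homCoeff_comp, Finset.sum_eq_single (0, m)]
  · rw [homCoeff_baseChange, if_pos rfl]
  · rintro ⟨p, q⟩ hp hne
    rw [homCoeff_baseChange, if_neg, LinearMap.zero_comp]
    rintro rfl
    rw [Finset.HasAntidiagonal.mem_antidiagonal, zero_add] at hp
    exact hne (by rw [← hp])
  · exact fun h => absurd (Finset.HasAntidiagonal.mem_antidiagonal.2 (zero_add m)) h

theorem homCoeff_comp_baseChange (f : (CSym n ⊗[ℂ] B) →ₗ[CSym n] (CSym n ⊗[ℂ] C))
    (φ : A →ₗ[ℂ] B) (m : Fin n →₀ ℕ) :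
    homCoeff (f ∘ₗ φ.baseChange (CSym n)) m = homCoeff f m ∘ₗ φ :=
  LinearMap.ext fun _ => rfl

/-- If `f` has no coefficients of degree less than `k`, then a coefficient of `f ∘ g` depends only
on coefficients of `g` of a degree smaller by `k`. -/
theorem homCoeff_comp_eq_zero (k : ℕ) (f : (CSym n ⊗[ℂ] B) →ₗ[CSym n] (CSym n ⊗[ℂ] C))
    (hf : ∀ m : Fin n →₀ ℕ, m.degree < k → homCoeff f m = 0)
    (g : (CSym n ⊗[ℂ] A) →ₗ[CSym n] (CSym n ⊗[ℂ] B)) (m : Fin n →₀ ℕ)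
    (hg : ∀ m' : Fin n →₀ ℕ, m'.degree + k ≤ m.degree → homCoeff g m' = 0) :
    homCoeff (f ∘ₗ g) m = 0 := by
  rw [homCoeff_comp]
  refine Finset.sum_eq_zero fun p hp => ?_
  rw [Finset.HasAntidiagonal.mem_antidiagonal] at hp
  have hd : p.1.degree + p.2.degree = m.degree := by rw [← map_add, hp]
  by_cases h : p.1.degree < k
  · rw [hf _ h, LinearMap.zero_comp]
  · rw [hg _ (by omega), LinearMap.comp_zero]

/-- An endomorphism with constant term the identity is bijective. -/
theorem bijective_of_homCoeff_zero [FiniteDimensional ℂ A]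
    (f : (CSym n ⊗[ℂ] A) →ₗ[CSym n] (CSym n ⊗[ℂ] A)) (hf : homCoeff f 0 = LinearMap.id) :
    Function.Bijective f := by
  let Θ := LinearEquiv.ofBijective _ (homCoeff_bijective (n := n) (A := A) (B := A))
  let ν := LinearMap.id - f
  have hν : ∀ m : Fin n →₀ ℕ, m.degree < 1 → homCoeff ν m = 0 := by
    intro m hm
    have hm : m = 0 := (Finsupp.degree_eq_zero_iff m).1 (by omega)
    rw [hm, homCoeff_sub, Pi.sub_apply, hf, homCoeff_id, if_pos rfl, sub_self]
  let Z : ((Fin n →₀ ℕ) → (A →ₗ[ℂ] A)) →ₗ[ℂ] ((Fin n →₀ ℕ) → (A →ₗ[ℂ] A)) :=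
    { toFun := fun F => homCoeff (ν ∘ₗ Θ.symm F)
      map_add' := fun F G => by rw [map_add, LinearMap.comp_add, map_add]
      map_smul' := fun c F => by
        have h : ν ∘ₗ (c • Θ.symm F) = c • (ν ∘ₗ Θ.symm F) :=
          LinearMap.ext fun x => (ν.restrictScalars ℂ).map_smul c (Θ.symm F x)
        rw [map_smul, RingHom.id_apply, h, map_smul] }
  -- With `ν = 1 - f`, the solution of `g = 1 + νg` is the Neumann series. It makes sense because
  -- `ν` has no constant term, and it is a right inverse of `f`.
  obtain ⟨F, hF⟩ := exists_fixedPoint Z (fun F m h =>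
      homCoeff_comp_eq_zero 1 ν hν _ _ fun m' hm' => by
    change Θ (Θ.symm F) m' = 0
    rw [Θ.apply_symm_apply]
    exact h m' (by omega)) (homCoeff LinearMap.id)
  have hg : f ∘ₗ Θ.symm F = LinearMap.id := by
    refine homCoeff_bijective.1 ?_
    have h₁ : homCoeff (Θ.symm F) = homCoeff LinearMap.id + homCoeff (ν ∘ₗ Θ.symm F) :=
      (Θ.apply_symm_apply F).trans hF
    rw [LinearMap.sub_comp, LinearMap.id_comp, homCoeff_sub] at h₁
    have h₂ : homCoeff (f ∘ₗ Θ.symm F) = homCoeff LinearMap.id + (homCoeff (Θ.symm F) -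
      homCoeff (f ∘ₗ Θ.symm F)) - homCoeff (Θ.symm F) + homCoeff (f ∘ₗ Θ.symm F) := by
      rw [← h₁]; abel
    rw [h₂]; abel
  have hs : Function.Surjective f := fun y => ⟨Θ.symm F y, LinearMap.congr_fun hg y⟩
  -- The module is finitely generated over a commutative ring, so surjectivity suffices.
  exact ⟨OrzechProperty.injective_of_surjective_endomorphism f hs, hs⟩

end Coefficients

/-! ### Parity operators -/

section Parity

variable {R : Type*} [CommRing R] {M N : Type*} [AddCommGroup M] [Module R M] [AddCommGroup N]
  [Module R N]

/-- The operator `ε` is the identity on the even part and minus the identity on the odd part. -/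
structure IsParity (P : ZMod 2 → Submodule R M) (ε : M →ₗ[R] M) : Prop where
  even : ∀ x ∈ P 0, ε x = x
  odd : ∀ x ∈ P 1, ε x = -x

theorem exists_isParity {P : ZMod 2 → Submodule R M} (h : IsCompl (P 0) (P 1)) :
    ∃ ε, IsParity P ε := by
  refine ⟨(P 0).subtype ∘ₗ (P 0).projectionOnto (P 1) h -
    (P 1).subtype ∘ₗ (P 1).projectionOnto (P 0) h.symm, fun x hx => ?_, fun x hx => ?_⟩
  · have h₁ := Submodule.projectionOnto_apply_left h ⟨x, hx⟩
    have h₂ := Submodule.projectionOnto_apply_right h.symm ⟨x, hx⟩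
    change ((P 0).projectionOnto (P 1) h x : M) - ((P 1).projectionOnto (P 0) h.symm x : M) = x
    rw [h₁, h₂, Submodule.coe_zero, sub_zero]
  · have h₁ := Submodule.projectionOnto_apply_right h ⟨x, hx⟩
    have h₂ := Submodule.projectionOnto_apply_left h.symm ⟨x, hx⟩
    change ((P 0).projectionOnto (P 1) h x : M) - ((P 1).projectionOnto (P 0) h.symm x : M) = -x
    rw [h₁, h₂, Submodule.coe_zero, zero_sub]

theorem forall_zmod_two {p : ZMod 2 → Prop} (h₀ : p 0) (h₁ : p 1) (i : ZMod 2) : p i := by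
  have hi : ∀ k : ZMod 2, k = 0 ∨ k = 1 := by decide
  rcases hi i with rfl | rfl
  · exact h₀
  · exact h₁

variable {P : ZMod 2 → Submodule R M} {P' : ZMod 2 → Submodule R N} {ε : M →ₗ[R] M}
  {ε' : N →ₗ[R] N}

theorem exists_even_add_odd (h : IsCompl (P 0) (P 1)) (x : M) :
    ∃ y ∈ P 0, ∃ z ∈ P 1, x = y + z := by
  obtain ⟨y, z, hy, hz, rfl⟩ := Submodule.codisjoint_iff_exists_add_eq.1 h.codisjoint x
  exact ⟨y, hy, z, hz, rfl⟩

theorem IsParity.apply_apply (hε : IsParity P ε) (h : IsCompl (P 0) (P 1)) (x : M) :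
    ε (ε x) = x := by
  obtain ⟨y, hy, z, hz, rfl⟩ := exists_even_add_odd h x
  rw [map_add, hε.even y hy, hε.odd z hz, map_add, hε.even y hy, map_neg, hε.odd z hz, neg_neg]

theorem IsParity.comm_of_even (hε : IsParity P ε) (hε' : IsParity P' ε') (h : IsCompl (P 0) (P 1))
    (f : M →+ N) (hf : ∀ i, ∀ x ∈ P i, f x ∈ P' i) (x : M) : f (ε x) = ε' (f x) := by
  obtain ⟨y, hy, z, hz, rfl⟩ := exists_even_add_odd h x
  rw [map_add, hε.even y hy, hε.odd z hz, map_add, map_add, map_add, map_neg,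
    hε'.even _ (hf 0 y hy), hε'.odd _ (hf 1 z hz)]

theorem IsParity.anticomm_of_odd (hε : IsParity P ε) (hε' : IsParity P' ε')
    (h : IsCompl (P 0) (P 1)) (f : M →+ N) (hf : ∀ i, ∀ x ∈ P i, f x ∈ P' (i + 1)) (x : M) :
    f (ε x) = -ε' (f x) := by
  obtain ⟨y, hy, z, hz, rfl⟩ := exists_even_add_odd h x
  rw [map_add, hε.even y hy, hε.odd z hz, map_add, map_add, map_add, map_neg,
    hε'.odd (f y) (hf 0 y hy), hε'.even (f z) (hf 1 z hz), neg_add, neg_neg]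

variable [Algebra ℂ R]

theorem eq_zero_of_add_self (R : Type*) [CommRing R] [Algebra ℂ R] {M : Type*} [AddCommGroup M]
    [Module R M] {x : M} (h : x + x = 0) : x = 0 := by
  have h₁ : algebraMap ℂ R (1 / 2) + algebraMap ℂ R (1 / 2) = 1 := by
    rw [← map_add, add_halves, map_one]
  rw [← one_smul R x, ← h₁, add_smul, ← smul_add, h, smul_zero]

theorem IsParity.mem_even (hε : IsParity P ε) (h : IsCompl (P 0) (P 1)) {x : M}
    (hx : ε x = x) : x ∈ P 0 := by
  obtain ⟨y, hy, z, hz, rfl⟩ := exists_even_add_odd h x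
  rw [map_add, hε.even y hy, hε.odd z hz, add_right_inj] at hx
  rw [eq_zero_of_add_self R (eq_neg_iff_add_eq_zero.1 hx.symm), add_zero]
  exact hy

theorem IsParity.mem_odd (hε : IsParity P ε) (h : IsCompl (P 0) (P 1)) {x : M}
    (hx : ε x = -x) : x ∈ P 1 := by
  obtain ⟨y, hy, z, hz, rfl⟩ := exists_even_add_odd h x
  rw [map_add, hε.even y hy, hε.odd z hz, neg_add, add_left_inj] at hx
  rw [eq_zero_of_add_self R (eq_neg_iff_add_eq_zero.1 hx), zero_add]
  exact hz

/-- Because `2` is invertible, membership in the pieces can be recovered from `ε`. Degree conditions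
thus become identities between operators, which can be compared coefficient by coefficient. -/
theorem IsParity.even_of_comm (hε : IsParity P ε) (hε' : IsParity P' ε')
    (h' : IsCompl (P' 0) (P' 1)) (f : M →+ N) (hf : ∀ x, f (ε x) = ε' (f x)) :
    ∀ i, ∀ x ∈ P i, f x ∈ P' i :=
  forall_zmod_two
    (fun x hx => hε'.mem_even h' (by rw [← hf, hε.even x hx]))
    (fun x hx => hε'.mem_odd h' (by rw [← hf, hε.odd x hx, map_neg]))

theorem IsParity.odd_of_anticomm (hε : IsParity P ε) (hε' : IsParity P' ε')
    (h' : IsCompl (P' 0) (P' 1)) (f : M →+ N) (hf : ∀ x, f (ε x) = -ε' (f x)) :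
    ∀ i, ∀ x ∈ P i, f x ∈ P' (i + 1) :=
  forall_zmod_two
    (fun x hx => hε'.mem_odd h' (by rw [← neg_eq_iff_eq_neg, ← hf, hε.even x hx]))
    (fun x hx => hε'.mem_even h' (by
      rw [← neg_eq_iff_eq_neg.2 (hf x), hε.odd x hx, map_neg, neg_neg]))

theorem IsParity.baseChange {A : Type*} [AddCommGroup A] [Module ℂ A] {P : ZMod 2 → Submodule ℂ A}
    {ε : A →ₗ[ℂ] A} (hε : IsParity P ε) :
    IsParity (fun i => (P i).baseChange R) (ε.baseChange R) where
  even := by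
    rintro _ ⟨y, rfl⟩
    induction y using TensorProduct.induction_on with
    | zero => rw [map_zero, map_zero]
    | add x y hx hy => rw [map_add, map_add, hx, hy]
    | tmul r a => exact congrArg (r ⊗ₜ[ℂ] ·) (hε.even a a.2)
  odd := by
    rintro _ ⟨y, rfl⟩
    induction y using TensorProduct.induction_on with
    | zero => rw [map_zero, map_zero, neg_zero]
    | add x y hx hy => rw [map_add, map_add, hx, hy, neg_add]
    | tmul r a =>
      exact (congrArg (r ⊗ₜ[ℂ] ·) (hε.odd a a.2)).trans (TensorProduct.tmul_neg _ _)

end Parity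

/-! ### The functor `Φ` on morphisms up to homotopy -/

section FullyFaithful

variable {V : Type v} [AddCommGroup V] [Module ℂ V] {n : ℕ} (b : Module.Basis (Fin n) ℂ V)
variable {Q : QuadraticForm ℂ V}

include b in
theorem ClMod.finiteDimensional (A : ClMod.{u} Q) : FiniteDimensional ℂ A.carrier :=
  haveI : Module.Finite ℂ V := .of_basis b
  haveI : Module.Finite ℂ (CliffordAlgebra Q) := finite_clifford
  Module.Finite.trans (CliffordAlgebra Q) _

/-- The action of a vector on a Clifford module. -/
noncomputable def cliffSmul (A : ClMod.{u} Q) (v : V) : A.carrier →ₗ[ℂ] A.carrier :=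
  Algebra.lsmul ℂ ℂ A.carrier (CliffordAlgebra.ι Q v)

theorem cliffSmul_apply (A : ClMod.{u} Q) (v : V) (x : A.carrier) :
    cliffSmul A v x = CliffordAlgebra.ι Q v • x := rfl

theorem cliffSmul_add_swap (A : ClMod.{u} Q) (v w : V) (x : A.carrier) :
    cliffSmul A v (cliffSmul A w x) + cliffSmul A w (cliffSmul A v x) =
      (2 * QuadraticMap.associated (R := ℂ) Q v w) • x := by
  have h := DFunLike.congr_fun (DFunLike.congr_fun (QuadraticMap.two_nsmul_associated ℂ Q) v) w
  change 2 • QuadraticMap.associated (R := ℂ) Q v w = QuadraticMap.polar Q v w at h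
  rw [cliffSmul_apply, cliffSmul_apply, cliffSmul_apply, cliffSmul_apply, smul_smul, smul_smul,
    ← add_smul, CliffordAlgebra.ι_mul_ι_add_swap, ← h, algebraMap_smul, nsmul_eq_mul,
    Nat.cast_ofNat]

theorem cliffSmul_parity {A : ClMod.{u} Q} {ε : A.carrier →ₗ[ℂ] A.carrier}
    (hε : IsParity A.piece ε) (v : V) (x : A.carrier) :
    cliffSmul A v (ε x) = -ε (cliffSmul A v x) :=
  hε.anticomm_of_odd hε A.isCompl (cliffSmul A v).toAddMonoidHom (fun i x hx => by
    rw [add_comm]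
    exact A.smul_mem 1 i _ _ (CliffordAlgebra.ι_mem_evenOdd_one _ _) hx) x

variable {A B : ClMod.{u} Q} (εA : A.carrier →ₗ[ℂ] A.carrier) (εB : B.carrier →ₗ[ℂ] B.carrier)

/-- Multiplication by a vector on the left, on linear maps between Clifford modules. -/
noncomputable def cliffLeft (A B : ClMod.{u} Q) (v : V) :
    Module.End ℂ (A.carrier →ₗ[ℂ] B.carrier) where
  toFun φ := cliffSmul B v ∘ₗ φ
  map_add' _ _ := LinearMap.comp_add _ _ _
  map_smul' _ _ := LinearMap.comp_smul _ _ _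

/-- Multiplication by a vector on the right with the sign of the parity, on linear maps between
Clifford modules. -/
noncomputable def cliffRight (v : V) : Module.End ℂ (A.carrier →ₗ[ℂ] B.carrier) where
  toFun φ := εB ∘ₗ φ ∘ₗ εA ∘ₗ cliffSmul A v
  map_add' _ _ := by rw [LinearMap.add_comp, LinearMap.comp_add]
  map_smul' _ _ := by rw [LinearMap.smul_comp, LinearMap.comp_smul]; rfl

variable {εA εB}

theorem cliffLeft_add_swap (v w : V) (φ : A.carrier →ₗ[ℂ] B.carrier) :
    cliffLeft A B v (cliffLeft A B w φ) + cliffLeft A B w (cliffLeft A B v φ) =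
      (2 * QuadraticMap.associated (R := ℂ) Q v w) • φ :=
  LinearMap.ext fun x => cliffSmul_add_swap B v w (φ x)

/-- Conjugation by the parities multiplies a homogeneous `φ` by `(-1)^|φ|`. Moving the inner parity
past an odd vector produces the sign, so the right action is a Clifford action for `-Q`. -/
theorem cliffRight_add_swap (hA : IsParity A.piece εA) (hB : IsParity B.piece εB) (v w : V)
    (φ : A.carrier →ₗ[ℂ] B.carrier) :
    cliffRight εA εB v (cliffRight εA εB w φ) + cliffRight εA εB w (cliffRight εA εB v φ) =
      -(2 * QuadraticMap.associated (R := ℂ) Q v w) • φ := by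
  refine LinearMap.ext fun x => ?_
  change εB (εB (φ (εA (cliffSmul A w (εA (cliffSmul A v x)))))) +
    εB (εB (φ (εA (cliffSmul A v (εA (cliffSmul A w x)))))) =
      -(2 * QuadraticMap.associated (R := ℂ) Q v w) • φ x
  simp only [hB.apply_apply B.isCompl, cliffSmul_parity hA, map_neg, hA.apply_apply A.isCompl]
  rw [← neg_add, ← map_add, add_comm, cliffSmul_add_swap, map_smul, neg_smul]

theorem cliffLeft_cliffRight (hB : IsParity B.piece εB) (v w : V)
    (φ : A.carrier →ₗ[ℂ] B.carrier) :
    cliffLeft A B v (cliffRight εA εB w φ) = -cliffRight εA εB w (cliffLeft A B v φ) :=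
  LinearMap.ext fun _ => cliffSmul_parity hB v _

/-- The supercommutators with the vectors `v i` satisfy the canonical anticommutation relations
together with the anticommutators with dual vectors. -/
theorem isCAR_clifford {ι : Type*} [DecidableEq ι] (v w : ι → V)
    (hvw : ∀ i j, QuadraticMap.associated (R := ℂ) Q (v i) (w j) = if i = j then 1 else 0)
    (hA : IsParity A.piece εA) (hB : IsParity B.piece εB) :
    IsCAR (fun i => cliffLeft A B (v i) - cliffRight εA εB (v i))
      (fun j => (1 / 4 : ℂ) • (cliffLeft A B (w j) + cliffRight εA εB (w j))) where
  cc i j φ := by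
    simp only [LinearMap.sub_apply, map_sub]
    have h₁ := cliffLeft_add_swap (v i) (v j) φ
    have h₂ := cliffRight_add_swap hA hB (v i) (v j) φ
    have h₃ := cliffLeft_cliffRight (εA := εA) hB (v i) (v j) φ
    have h₄ := cliffLeft_cliffRight (εA := εA) hB (v j) (v i) φ
    rw [h₃, h₄]
    linear_combination (norm := module) h₁ + h₂
  aa i j φ := by
    simp only [LinearMap.add_apply, LinearMap.smul_apply, map_add, map_smul]
    have h₁ := cliffLeft_add_swap (w i) (w j) φ
    have h₂ := cliffRight_add_swap hA hB (w i) (w j) φ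
    have h₃ := cliffLeft_cliffRight (εA := εA) hB (w i) (w j) φ
    have h₄ := cliffLeft_cliffRight (εA := εA) hB (w j) (w i) φ
    rw [h₃, h₄]
    linear_combination (norm := module) (1 / 16 : ℂ) • h₁ + (1 / 16 : ℂ) • h₂
  -- With `ℓ` and `r` the left and right actions, the mixed terms cancel and `{ℓ_v - r_v, ℓ_w + r_w}
  -- = {ℓ_v, ℓ_w} - {r_v, r_w} = 4 B(v, w)`; hence the factor `1/4`. In `cc` and `aa` the
  -- contributions of `Q` and `-Q` cancel instead.
  ca i j φ := by
    simp only [LinearMap.add_apply, LinearMap.sub_apply, LinearMap.smul_apply, map_add, map_sub,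
      map_smul]
    have h₁ := cliffLeft_add_swap (v i) (w j) φ
    have h₂ := cliffRight_add_swap hA hB (v i) (w j) φ
    have h₃ := cliffLeft_cliffRight (εA := εA) hB (v i) (w j) φ
    have h₄ := cliffLeft_cliffRight (εA := εA) hB (w j) (v i) φ
    have h₅ : (if i = j then φ else 0) = QuadraticMap.associated (R := ℂ) Q (v i) (w j) • φ := by
      rw [hvw]
      split_ifs
      · rw [one_smul]
      · rw [zero_smul]
    rw [h₃, h₄, h₅]
    linear_combination (norm := module) (1 / 4 : ℂ) • h₁ - (1 / 4 : ℂ) • h₂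

theorem behD_eq (A : ClMod.{u} Q) : behD b Q A =
    ∑ j, (MvPowerSeries.X j : CSym n) • (cliffSmul A (b j)).baseChange (CSym n) := rfl

theorem homCoeff_behD_comp (f : (CSym n ⊗[ℂ] A.carrier) →ₗ[CSym n] (CSym n ⊗[ℂ] B.carrier)) :
    homCoeff (behD b Q B ∘ₗ f) =
      ∑ j, mulVar j ((cliffLeft A B (b j)).compLeft (Fin n →₀ ℕ) (homCoeff f)) := by
  have h : behD b Q B ∘ₗ f = ∑ j, ((MvPowerSeries.X j : CSym n) •
      (cliffSmul B (b j)).baseChange (CSym n)) ∘ₗ f :=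
    LinearMap.ext fun x => by
      rw [behD_eq, LinearMap.comp_apply, LinearMap.sum_apply, LinearMap.sum_apply]
      rfl
  rw [h, map_sum]
  refine Finset.sum_congr rfl fun j _ => ?_
  rw [LinearMap.smul_comp, homCoeff_X_smul]
  congr 1
  funext m
  exact homCoeff_baseChange_comp _ _ _

theorem homCoeff_comp_behD (f : (CSym n ⊗[ℂ] A.carrier) →ₗ[CSym n] (CSym n ⊗[ℂ] B.carrier)) :
    homCoeff (f ∘ₗ behD b Q A) =
      ∑ j, mulVar j (fun m => homCoeff f m ∘ₗ cliffSmul A (b j)) := by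
  have h : f ∘ₗ behD b Q A = ∑ j, f ∘ₗ ((MvPowerSeries.X j : CSym n) •
      (cliffSmul A (b j)).baseChange (CSym n)) :=
    LinearMap.ext fun x => by
      rw [behD_eq, LinearMap.comp_apply, LinearMap.sum_apply, LinearMap.sum_apply, map_sum]
      rfl
  rw [h, map_sum]
  refine Finset.sum_congr rfl fun j _ => ?_
  rw [LinearMap.comp_smul, homCoeff_X_smul]
  congr 1

/-- The supercommutator with the twisted differentials of `Φ(A)` and `Φ(B)` is a Koszul
differential. -/
theorem koszul_homCoeff (f : (CSym n ⊗[ℂ] A.carrier) →ₗ[CSym n] (CSym n ⊗[ℂ] B.carrier)) :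
    koszul (fun i => cliffLeft A B (b i) - cliffRight εA εB (b i)) (homCoeff f) =
      homCoeff (behD b Q B ∘ₗ f -
        (εB.baseChange (CSym n) ∘ₗ f ∘ₗ εA.baseChange (CSym n)) ∘ₗ behD b Q A) := by
  rw [homCoeff_sub, homCoeff_behD_comp, homCoeff_comp_behD, koszul_apply,
    ← Finset.sum_sub_distrib]
  refine Finset.sum_congr rfl fun j _ => ?_
  rw [← map_sub]
  congr 1
  funext m
  rw [Pi.sub_apply, homCoeff_baseChange_comp]
  rfl

theorem behD_parity (hA : IsParity A.piece εA) (x : CSym n ⊗[ℂ] A.carrier) :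
    behD b Q A (εA.baseChange (CSym n) x) = -εA.baseChange (CSym n) (behD b Q A x) :=
  (hA.baseChange (R := CSym n)).anticomm_of_odd (hA.baseChange (R := CSym n))
    (isCompl_baseChange _ A.isCompl) (behD b Q A).toAddMonoidHom (behD_mem b Q A) x

include b in
theorem exists_dual_vectors (hnd : (QuadraticMap.associated (R := ℂ) Q).Nondegenerate) :
    ∃ w : Fin n → V, ∀ i j,
      QuadraticMap.associated (R := ℂ) Q (b i) (w j) = if i = j then 1 else 0 := by
  have : FiniteDimensional ℂ V := .of_basis b
  let B : LinearMap.BilinForm ℂ V := QuadraticMap.associated (R := ℂ) Q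
  have hB : B.Nondegenerate := hnd
  exact ⟨B.dualBasis hB b, B.apply_dualBasis_right hB
    ⟨fun x y => QuadraticMap.associated_isSymm ℂ Q x y⟩ b⟩

/-- A closed map `Φ(A) → Φ(B)` of degree zero without constant term is null-homotopic. -/
theorem exists_homotopy_of_homCoeff_zero
    (hnd : (QuadraticMap.associated (R := ℂ) Q).Nondegenerate)
    (hA : IsParity A.piece εA) (hB : IsParity B.piece εB)
    (g : (CSym n ⊗[ℂ] A.carrier) →ₗ[CSym n] (CSym n ⊗[ℂ] B.carrier))
    (heven : ∀ x, g (εA.baseChange (CSym n) x) = εB.baseChange (CSym n) (g x))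
    (hclosed : ∀ x, behD b Q B (g x) = g (behD b Q A x)) (h₀ : homCoeff g 0 = 0) :
    ∃ h : (CSym n ⊗[ℂ] A.carrier) →ₗ[CSym n] (CSym n ⊗[ℂ] B.carrier),
      (∀ x, h (εA.baseChange (CSym n) x) = -εB.baseChange (CSym n) (h x)) ∧
      g = behD b Q B ∘ₗ h + h ∘ₗ behD b Q A := by
  have := ClMod.finiteDimensional b A
  have := ClMod.finiteDimensional b B
  obtain ⟨w, hw⟩ := exists_dual_vectors b hnd
  obtain ⟨S, -, hS⟩ := exists_koszul_contraction (isCAR_clifford (⇑b) w hw hA hB)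
  have hA' := (hA.baseChange (R := CSym n)).apply_apply (isCompl_baseChange _ A.isCompl)
  have hB' := (hB.baseChange (R := CSym n)).apply_apply (isCompl_baseChange _ B.isCompl)
  -- As `g` is even, conjugation by the parities does not change it, and the supercommutator is the
  -- ordinary commutator.
  have hk : koszul (fun i => cliffLeft A B (b i) - cliffRight εA εB (b i)) (homCoeff g) = 0 := by
    rw [koszul_homCoeff, ← map_zero homCoeff]
    congr 1
    refine LinearMap.ext fun x => ?_
    change behD b Q B (g x) - εB.baseChange (CSym n) (g (εA.baseChange (CSym n) (behD b Q A x))) = 0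
    rw [heven, hB', hclosed, sub_self]
  obtain ⟨G, hG⟩ := homCoeff_bijective.2 (S (homCoeff g))
  have h₁ := hS _ h₀
  rw [hk, map_zero, add_zero, ← hG, koszul_homCoeff] at h₁
  have h₂ := homCoeff_bijective.1 h₁
  have h₃ : ∀ x, behD b Q B (G x) -
      εB.baseChange (CSym n) (G (εA.baseChange (CSym n) (behD b Q A x))) = g x :=
    fun x => LinearMap.congr_fun h₂ x
  -- The contraction yields some primitive `G` of `g` without a definite parity; its odd part is the
  -- homotopy sought.
  refine ⟨(algebraMap ℂ (CSym n) (1 / 2)) •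
    (G - εB.baseChange (CSym n) ∘ₗ G ∘ₗ εA.baseChange (CSym n)), fun x => ?_, ?_⟩
  · change algebraMap ℂ (CSym n) (1 / 2) • (G (εA.baseChange (CSym n) x) - εB.baseChange (CSym n)
      (G (εA.baseChange (CSym n) (εA.baseChange (CSym n) x)))) =
      -εB.baseChange (CSym n) (algebraMap ℂ (CSym n) (1 / 2) •
        (G x - εB.baseChange (CSym n) (G (εA.baseChange (CSym n) x))))
    rw [hA', map_smul, map_sub, hB']
    exact (congrArg _ (neg_sub _ _).symm).trans (smul_neg _ _)
  · refine LinearMap.ext fun x => ?_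
    -- The equation for `G` conjugated by the parities. Its average with the original equation is
    -- the one for the odd part, since the even map `g` is unchanged.
    have h₄ := congrArg (εB.baseChange (CSym n)) (h₃ (εA.baseChange (CSym n) x))
    rw [← heven, hA', behD_parity b hA, map_neg, map_neg, map_neg, hA', sub_neg_eq_add, map_add,
      hB'] at h₄
    have h₅ := behD_parity b hB (G (εA.baseChange (CSym n) x))
    change g x = behD b Q B (algebraMap ℂ (CSym n) (1 / 2) •
      (G x - εB.baseChange (CSym n) (G (εA.baseChange (CSym n) x)))) +
      algebraMap ℂ (CSym n) (1 / 2) • (G (behD b Q A x) -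
        εB.baseChange (CSym n) (G (εA.baseChange (CSym n) (behD b Q A x))))
    rw [map_smul, map_sub, h₅, ← smul_add]
    have h₆ : algebraMap ℂ (CSym n) (1 / 2) + algebraMap ℂ (CSym n) (1 / 2) = 1 := by
      rw [← map_add, add_halves, map_one]
    calc g x = algebraMap ℂ (CSym n) (1 / 2) • (g x + g x) := by
          rw [smul_add, ← add_smul, h₆, one_smul]
      _ = _ := by
          congr 1
          conv_lhs => rw [← h₃ x]; arg 2; rw [h₃ x, ← h₄]
          abel

end FullyFaithful

/-! ### Constant terms of closed morphisms and full faithfulness of `Φ` up to homotopy -/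

section FullyFaithful

variable {V : Type v} [AddCommGroup V] [Module ℂ V] {n : ℕ} {b : Module.Basis (Fin n) ℂ V}
variable {Q : QuadraticForm ℂ V} {A B : ClMod.{u} Q}

/-- The linear map underlying a closed morphism `Φ(A) → Φ(B)`. -/
noncomputable def behHom (g : behObj b Q A ⟶ behObj b Q B) :
    (CSym n ⊗[ℂ] A.carrier) →ₗ[CSym n] (CSym n ⊗[ℂ] B.carrier) := g.1

theorem behHom_comm (g : behObj b Q A ⟶ behObj b Q B) (x : CSym n ⊗[ℂ] A.carrier) :
    behD b Q B (behHom g x) = behHom g (behD b Q A x) :=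
  MF.closed_comm g.2 x

theorem behHom_parity {εA : A.carrier →ₗ[ℂ] A.carrier} {εB : B.carrier →ₗ[ℂ] B.carrier}
    (hA : IsParity A.piece εA) (hB : IsParity B.piece εB) (g : behObj b Q A ⟶ behObj b Q B)
    (x : CSym n ⊗[ℂ] A.carrier) :
    behHom g (εA.baseChange (CSym n) x) = εB.baseChange (CSym n) (behHom g x) :=
  (hA.baseChange (R := CSym n)).comm_of_even (hB.baseChange (R := CSym n))
    (isCompl_baseChange _ A.isCompl) (behHom g).toAddMonoidHom
    (fun i x hx => MF.closed_mem g.2 i x hx) x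

theorem mem_nullHomotopic_of_homCoeff_zero
    (hnd : (QuadraticMap.associated (R := ℂ) Q).Nondegenerate)
    (g : behObj b Q A ⟶ behObj b Q B) (h₀ : homCoeff (behHom g) 0 = 0) :
    g ∈ (MF.nullHomotopic (R := CSym n) (W := quadSeries b Q)).I _ _ := by
  obtain ⟨εA, hA⟩ := exists_isParity A.isCompl
  obtain ⟨εB, hB⟩ := exists_isParity B.isCompl
  obtain ⟨h, hodd, hg⟩ := exists_homotopy_of_homCoeff_zero b hnd hA hB (behHom g)
    (behHom_parity hA hB g) (behHom_comm g) h₀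
  exact ⟨h, (hA.baseChange (R := CSym n)).odd_of_anticomm (hB.baseChange (R := CSym n))
    (isCompl_baseChange _ B.isCompl) h.toAddMonoidHom hodd, hg⟩

theorem homCoeff_behD_comp_zero
    (f : (CSym n ⊗[ℂ] A.carrier) →ₗ[CSym n] (CSym n ⊗[ℂ] B.carrier)) :
    homCoeff (behD b Q B ∘ₗ f) 0 = 0 := by
  rw [homCoeff_behD_comp, Finset.sum_apply]
  exact Finset.sum_eq_zero fun i _ => (mulVar_apply i _ 0).trans (if_pos rfl)

theorem homCoeff_comp_behD_zero
    (f : (CSym n ⊗[ℂ] A.carrier) →ₗ[CSym n] (CSym n ⊗[ℂ] B.carrier)) :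
    homCoeff (f ∘ₗ behD b Q A) 0 = 0 := by
  rw [homCoeff_comp_behD, Finset.sum_apply]
  exact Finset.sum_eq_zero fun i _ => (mulVar_apply i _ 0).trans (if_pos rfl)

/-- Both differentials have entries in the maximal ideal, hence so does `dh + hd`. -/
theorem homCoeff_zero_of_mem_nullHomotopic (g : behObj b Q A ⟶ behObj b Q B)
    (hg : g ∈ (MF.nullHomotopic (R := CSym n) (W := quadSeries b Q)).I _ _) :
    homCoeff (behHom g) 0 = 0 := by
  obtain ⟨h', -, hg⟩ := hg
  let h : (CSym n ⊗[ℂ] A.carrier) →ₗ[CSym n] (CSym n ⊗[ℂ] B.carrier) := h'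
  have h₁ : behHom g = behD b Q B ∘ₗ h + h ∘ₗ behD b Q A := hg
  have h₂ : homCoeff (behHom g) = homCoeff (behD b Q B ∘ₗ h) + homCoeff (h ∘ₗ behD b Q A) :=
    (congrArg homCoeff h₁).trans (map_add homCoeff _ _)
  rw [h₂, Pi.add_apply, homCoeff_behD_comp_zero, homCoeff_comp_behD_zero, add_zero]

theorem homCoeff_behMap (f : A ⟶ B) :
    homCoeff (behMap f : (CSym n ⊗[ℂ] A.carrier) →ₗ[CSym n] _) 0 = f.1.restrictScalars ℂ := by
  rw [behMap, homCoeff_baseChange, if_pos rfl]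

theorem sum_mulVar_single {ι K : Type*} [Fintype ι] [AddCommGroup K] [Module ℂ K]
    (F : ι → (ι →₀ ℕ) → K) (k : ι) : (∑ j, mulVar j (F j)) (Finsupp.single k 1) = F k 0 := by
  rw [Finset.sum_apply, Finset.sum_eq_single k]
  · rw [mulVar_apply, Finsupp.single_eq_same, if_neg one_ne_zero, tsub_self]
  · intro j _ hj
    rw [mulVar_apply, Finsupp.single_eq_of_ne hj, if_pos rfl]
  · exact fun h => absurd (Finset.mem_univ k) h

/-- The constant term of a closed map `Φ(A) → Φ(B)` is linear over the Clifford algebra. -/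
theorem homCoeff_zero_smul (g : behObj b Q A ⟶ behObj b Q B) (s : CliffordAlgebra Q)
    (x : A.carrier) : homCoeff (behHom g) 0 (s • x) = s • homCoeff (behHom g) 0 x := by
  have h : behD b Q B ∘ₗ behHom g = behHom g ∘ₗ behD b Q A := LinearMap.ext (behHom_comm g)
  have hb : ∀ (k : Fin n) (x : A.carrier), homCoeff (behHom g) 0 (cliffSmul A (b k) x) =
      cliffSmul B (b k) (homCoeff (behHom g) 0 x) := by
    intro k x
    -- The coefficient at `xₖ` of `dg = gd` involves only the constant term of `g` and the action of
    -- `bₖ`.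
    have h₁ := congrFun (congrArg homCoeff h) (Finsupp.single k 1)
    rw [homCoeff_behD_comp, homCoeff_comp_behD, sum_mulVar_single, sum_mulVar_single] at h₁
    exact (LinearMap.congr_fun h₁ x).symm
  induction s using CliffordAlgebra.induction generalizing x with
  | algebraMap c => rw [algebraMap_smul, algebraMap_smul, map_smul]
  | ι v =>
    have h₂ : ∀ (C : ClMod.{u} Q) (y : C.carrier), CliffordAlgebra.ι Q v • y =
        ∑ k, b.repr v k • cliffSmul C (b k) y := by
      intro C y
      conv_lhs => rw [← b.sum_repr v, map_sum, Finset.sum_smul]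
      refine Finset.sum_congr rfl fun k _ => ?_
      rw [map_smul, smul_assoc]
      rfl
    rw [h₂, h₂, map_sum]
    refine Finset.sum_congr rfl fun k _ => ?_
    rw [map_smul, hb]
  | mul s t hs ht => rw [mul_smul, hs, ht, mul_smul]
  | add s t hs ht => rw [add_smul, map_add, hs, ht, add_smul]

/-- The constant term of a closed map `Φ(A) → Φ(B)`. -/
noncomputable def constantTerm (g : behObj b Q A ⟶ behObj b Q B) : A ⟶ B :=
  ⟨{ homCoeff (behHom g) 0 with map_smul' := homCoeff_zero_smul g }, by
    obtain ⟨εA, hA⟩ := exists_isParity A.isCompl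
    obtain ⟨εB, hB⟩ := exists_isParity B.isCompl
    refine hA.even_of_comm hB B.isCompl (homCoeff (behHom g) 0).toAddMonoidHom fun x => ?_
    have h : behHom g ∘ₗ εA.baseChange (CSym n) = εB.baseChange (CSym n) ∘ₗ behHom g :=
      LinearMap.ext (behHom_parity hA hB g)
    have h₁ := congrFun (congrArg homCoeff h) 0
    rw [homCoeff_comp_baseChange, homCoeff_baseChange_comp] at h₁
    exact LinearMap.congr_fun h₁ x⟩

variable (b Q)

/-- The Buchweitz–Eisenbud–Herzog functor with values in the homotopy category. -/
noncomputable abbrev behHMF : ClMod.{u} Q ⥤ HMF.{u} (CSym n) (quadSeries b Q) :=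
  beh.{u} b Q ⋙ CategoryTheory.Quotient.functor _

/-- The constant term is a homotopy invariant, and `f` is the constant term of `Φ(f)`. -/
theorem behHMF_faithful : (behHMF.{u} b Q).Faithful where
  map_injective {A B f g} h := by
    have h₁ : (beh b Q).map f - (beh b Q).map g ∈
        (MF.nullHomotopic (R := CSym n) (W := quadSeries b Q)).I _ _ :=
      (CategoryTheory.Quotient.functor_map_eq_iff
        (MF.nullHomotopic (R := CSym n) (W := quadSeries b Q)).rel _ _).1 h
    have h₂ := homCoeff_zero_of_mem_nullHomotopic _ h₁
    have h₃ : homCoeff ((behMap f : (CSym n ⊗[ℂ] A.carrier) →ₗ[CSym n] _) - behMap g) 0 = 0 := h₂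
    rw [homCoeff_sub, Pi.sub_apply, homCoeff_behMap, homCoeff_behMap] at h₃
    exact GrMod.hom_ext fun a => LinearMap.congr_fun (sub_eq_zero.1 h₃) a

variable {Q}

/-- A closed `g` differs from `Φ` of its constant term by a closed map with constant term zero,
which the Koszul contraction makes null-homotopic. -/
theorem behHMF_full (hnd : (QuadraticMap.associated (R := ℂ) Q).Nondegenerate) :
    (behHMF.{u} b Q).Full where
  map_surjective {A B} g := by
    obtain ⟨g, rfl⟩ := (CategoryTheory.Quotient.functor
      (MF.nullHomotopic (R := CSym n) (W := quadSeries b Q)).rel).map_surjective g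
    change behObj b Q A ⟶ behObj b Q B at g
    refine ⟨constantTerm g, CategoryTheory.Quotient.sound _ ?_⟩
    refine mem_nullHomotopic_of_homCoeff_zero hnd _ ?_
    change homCoeff ((behMap (constantTerm g) : (CSym n ⊗[ℂ] A.carrier) →ₗ[CSym n] _) -
      behHom g) 0 = 0
    rw [homCoeff_sub, Pi.sub_apply, homCoeff_behMap, sub_eq_zero]
    rfl

end FullyFaithful

/-! ### Reduction to minimal matrix factorizations -/

section Minimal

variable {R : Type w} [CommRing R] {W : R}

/-- A matrix factorization is minimal if no matrix coefficient of its differential is invertible. -/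
def MF.IsMinimal (M : MF.{u} R W) : Prop :=
  ∀ (l : M.carrier →ₗ[R] R) (m : M.carrier), ¬ IsUnit (l (M.d m))

variable [IsLocalRing R]

/-- A retract of a free module is projective, and finitely generated projectives over a local ring
are free. This applies to kernels of idempotents and to the homogeneous pieces. -/
theorem free_of_retraction {M N : Type*} [AddCommGroup M] [Module R M] [AddCommGroup N] [Module R N]
    [Module.Finite R M] [Module.Free R M] (i : N →ₗ[R] M) (s : M →ₗ[R] N)
    (h : s ∘ₗ i = LinearMap.id) : Module.Free R N ∧ Module.Finite R N := by
  have hN : Module.Finite R N := .of_surjective s fun x => ⟨i x, LinearMap.congr_fun h x⟩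
  have : Module.Projective R N := .of_split i s h
  exact ⟨Module.free_of_flat_of_isLocalRing, hN⟩

namespace MF

variable (M : MF.{u} R W) (e : M.carrier →ₗ[R] M.carrier)
  (hd : ∀ x, e (M.d x) = M.d (e x)) (he : ∀ i, ∀ x ∈ M.piece i, e x ∈ M.piece i)
  (hee : ∀ x, e (e x) = e x)

/-- The direct summand of a matrix factorization cut out by an idempotent endomorphism `e`, as the
kernel of `e`. -/
noncomputable def kernel : MF.{u} R W :=
  let s : M.carrier →ₗ[R] LinearMap.ker e := (LinearMap.id - e).codRestrict _ fun x => by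
    rw [LinearMap.mem_ker, LinearMap.sub_apply, LinearMap.id_apply, map_sub, hee, sub_self]
  have hs : s ∘ₗ (LinearMap.ker e).subtype = LinearMap.id := LinearMap.ext fun x => Subtype.ext (by
    change (x : M.carrier) - e x = x
    rw [LinearMap.mem_ker.1 x.2, sub_zero])
  haveI := (free_of_retraction _ s hs).1
  haveI := (free_of_retraction _ s hs).2
  { carrier := LinearMap.ker e
    piece := fun i => (M.piece i).comap (LinearMap.ker e).subtype
    isCompl := by
      refine ⟨?_, ?_⟩
      · rw [Submodule.disjoint_def]
        intro x h₀ h₁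
        exact Subtype.ext (Submodule.disjoint_def.1 M.isCompl.disjoint x h₀ h₁)
      · rw [codisjoint_iff, eq_top_iff]
        rintro ⟨x, hx⟩ _
        obtain ⟨y, hy, z, hz, rfl⟩ := exists_even_add_odd M.isCompl x
        rw [LinearMap.mem_ker, map_add] at hx
        -- As `e` preserves degrees, `e y = -e z` lies in both pieces; thus the kernel is a graded
        -- submodule.
        have hy' : e y = 0 := Submodule.disjoint_def.1 M.isCompl.disjoint _ (he 0 y hy) (by
          rw [eq_neg_of_add_eq_zero_left hx]
          exact neg_mem (he 1 z hz))
        have hz' : e z = 0 := by rwa [hy', zero_add] at hx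
        exact Submodule.mem_sup.2 ⟨⟨y, hy'⟩, hy, ⟨z, hz'⟩, hz, rfl⟩
    d := M.d.restrict fun x hx => by
      rw [LinearMap.mem_ker, hd, LinearMap.mem_ker.1 hx, map_zero]
    d_mem := fun i x hx => M.d_mem i _ hx
    d_d := fun x => Subtype.ext (M.d_d x) }

/-- The inclusion of the direct summand. -/
noncomputable def kernelInclusion : M.kernel e hd he hee ⟶ M :=
  ⟨(LinearMap.ker e).subtype, closed_of_comm (M := M.kernel e hd he hee) (N := M)
    (fun _ _ h => h) (fun _ => rfl)⟩

/-- The projection to the direct summand. -/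
noncomputable def kernelProjection : M ⟶ M.kernel e hd he hee :=
  ⟨(LinearMap.id - e).codRestrict (LinearMap.ker e) fun x => by
    rw [LinearMap.mem_ker, LinearMap.sub_apply, LinearMap.id_apply, map_sub, hee, sub_self],
    closed_of_comm (M := M) (N := M.kernel e hd he hee)
      (fun i x hx => sub_mem hx (he i x hx)) (fun x => Subtype.ext (by
        change M.d (x - e x) = M.d x - e (M.d x)
        rw [map_sub, hd]))⟩

theorem kernelInclusion_projection :
    M.kernelInclusion e hd he hee ≫ M.kernelProjection e hd he hee = 𝟙 _ :=
  hom_ext fun x => Subtype.ext (by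
    let y : LinearMap.ker e := x
    change y.1 - e y.1 = y.1
    rw [LinearMap.mem_ker.1 y.2, sub_zero])

/-- If the ranks agreed, the projection followed by an isomorphism would be a surjective, hence
injective, endomorphism of `M` killing `m`. -/
theorem finrank_kernel_lt {m : M.carrier} (hm : m ≠ 0) (hem : e m = m) :
    Module.finrank R (M.kernel e hd he hee).carrier < Module.finrank R M.carrier := by
  refine lt_of_le_of_ne (LinearMap.finrank_le_finrank_of_injective
    (f := (M.kernelInclusion e hd he hee).1) Subtype.val_injective) fun h => hm ?_
  let φ := LinearEquiv.ofFinrankEq (R := R) (M.kernel e hd he hee).carrier M.carrier h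
  have hs : Function.Surjective (φ.toLinearMap ∘ₗ (M.kernelProjection e hd he hee).1) :=
    φ.surjective.comp fun x => ⟨(M.kernelInclusion e hd he hee).1 x,
      congrArg (fun f => f.1 x) (M.kernelInclusion_projection e hd he hee)⟩
  refine OrzechProperty.injective_of_surjective_endomorphism _ hs ?_
  rw [map_zero, LinearMap.comp_apply]
  have : (M.kernelProjection e hd he hee).1 m = 0 := Subtype.ext (by
    change m - e m = 0
    rw [hem, sub_self])
  rw [this, map_zero]

variable [Algebra ℂ R]

/-- If the idempotent is null-homotopic, then the direct summand is the whole matrix factorization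
up to homotopy. -/
noncomputable def kernelIso (h : M.carrier →ₗ[R] M.carrier) (hh : h ∈ degHoms 1 M M)
    (heh : e = M.d ∘ₗ h + h ∘ₗ M.d) :
    (CategoryTheory.Quotient.functor (nullHomotopic (R := R) (W := W)).rel).obj M ≅
      (CategoryTheory.Quotient.functor _).obj (M.kernel e hd he hee) where
  hom := (CategoryTheory.Quotient.functor _).map (M.kernelProjection e hd he hee)
  inv := (CategoryTheory.Quotient.functor _).map (M.kernelInclusion e hd he hee)
  hom_inv_id := by
    rw [← Functor.map_comp, ← CategoryTheory.Functor.map_id]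
    -- Inclusion after projection is `1 - e`, which differs from `1` by `-e`, with homotopy `-h`.
    refine CategoryTheory.Quotient.sound _ ⟨-h, neg_mem hh, LinearMap.ext fun x => ?_⟩
    change (x - e x) - x = M.d (-h x) + -h (M.d x)
    rw [sub_sub_cancel_left, heh, map_neg, ← neg_add]
    rfl
  inv_hom_id := by
    rw [← Functor.map_comp, kernelInclusion_projection, CategoryTheory.Functor.map_id]

/-- A matrix factorization which is not minimal is homotopy equivalent to one of smaller rank. -/
theorem exists_smaller (hM : ¬ M.IsMinimal) : ∃ M' : MF.{u} R W,
    Module.finrank R M'.carrier < Module.finrank R M.carrier ∧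
    Nonempty ((CategoryTheory.Quotient.functor (nullHomotopic (R := R) (W := W)).rel).obj M ≅
      (CategoryTheory.Quotient.functor _).obj M') := by
  obtain ⟨ε, hε⟩ := exists_isParity M.isCompl
  have hεd : ∀ x, M.d (ε x) = -ε (M.d x) :=
    hε.anticomm_of_odd hε M.isCompl M.d.toAddMonoidHom M.d_mem
  have hεε := hε.apply_apply M.isCompl
  -- A homogeneous form of non-minimality: `s = -1` for `m` even and `s = 1` for `m` odd, and `l`
  -- vanishes on the piece containing `m`.
  obtain ⟨m, s, l, hs, hm, hl, hlm⟩ : ∃ (m : M.carrier) (s : R) (l : M.carrier →ₗ[R] R),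
      s * s = 1 ∧ ε m = -(s • m) ∧ (∀ y, l (ε y) = s * l y) ∧ l (M.d m) = 1 := by
    simp only [IsMinimal, not_forall, not_not] at hM
    obtain ⟨l, x, hx⟩ := hM
    have key : ∀ (m : M.carrier) (s : R), s * s = 1 → ε m = -(s • m) → IsUnit (l (M.d m)) →
        ∃ (m : M.carrier) (s : R) (l : M.carrier →ₗ[R] R),
          s * s = 1 ∧ ε m = -(s • m) ∧ (∀ y, l (ε y) = s * l y) ∧ l (M.d m) = 1 := by
      rintro m s hs hm ⟨a, ha⟩
      have h2 : algebraMap ℂ R (1 / 2) + algebraMap ℂ R (1 / 2) = 1 := by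
        rw [← map_add, add_halves, map_one]
      -- The factor `1/2` makes this the part of `l` with the parity of `d m`; dividing by the unit
      -- `a = l (d m)` normalizes its value there to `1`.
      refine ⟨m, s, (algebraMap ℂ R (1 / 2) * (a⁻¹ : Rˣ)) • (l + s • (l ∘ₗ ε)), hs, hm,
        fun y => ?_, ?_⟩
      · change _ * (l (ε y) + s * l (ε (ε y))) = s * (_ * (l y + s * l (ε y)))
        rw [hεε]
        linear_combination (-(algebraMap ℂ R (1 / 2) * (a⁻¹ : Rˣ)) * l (ε y)) * hs
      · have hdm : ε (M.d m) = s • M.d m := by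
          have := hεd m
          rw [hm, map_neg, map_smul, neg_inj] at this
          exact this.symm
        change _ * (l (M.d m) + s * l (ε (M.d m))) = 1
        rw [hdm, map_smul, smul_eq_mul, ← ha]
        have h3 : ((a⁻¹ : Rˣ) : R) * a = 1 := a.inv_mul
        linear_combination (algebraMap ℂ R (1 / 2) * (a⁻¹ : Rˣ) * a) * hs +
          (algebraMap ℂ R (1 / 2) + algebraMap ℂ R (1 / 2)) * h3 + h2
    obtain ⟨y, hy, z, hz, rfl⟩ := exists_even_add_odd M.isCompl x
    rw [map_add, map_add] at hx
    -- Locality is used here: one of the two homogeneous components of the vector already gives a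
    -- unit.
    rcases IsLocalRing.isUnit_or_isUnit_of_isUnit_add hx with hx | hx
    · exact key y (-1) (by ring) (by rw [hε.even y hy, neg_smul, one_smul, neg_neg]) hx
    · exact key z 1 (by ring) (by rw [hε.odd z hz, one_smul]) hx
  have hlm0 : l m = 0 := by
    have h := hl m
    rw [hm, map_neg, map_smul, smul_eq_mul] at h
    have h' : s * l m + s * l m = 0 := by linear_combination -h
    have h'' := eq_zero_of_add_self R h'
    linear_combination s * h'' - l m * hs
  -- The rank one map `y ↦ l(y) m` is odd, and `e = dh + hd` fixes `m` and `d m` and has values in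
  -- their span. So `e` is a null-homotopic idempotent onto a contractible summand.
  let h : M.carrier →ₗ[R] M.carrier := l.smulRight m
  let e : M.carrier →ₗ[R] M.carrier := M.d ∘ₗ h + h ∘ₗ M.d
  have hh' : ∀ y, h y = l y • m := fun _ => rfl
  have he' : ∀ y, e y = l y • M.d m + l (M.d y) • m := fun y => by
    change M.d (h y) + h (M.d y) = _
    rw [hh', hh', map_smul]
  have hh : h ∈ degHoms 1 M M :=
    hε.odd_of_anticomm hε M.isCompl h.toAddMonoidHom fun y => by
      change h (ε y) = -ε (h y)
      rw [hh', hh', hl, map_smul, hm, smul_neg, neg_neg, smul_smul, mul_comm]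
  have hem : e m = m := by rw [he', hlm0, hlm, zero_smul, zero_add, one_smul]
  have hedm : e (M.d m) = M.d m := by
    rw [he', M.d_d, map_smul, hlm0, hlm, smul_zero, zero_smul, add_zero, one_smul]
  have hd : ∀ x, e (M.d x) = M.d (e x) := fun x => by
    rw [he', he', map_add, map_smul, map_smul, M.d_d, M.d_d, map_smul, smul_eq_mul, smul_smul,
      add_comm, mul_comm]
  have he : ∀ i, ∀ x ∈ M.piece i, e x ∈ M.piece i :=
    hε.even_of_comm hε M.isCompl e.toAddMonoidHom fun y => by
      change M.d (h (ε y)) + h (M.d (ε y)) = ε (M.d (h y) + h (M.d y))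
      have hhε : ∀ y, h (ε y) = -ε (h y) := hε.anticomm_of_odd hε M.isCompl h.toAddMonoidHom hh
      rw [hhε, hεd, map_neg, map_neg, hhε, hεd, neg_neg, neg_neg, map_add]
  have hee : ∀ x, e (e x) = e x := fun x => by
    conv_lhs => rw [he' x]
    rw [map_add, map_smul, map_smul, hem, hedm, he']
  have hm0 : m ≠ 0 := by
    rintro rfl
    rw [map_zero, map_zero] at hlm
    exact zero_ne_one hlm
  exact ⟨M.kernel e hd he hee, M.finrank_kernel_lt e hd he hee hm0 hem,
    ⟨M.kernelIso e hd he hee h hh rfl⟩⟩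

/-- Every matrix factorization over a local ring is homotopy equivalent to a minimal one. -/
theorem exists_minimal : ∃ M' : MF.{u} R W, M'.IsMinimal ∧
    Nonempty ((CategoryTheory.Quotient.functor (nullHomotopic (R := R) (W := W)).rel).obj M ≅
      (CategoryTheory.Quotient.functor _).obj M') := by
  induction h : Module.finrank R M.carrier using Nat.strong_induction_on generalizing M with
  | _ k ih =>
    by_cases hM : M.IsMinimal
    · exact ⟨M, hM, ⟨Iso.refl _⟩⟩
    · obtain ⟨M₁, h₁, ⟨e₁⟩⟩ := M.exists_smaller hM
      obtain ⟨M₂, h₂, ⟨e₂⟩⟩ := ih _ (h ▸ h₁) M₁ rfl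
      exact ⟨M₂, h₂, ⟨e₁ ≪≫ e₂⟩⟩

end MF

end Minimal

/-! ### Minimal matrix factorizations of a quadratic form -/

section CliffordRelations

variable {ι K : Type*} [Fintype ι] [AddCommGroup K] [Module ℂ K]

theorem partialDeriv_sum_mulVar (F : ι → (ι →₀ ℕ) → K) (i : ι) :
    partialDeriv i (∑ k, mulVar k (F k)) = F i + ∑ k, mulVar k (partialDeriv i (F k)) := by
  classical
  have h : ∀ k, partialDeriv i (mulVar k (F k)) =
      (if k = i then F i else 0) + mulVar k (partialDeriv i (F k)) := by
    intro k
    split_ifs with hk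
    · subst hk
      rw [partialDeriv_mulVar_self, add_comm]
    · rw [partialDeriv_mulVar_of_ne (Ne.symm hk), zero_add]
  rw [map_sum, Finset.sum_congr rfl fun k _ => h k, Finset.sum_add_distrib,
    Finset.sum_ite_eq' Finset.univ i, if_pos (Finset.mem_univ i)]

/-- The quadratic coefficients of a quadratic form with coefficients in `K`. -/
theorem quadratic_coeff (u : ι → ι → (ι →₀ ℕ) → K) (i j : ι) :
    ((Finsupp.single j 1 i : ℕ) + 1 : ℂ) • (∑ k, mulVar k (∑ l, mulVar l (u k l)))
      (Finsupp.single j 1 + Finsupp.single i 1) = u i j 0 + u j i 0 := by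
  -- The coefficient at `xⱼ` of `∂ᵢ`. Differentiation produces the factor, equal to `2` for `i = j`
  -- and `1` otherwise, which lets both cases be treated together.
  have h := congrFun (partialDeriv_sum_mulVar (fun k => ∑ l, mulVar l (u k l)) i)
    (Finsupp.single j 1)
  rw [partialDeriv_apply, Pi.add_apply, sum_mulVar_single, sum_mulVar_single,
    partialDeriv_apply] at h
  rw [h, zero_add, sum_mulVar_single, Finsupp.coe_zero, Pi.zero_apply, Nat.cast_zero, zero_add,
    one_smul]

variable {n : ℕ} {A : Type*} [AddCommGroup A] [Module ℂ A]

/-- The linear part of an endomorphism. -/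
noncomputable def linearPart (γ : Fin n → (A →ₗ[ℂ] A)) :
    (CSym n ⊗[ℂ] A) →ₗ[CSym n] (CSym n ⊗[ℂ] A) :=
  ∑ k, (MvPowerSeries.X k : CSym n) • (γ k).baseChange (CSym n)

theorem homCoeff_linearPart (γ : Fin n → (A →ₗ[ℂ] A)) : homCoeff (linearPart γ) =
    ∑ k, mulVar k (homCoeff ((γ k).baseChange (CSym n))) := by
  rw [linearPart, map_sum]
  exact Finset.sum_congr rfl fun k _ => homCoeff_X_smul _ _

theorem homCoeff_linearPart_zero (γ : Fin n → (A →ₗ[ℂ] A)) : homCoeff (linearPart γ) 0 = 0 := by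
  rw [homCoeff_linearPart, Finset.sum_apply]
  exact Finset.sum_eq_zero fun i _ => (mulVar_apply i _ 0).trans (if_pos rfl)

theorem homCoeff_linearPart_single (γ : Fin n → (A →ₗ[ℂ] A)) (k : Fin n) :
    homCoeff (linearPart γ) (Finsupp.single k 1) = γ k := by
  rw [homCoeff_linearPart, sum_mulVar_single, homCoeff_baseChange, if_pos rfl]

theorem exists_single_of_degree_eq_one {m : Fin n →₀ ℕ} (hm : m.degree = 1) :
    ∃ k, m = Finsupp.single k 1 := by
  have h0 : m ≠ 0 := by
    rintro rfl
    rw [map_zero] at hm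
    exact zero_ne_one hm
  obtain ⟨k, hk⟩ := Finsupp.ne_iff.1 h0
  rw [Finsupp.coe_zero, Pi.zero_apply] at hk
  have hle : Finsupp.single k 1 ≤ m := by
    rw [Finsupp.single_le_iff]
    omega
  refine ⟨k, ?_⟩
  have h1 : (m - Finsupp.single k 1).degree + (Finsupp.single k 1).degree = m.degree := by
    rw [← map_add, tsub_add_cancel_of_le hle]
  rw [Finsupp.degree_single, hm] at h1
  have h2 : m - Finsupp.single k 1 = 0 := (Finsupp.degree_eq_zero_iff _).1 (by omega)
  rw [← tsub_add_cancel_of_le hle, h2, zero_add]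

theorem homCoeff_eq_linearPart {D : (CSym n ⊗[ℂ] A) →ₗ[CSym n] (CSym n ⊗[ℂ] A)}
    {γ : Fin n → (A →ₗ[ℂ] A)} (h₀ : homCoeff D 0 = 0)
    (h₁ : ∀ k, homCoeff D (Finsupp.single k 1) = γ k) {m : Fin n →₀ ℕ} (hm : m.degree < 2) :
    homCoeff D m = homCoeff (linearPart γ) m := by
  by_cases h : m.degree = 0
  · rw [(Finsupp.degree_eq_zero_iff m).1 h, h₀, homCoeff_linearPart_zero]
  · obtain ⟨k, rfl⟩ := exists_single_of_degree_eq_one (m := m) (by omega)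
    rw [h₁, homCoeff_linearPart_single]

/-- Without constant terms, degree two arises only as one plus one. -/
theorem homCoeff_comp_self_eq_linearPart {D : (CSym n ⊗[ℂ] A) →ₗ[CSym n] (CSym n ⊗[ℂ] A)}
    {γ : Fin n → (A →ₗ[ℂ] A)} (h₀ : homCoeff D 0 = 0)
    (h₁ : ∀ k, homCoeff D (Finsupp.single k 1) = γ k) {m : Fin n →₀ ℕ} (hm : m.degree = 2) :
    homCoeff (D ∘ₗ D) m = homCoeff (linearPart γ ∘ₗ linearPart γ) m := by
  rw [homCoeff_comp, homCoeff_comp]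
  refine Finset.sum_congr rfl fun p hp => ?_
  rw [Finset.HasAntidiagonal.mem_antidiagonal] at hp
  have hd : p.1.degree + p.2.degree = 2 := by rw [← map_add, hp, hm]
  have hz : ∀ q : Fin n →₀ ℕ, q.degree = 0 → homCoeff D q = 0 ∧ homCoeff (linearPart γ) q = 0 := by
    intro q hq
    rw [(Finsupp.degree_eq_zero_iff q).1 hq]
    exact ⟨h₀, homCoeff_linearPart_zero γ⟩
  by_cases hp₁ : p.1.degree = 0
  · rw [(hz _ hp₁).1, (hz _ hp₁).2, LinearMap.zero_comp, LinearMap.zero_comp]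
  · by_cases hp₂ : p.2.degree = 0
    · rw [(hz _ hp₂).1, (hz _ hp₂).2, LinearMap.comp_zero, LinearMap.comp_zero]
    · rw [homCoeff_eq_linearPart h₀ h₁ (by omega), homCoeff_eq_linearPart h₀ h₁ (by omega)]

theorem homCoeff_sum_sum (u : Fin n → Fin n → (A →ₗ[ℂ] A)) :
    homCoeff (∑ k, ∑ l, (MvPowerSeries.X k : CSym n) • (MvPowerSeries.X l : CSym n) •
      (u k l).baseChange (CSym n)) =
      ∑ k, mulVar k (∑ l, mulVar l (homCoeff ((u k l).baseChange (CSym n)))) := by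
  rw [map_sum]
  refine Finset.sum_congr rfl fun k _ => ?_
  rw [map_sum, map_sum]
  refine Finset.sum_congr rfl fun l _ => ?_
  rw [homCoeff_X_smul, homCoeff_X_smul]

theorem linearPart_comp_linearPart (γ : Fin n → (A →ₗ[ℂ] A)) :
    linearPart γ ∘ₗ linearPart γ = ∑ k, ∑ l, (MvPowerSeries.X k : CSym n) •
      (MvPowerSeries.X l : CSym n) • (γ k ∘ₗ γ l).baseChange (CSym n) := by
  refine LinearMap.ext fun x => ?_
  rw [LinearMap.comp_apply, LinearMap.sum_apply]
  conv_lhs => rw [linearPart, LinearMap.sum_apply]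
  refine Finset.sum_congr rfl fun k _ => ?_
  rw [LinearMap.sum_apply, LinearMap.smul_apply, LinearMap.sum_apply, map_sum, Finset.smul_sum]
  refine Finset.sum_congr rfl fun l _ => ?_
  rw [LinearMap.smul_apply, map_smul, LinearMap.baseChange_comp]
  rfl

variable {V : Type v} [AddCommGroup V] [Module ℂ V] (b : Module.Basis (Fin n) ℂ V)
  (Q : QuadraticForm ℂ V)

/-- The linear part of a matrix factorization of a quadratic form without constant term satisfies
the Clifford relations. -/
theorem clifford_relations {D : (CSym n ⊗[ℂ] A) →ₗ[CSym n] (CSym n ⊗[ℂ] A)}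
    {γ : Fin n → (A →ₗ[ℂ] A)} (h₀ : homCoeff D 0 = 0)
    (h₁ : ∀ k, homCoeff D (Finsupp.single k 1) = γ k)
    (hD : ∀ x, D (D x) = quadSeries b Q • x) (i j : Fin n) :
    γ i ∘ₗ γ j + γ j ∘ₗ γ i =
      (2 * QuadraticMap.associated (R := ℂ) Q (b i) (b j)) • LinearMap.id := by
  have hW : D ∘ₗ D = ∑ k, ∑ l, (MvPowerSeries.X k : CSym n) • (MvPowerSeries.X l : CSym n) •
      (QuadraticMap.associated (R := ℂ) Q (b k) (b l) •
        (LinearMap.id : A →ₗ[ℂ] A)).baseChange (CSym n) := by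
    refine LinearMap.ext fun x => ?_
    rw [LinearMap.comp_apply, hD, quadSeries, LinearMap.sum_apply, Finset.sum_smul]
    refine Finset.sum_congr rfl fun k _ => ?_
    rw [LinearMap.sum_apply, Finset.sum_smul]
    refine Finset.sum_congr rfl fun l _ => ?_
    rw [LinearMap.smul_apply, LinearMap.smul_apply, LinearMap.baseChange_smul,
      LinearMap.baseChange_id, smul_smul, LinearMap.smul_apply, LinearMap.id_apply, smul_assoc,
      smul_comm]
  have hm : (Finsupp.single j 1 + Finsupp.single i 1 : Fin n →₀ ℕ).degree = 2 := by
    rw [map_add, Finsupp.degree_single, Finsupp.degree_single]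
  have h := homCoeff_comp_self_eq_linearPart h₀ h₁ hm
  rw [hW, linearPart_comp_linearPart, homCoeff_sum_sum, homCoeff_sum_sum] at h
  -- After this scaling `quadratic_coeff` symmetrizes both sides in `i` and `j`, which gives the
  -- anticommutator of the linear coefficients and twice the bilinear form.
  have h' := congrArg (fun z => ((Finsupp.single j 1 i : ℕ) + 1 : ℂ) • z) h
  simp only [quadratic_coeff, homCoeff_baseChange, if_pos] at h'
  have hs : QuadraticMap.associated (R := ℂ) Q (b j) (b i) =
    QuadraticMap.associated (R := ℂ) Q (b i) (b j) := QuadraticMap.associated_isSymm ℂ Q _ _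
  rw [← h', hs, two_mul, add_smul]

end CliffordRelations

/-! ### Graded Clifford modules from operators satisfying the Clifford relations -/

section CliffordModule

variable {V : Type v} [AddCommGroup V] [Module ℂ V] {n : ℕ} (b : Module.Basis (Fin n) ℂ V)
  (Q : QuadraticForm ℂ V) {A : Type u} [AddCommGroup A] [Module ℂ A]

/-- A linear map from `V` given by operators subject to the Clifford relations on basis vectors
satisfies the Clifford relation. -/
theorem constr_mul_self (γ : Fin n → Module.End ℂ A)
    (hγ : ∀ i j, γ i * γ j + γ j * γ i =
      (2 * QuadraticMap.associated (R := ℂ) Q (b i) (b j)) • 1) (v : V) :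
    b.constr ℂ γ v * b.constr ℂ γ v = algebraMap ℂ (Module.End ℂ A) (Q v) := by
  let T : V →ₗ[ℂ] Module.End ℂ A := b.constr ℂ γ
  let f : V →ₗ[ℂ] V →ₗ[ℂ] Module.End ℂ A := (LinearMap.mul ℂ (Module.End ℂ A)).compl₁₂ T T
  let g : V →ₗ[ℂ] V →ₗ[ℂ] Module.End ℂ A :=
    ((2 : ℂ) • QuadraticMap.associated (R := ℂ) Q).compr₂ (LinearMap.toSpanSingleton ℂ _ 1)
  -- The relation is bilinear in its polarized form, so it may be checked on basis vectors; the
  -- diagonal then gives twice the claim.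
  have h : f + f.flip = g := b.ext fun i => b.ext fun j => by
    change T (b i) * T (b j) + T (b j) * T (b i) =
      (2 * QuadraticMap.associated (R := ℂ) Q (b i) (b j)) • 1
    rw [← hγ, b.constr_basis, b.constr_basis]
  have h' : T v * T v + T v * T v = (2 * QuadraticMap.associated (R := ℂ) Q v v) • 1 :=
    LinearMap.congr_fun (LinearMap.congr_fun h v) v
  rw [QuadraticMap.associated_eq_self_apply, ← two_smul ℂ, mul_smul] at h'
  rw [Algebra.algebraMap_eq_smul_one]
  exact smul_right_injective _ (two_ne_zero' ℂ) h'

/-- The universal property of the Clifford algebra supplies the action, and even and odd induction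
supplies its compatibility with the grading. The module is `A` itself; the equivalence `e` is the
identity. -/
theorem exists_clMod [FiniteDimensional ℂ A] {P : ZMod 2 → Submodule ℂ A}
    (hP : IsCompl (P 0) (P 1)) (γ : Fin n → (A →ₗ[ℂ] A))
    (hodd : ∀ k i, ∀ x ∈ P i, γ k x ∈ P (i + 1))
    (hγ : ∀ i j, γ i ∘ₗ γ j + γ j ∘ₗ γ i =
      (2 * QuadraticMap.associated (R := ℂ) Q (b i) (b j)) • LinearMap.id) :
    ∃ (C : ClMod.{u} Q) (e : C.carrier ≃ₗ[ℂ] A), (∀ i, ∀ x ∈ C.piece i, e x ∈ P i) ∧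
      ∀ k x, e (cliffSmul C (b k) x) = γ k (e x) := by
  let T : V →ₗ[ℂ] Module.End ℂ A := b.constr ℂ γ
  let Ψ : CliffordAlgebra Q →ₐ[ℂ] Module.End ℂ A :=
    CliffordAlgebra.lift Q ⟨T, constr_mul_self b Q γ hγ⟩
  have hι : ∀ v, Ψ (CliffordAlgebra.ι Q v) = T v := fun v => CliffordAlgebra.lift_ι_apply _ _ _
  let _ : Module (CliffordAlgebra Q) A := Module.compHom A Ψ.toRingHom
  have hsmul : ∀ (s : CliffordAlgebra Q) (x : A), s • x = Ψ s x := fun _ _ => rfl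
  have : IsScalarTower ℂ (CliffordAlgebra Q) A := ⟨fun c s x => by
    rw [hsmul, hsmul, map_smul, LinearMap.smul_apply]⟩
  have : Module.Finite (CliffordAlgebra Q) A :=
    Module.Finite.of_restrictScalars_finite ℂ (CliffordAlgebra Q) A
  have hT : ∀ v i, ∀ x ∈ P i, T v x ∈ P (i + 1) := by
    intro v i x hx
    change b.constr ℂ γ v x ∈ _
    rw [b.constr_apply_fintype (S := ℂ), LinearMap.sum_apply]
    exact sum_mem fun k _ => (P (i + 1)).smul_mem _ (hodd k i x hx)
  have h2 : ∀ i : ZMod 2, i + 1 + 1 = i := by decide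
  have key : ∀ (m₁ m₂ : V) (i j : ZMod 2) (s : CliffordAlgebra Q),
      (∀ x ∈ P j, s • x ∈ P (i + j)) → ∀ x ∈ P j,
        (CliffordAlgebra.ι Q m₁ * CliffordAlgebra.ι Q m₂ * s) • x ∈ P (i + j) := by
    intro m₁ m₂ i j s hs x hx
    rw [mul_smul, mul_smul, hsmul _ (_ • _ • _), hι, hsmul _ (_ • _), hι]
    have h := hT m₁ _ _ (hT m₂ _ _ (hs x hx))
    rwa [h2] at h
  have hmem : ∀ (i j : ZMod 2) (s : CliffordAlgebra Q), s ∈ CliffordAlgebra.evenOdd Q i →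
      ∀ x ∈ P j, s • x ∈ P (i + j) := by
    intro i j s hs
    revert i
    refine forall_zmod_two (fun hs => ?_) (fun hs => ?_)
    · induction s, hs using CliffordAlgebra.even_induction with
      | algebraMap c =>
        intro x hx
        rw [algebraMap_smul, zero_add]
        exact (P j).smul_mem c hx
      | add s t _ _ hs ht =>
        intro x hx
        rw [add_smul]
        exact add_mem (hs x hx) (ht x hx)
      | ι_mul_ι_mul m₁ m₂ s _ hs => exact key m₁ m₂ 0 j s hs
    · induction s, hs using CliffordAlgebra.odd_induction with
      | ι v =>
        intro x hx
        rw [hsmul, hι, add_comm]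
        exact hT v j x hx
      | add s t _ _ hs ht =>
        intro x hx
        rw [add_smul]
        exact add_mem (hs x hx) (ht x hx)
      | ι_mul_ι_mul m₁ m₂ s _ hs => exact key m₁ m₂ 1 j s hs
  have hmem' : ∀ (i j : ZMod 2) (s : CliffordAlgebra Q) (x : A), s ∈ CliffordAlgebra.evenOdd Q i →
      x ∈ P j → s • x ∈ P (i + j) := fun i j s x hs hx => hmem i j s hs x hx
  refine ⟨{ carrier := A, piece := P, isCompl := hP, smul_mem := hmem' }, LinearEquiv.refl ℂ A,
    fun _ _ h => h, fun k x => ?_⟩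
  have h := LinearMap.congr_fun ((hι (b k)).trans (b.constr_basis ℂ γ k)) x
  exact h

end CliffordModule

/-! ### Graded trivializations and the constant term of a minimal differential -/

section GradedFree

variable {n : ℕ} {W : CSym n}

theorem isCompl_pieces {ι₀ ι₁ A : Type*} [AddCommGroup A] [Module ℂ A]
    (c : Module.Basis (ι₀ ⊕ ι₁) ℂ A) :
    IsCompl (Submodule.span ℂ (Set.range fun i => c (Sum.inl i)))
      (Submodule.span ℂ (Set.range fun i => c (Sum.inr i))) := by
  have h := c.linearIndependent.isCompl_span_image c.span_eq Set.isCompl_range_inl_range_inr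
  rwa [← Set.range_comp, ← Set.range_comp] at h

/-- A matrix factorization over power series is, as a graded module, extended from a graded complex
vector space. -/
theorem MF.exists_graded_basis (M : MF.{u} (CSym n) W) :
    ∃ (A : Type u) (_ : AddCommGroup A) (_ : Module ℂ A) (_ : FiniteDimensional ℂ A)
      (P : ZMod 2 → Submodule ℂ A) (_ : IsCompl (P 0) (P 1))
      (e : (CSym n ⊗[ℂ] A) ≃ₗ[CSym n] M.carrier),
      ∀ i, ∀ x ∈ (P i).baseChange (CSym n), e x ∈ M.piece i := by
  -- Each homogeneous piece is a retract of the free module `M`, hence free; a homogeneous basis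
  -- results from bases of the two pieces.
  have h₀ := free_of_retraction _ _
    (Submodule.projectionOnto_comp_subtype M.isCompl)
  have h₁ := free_of_retraction _ _
    (Submodule.projectionOnto_comp_subtype M.isCompl.symm)
  have := h₀.1
  have := h₀.2
  have := h₁.1
  have := h₁.2
  let β₀ := Module.Free.chooseBasis (CSym n) (M.piece 0)
  let β₁ := Module.Free.chooseBasis (CSym n) (M.piece 1)
  let β := (β₀.prod β₁).map (Submodule.prodEquivOfIsCompl _ _ M.isCompl)
  let c := Pi.basisFun ℂ (Module.Free.ChooseBasisIndex (CSym n) (M.piece 0) ⊕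
    Module.Free.ChooseBasisIndex (CSym n) (M.piece 1))
  let e := (c.baseChange (CSym n)).equiv β (Equiv.refl _)
  have he : ∀ i, e (1 ⊗ₜ c i) = β i := fun i => by
    rw [← Module.Basis.baseChange_apply]
    exact Module.Basis.equiv_apply _ _ _ _
  refine ⟨_, _, _, inferInstance, fun i => if i = 0 then _ else _, isCompl_pieces c, e,
    forall_zmod_two ?_ ?_⟩
  · change Submodule.baseChange _ (Submodule.span ℂ _) ≤ (M.piece 0).comap e.toLinearMap
    rw [Submodule.baseChange_span, Submodule.span_le]
    rintro _ ⟨_, ⟨i, rfl⟩, rfl⟩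
    change e (1 ⊗ₜ c _) ∈ M.piece 0
    rw [he, Module.Basis.map_apply, Submodule.coe_prodEquivOfIsCompl',
      Module.Basis.prod_apply_inl_snd, Submodule.coe_zero, add_zero]
    exact Subtype.mem _
  · change Submodule.baseChange _ (Submodule.span ℂ _) ≤ (M.piece 1).comap e.toLinearMap
    rw [Submodule.baseChange_span, Submodule.span_le]
    rintro _ ⟨_, ⟨i, rfl⟩, rfl⟩
    change e (1 ⊗ₜ c _) ∈ M.piece 1
    rw [he, Module.Basis.map_apply, Submodule.coe_prodEquivOfIsCompl',
      Module.Basis.prod_apply_inr_fst, Submodule.coe_zero, zero_add]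
    exact Subtype.mem _

/-- A degree-preserving bijection intertwines the parity operators, and therefore so does its
inverse. -/
theorem symm_mem_piece {R : Type*} [CommRing R] [Algebra ℂ R] {M N : Type*} [AddCommGroup M]
    [Module R M] [AddCommGroup N] [Module R N] {P : ZMod 2 → Submodule R M}
    {P' : ZMod 2 → Submodule R N} (hP : IsCompl (P 0) (P 1)) (hP' : IsCompl (P' 0) (P' 1))
    (e : M ≃ₗ[R] N) (he : ∀ i, ∀ x ∈ P i, e x ∈ P' i) : ∀ i, ∀ y ∈ P' i, e.symm y ∈ P i := by
  obtain ⟨ε, hε⟩ := exists_isParity hP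
  obtain ⟨ε', hε'⟩ := exists_isParity hP'
  refine hε'.even_of_comm hε hP e.symm.toLinearMap.toAddMonoidHom fun y => e.injective ?_
  have h : e (ε (e.symm y)) = ε' (e (e.symm y)) :=
    hε.comm_of_even hε' hP e.toLinearMap.toAddMonoidHom he _
  rw [e.apply_symm_apply] at h
  exact (e.apply_symm_apply _).trans h.symm

/-- A power series with nonzero constant term is a unit. A functional on `A` detecting a nonzero
constant term would extend to one on `M` taking a unit value on the image of `d`. -/
theorem MF.IsMinimal.homCoeff_zero {M : MF.{u} (CSym n) W} (hM : M.IsMinimal) {A : Type*}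
    [AddCommGroup A] [Module ℂ A] (e : (CSym n ⊗[ℂ] A) ≃ₗ[CSym n] M.carrier) :
    homCoeff (e.symm.toLinearMap ∘ₗ M.d ∘ₗ e.toLinearMap) 0 = 0 := by
  refine LinearMap.ext fun a => (Module.forall_dual_apply_eq_zero_iff ℂ _).1 fun l => ?_
  by_contra h
  let l' : (CSym n ⊗[ℂ] A) →ₗ[CSym n] CSym n :=
    LinearMap.liftBaseChange (CSym n) (Algebra.linearMap ℂ (CSym n) ∘ₗ l)
  have hl' : ∀ y, MvPowerSeries.constantCoeff (l' y) = l (tensorCoeff y 0) := by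
    intro y
    induction y using TensorProduct.induction_on with
    | zero => rw [map_zero, map_zero, map_zero, Pi.zero_apply, map_zero]
    | add x y hx hy => rw [map_add, map_add, map_add, Pi.add_apply, map_add, hx, hy]
    | tmul r a =>
      rw [LinearMap.liftBaseChange_tmul, tensorCoeff_tmul, smul_eq_mul, map_mul, map_smul,
        smul_eq_mul]
      congr 1
  refine hM (l' ∘ₗ e.symm.toLinearMap) (e (1 ⊗ₜ a)) (MvPowerSeries.isUnit_iff_constantCoeff.2 ?_)
  rw [LinearMap.comp_apply, hl']
  exact isUnit_iff_ne_zero.2 h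

end GradedFree

/-! ### Removing the higher order terms of a minimal factorization -/

section Deformation

variable {V : Type v} [AddCommGroup V] [Module ℂ V] {n : ℕ} (b : Module.Basis (Fin n) ℂ V)
  {Q : QuadraticForm ℂ V}

/-- A matrix factorization of a nondegenerate quadratic form is determined by its linear part. -/
theorem exists_conjugation (hnd : (QuadraticMap.associated (R := ℂ) Q).Nondegenerate)
    {A : ClMod.{u} Q} {ε : A.carrier →ₗ[ℂ] A.carrier} (hε : IsParity A.piece ε)
    (D : (CSym n ⊗[ℂ] A.carrier) →ₗ[CSym n] (CSym n ⊗[ℂ] A.carrier))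
    (hodd : ∀ x, D (ε.baseChange (CSym n) x) = -ε.baseChange (CSym n) (D x))
    (hD : ∀ x, D (D x) = quadSeries b Q • x) (h₀ : homCoeff D 0 = 0)
    (h₁ : ∀ k, homCoeff D (Finsupp.single k 1) = cliffSmul A (b k)) :
    ∃ f : (CSym n ⊗[ℂ] A.carrier) →ₗ[CSym n] (CSym n ⊗[ℂ] A.carrier),
      (∀ x, f (ε.baseChange (CSym n) x) = ε.baseChange (CSym n) (f x)) ∧
      (∀ x, D (f x) = f (behD b Q A x)) ∧ homCoeff f 0 = LinearMap.id := by
  have := ClMod.finiteDimensional b A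
  obtain ⟨w, hw⟩ := exists_dual_vectors b hnd
  have hcar := isCAR_clifford (⇑b) w hw hε hε
  set L := behD b Q A with hL
  set η := ε.baseChange (CSym n) with hη
  have hηη : ∀ x, η (η x) = x :=
    (hε.baseChange (R := CSym n)).apply_apply (isCompl_baseChange _ A.isCompl)
  have hLη : ∀ x, L (η x) = -η (L x) := behD_parity b hε
  have hLL : ∀ x, L (L x) = quadSeries b Q • x := behD_behD b Q A
  let Θ := LinearEquiv.ofBijective _ (homCoeff_bijective (n := n) (A := A.carrier) (B := A.carrier))
  -- The differential on maps from the factorization with `L` to the one with `D`. It squares to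
  -- zero since `D² = L²` is a scalar, and its even cocycles are the maps intertwining `L` and `D`.
  let Δ : ((CSym n ⊗[ℂ] A.carrier) →ₗ[CSym n] (CSym n ⊗[ℂ] A.carrier)) →
      ((CSym n ⊗[ℂ] A.carrier) →ₗ[CSym n] (CSym n ⊗[ℂ] A.carrier)) :=
    fun f => D ∘ₗ f - (η ∘ₗ f ∘ₗ η) ∘ₗ L
  have hΔ : ∀ f x, Δ f x = D (f x) - η (f (η (L x))) := fun _ _ => rfl
  have hΔΔ : ∀ f, Δ (Δ f) = 0 := fun f => LinearMap.ext fun x => by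
    rw [hΔ, hΔ, hΔ, map_sub, map_sub, hD, hLη, hLL, hηη]
    have h := hodd (f (η (L x)))
    rw [eq_neg_iff_add_eq_zero] at h
    simp only [map_neg, hηη, map_smul]
    rw [LinearMap.zero_apply, ← neg_zero, ← h]
    abel
  -- Composition with `D - L`. As `L` is the linear part of `D`, this raises degrees by at least
  -- two, and `Δ` is the Koszul differential plus this perturbation.
  let Eop : ((Fin n →₀ ℕ) → (A.carrier →ₗ[ℂ] A.carrier)) →ₗ[ℂ]
      ((Fin n →₀ ℕ) → (A.carrier →ₗ[ℂ] A.carrier)) :=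
    { toFun := fun F => homCoeff ((D - L) ∘ₗ Θ.symm F)
      map_add' := fun F G => by rw [map_add, LinearMap.comp_add, map_add]
      map_smul' := fun c F => by
        have h : (D - L) ∘ₗ (c • Θ.symm F) = c • ((D - L) ∘ₗ Θ.symm F) :=
          LinearMap.ext fun x => ((D - L).restrictScalars ℂ).map_smul c (Θ.symm F x)
        rw [map_smul, RingHom.id_apply, h, map_smul] }
  have hE : ∀ f, koszul (fun i => cliffLeft A A (b i) - cliffRight ε ε (b i)) (homCoeff f) +
      Eop (homCoeff f) = homCoeff (Δ f) := by
    intro f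
    have h : Θ.symm (homCoeff f) = f := Θ.symm_apply_apply f
    change _ + homCoeff ((D - L) ∘ₗ Θ.symm (homCoeff f)) = _
    rw [h, koszul_homCoeff, ← map_add]
    congr 1
    refine LinearMap.ext fun x => ?_
    change (L (f x) - η (f (η (L x)))) + (D (f x) - L (f x)) = D (f x) - η (f (η (L x)))
    abel
  have hDL : ∀ m : Fin n →₀ ℕ, m.degree < 2 → homCoeff (D - L) m = 0 := by
    intro m hm
    rw [homCoeff_sub, Pi.sub_apply, homCoeff_eq_linearPart h₀ h₁ hm]
    exact sub_self _
  obtain ⟨φ, hφ, hφ₀⟩ := exists_perturbed_cocycle hcar Eop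
    (fun F m hF => homCoeff_comp_eq_zero 2 _ hDL _ m fun m' hm' =>
      (congrFun (Θ.apply_symm_apply F) m').trans (hF m' hm'))
    (fun F => by
      obtain ⟨f, rfl⟩ := Θ.surjective F
      change koszul _ (koszul _ (homCoeff f) + Eop (homCoeff f)) +
        Eop (koszul _ (homCoeff f) + Eop (homCoeff f)) = 0
      rw [hE, hE, hΔΔ, map_zero])
    -- The identity commutes with `L`, so it is a cocycle of the unperturbed complex from which to
    -- start.
    (homCoeff LinearMap.id) (by
      rw [koszul_homCoeff, ← map_zero homCoeff]
      congr 1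
      refine LinearMap.ext fun x => ?_
      change L x - η (η (L x)) = 0
      rw [hηη, sub_self])
  obtain ⟨f, rfl⟩ := Θ.surjective φ
  have hf : ∀ x, D (f x) = η (f (η (L x))) := by
    have h : homCoeff (Δ f) = 0 := (hE f).symm.trans hφ
    have h' : Δ f = 0 := homCoeff_bijective.1 (h.trans (map_zero _).symm)
    exact fun x => sub_eq_zero.1 (LinearMap.congr_fun h' x)
  have hf₀ : homCoeff f 0 = LinearMap.id := hφ₀.trans ((homCoeff_id 0).trans (if_pos rfl))
  -- The even part of the cocycle is again a cocycle, now a genuine intertwiner, and it keeps the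
  -- constant term.
  refine ⟨(1 / 2 : ℂ) • (f + η ∘ₗ f ∘ₗ η), fun x => ?_, fun x => ?_, ?_⟩
  · change (1 / 2 : ℂ) • (f (η x) + η (f (η (η x)))) = η ((1 / 2 : ℂ) • (f x + η (f (η x))))
    rw [LinearMap.map_smul_of_tower, map_add, hηη, hηη, add_comm]
  · change D ((1 / 2 : ℂ) • (f x + η (f (η x)))) = (1 / 2 : ℂ) • (f (L x) + η (f (η (L x))))
    rw [LinearMap.map_smul_of_tower, map_add, hodd, hf, hf, hLη]
    simp only [map_neg, hηη, neg_neg]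
    rw [add_comm]
  · rw [map_smul, map_add, Pi.smul_apply, Pi.add_apply, hη, homCoeff_baseChange_comp,
      homCoeff_comp_baseChange, hf₀]
    refine LinearMap.ext fun a => ?_
    change (1 / 2 : ℂ) • (a + ε (ε a)) = a
    rw [hε.apply_apply A.isCompl, ← two_smul ℂ a, smul_smul, one_div,
      inv_mul_cancel₀ two_ne_zero, one_smul]

/-- A minimal matrix factorization of a nondegenerate quadratic form is of the form `Φ(A)`. -/
theorem MF.IsMinimal.exists_beh_iso (hnd : (QuadraticMap.associated (R := ℂ) Q).Nondegenerate)
    {M : MF.{u} (CSym n) (quadSeries b Q)} (hM : M.IsMinimal) :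
    ∃ A : ClMod.{u} Q, Nonempty (behObj b Q A ≅ M) := by
  obtain ⟨A, _, _, _, P, hP, e₁, he₁⟩ := M.exists_graded_basis
  obtain ⟨ε, hε⟩ := exists_isParity hP
  have hP' := isCompl_baseChange (CSym n) hP
  have he₁' := symm_mem_piece hP' M.isCompl e₁ he₁
  let D := e₁.symm.toLinearMap ∘ₗ M.d ∘ₗ e₁.toLinearMap
  have hDη : ∀ x, D (ε.baseChange (CSym n) x) = -ε.baseChange (CSym n) (D x) :=
    (hε.baseChange (R := CSym n)).anticomm_of_odd (hε.baseChange (R := CSym n)) hP'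
      D.toAddMonoidHom fun i x hx => he₁' _ _ (M.d_mem i _ (he₁ i x hx))
  have h₀ : homCoeff D 0 = 0 := hM.homCoeff_zero e₁
  have hD : ∀ x, D (D x) = quadSeries b Q • x := fun x => by
    change e₁.symm (M.d (e₁ (e₁.symm (M.d (e₁ x))))) = _
    rw [e₁.apply_symm_apply, M.d_d, map_smul, e₁.symm_apply_apply]
  have hγ : ∀ k i, ∀ x ∈ P i, homCoeff D (Finsupp.single k 1) x ∈ P (i + 1) := fun k =>
    hε.odd_of_anticomm hε hP (homCoeff D (Finsupp.single k 1)).toAddMonoidHom fun x => by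
      have h : D ∘ₗ ε.baseChange (CSym n) + ε.baseChange (CSym n) ∘ₗ D = 0 :=
        LinearMap.ext fun x => eq_neg_iff_add_eq_zero.1 (hDη x)
      have h' := congrFun (congrArg homCoeff h) (Finsupp.single k 1)
      rw [map_add, Pi.add_apply, homCoeff_comp_baseChange, homCoeff_baseChange_comp, map_zero] at h'
      exact eq_neg_iff_add_eq_zero.2 (LinearMap.congr_fun h' x)
  -- The coefficients of `D` at the variables define the Clifford module; minimality entered through
  -- `h₀`.
  obtain ⟨C, e, he, hek⟩ := exists_clMod b Q hP _ hγ
    (clifford_relations b Q h₀ (fun _ => rfl) hD)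
  obtain ⟨ε', hε'⟩ := exists_isParity C.isCompl
  have hC := isCompl_baseChange (CSym n) C.isCompl
  let e₂ := (LinearEquiv.baseChange ℂ (CSym n) _ _ e).trans e₁
  have he₂ : ∀ i, ∀ x ∈ (C.piece i).baseChange (CSym n), e₂ x ∈ M.piece i := by
    intro i x hx
    refine he₁ i _ ?_
    have h : (C.piece i).baseChange (CSym n) ≤ ((P i).baseChange (CSym n)).comap
        (e.toLinearMap.baseChange (CSym n)) := by
      rw [Submodule.baseChange_eq_span, Submodule.span_le]
      rintro _ ⟨y, hy, rfl⟩
      exact Submodule.tmul_mem_baseChange_of_mem 1 (he i y hy)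
    exact h hx
  have he₂' := symm_mem_piece hC M.isCompl e₂ he₂
  let D₂ := e₂.symm.toLinearMap ∘ₗ M.d ∘ₗ e₂.toLinearMap
  have hD₂ : D₂ = e.symm.toLinearMap.baseChange (CSym n) ∘ₗ D ∘ₗ
      e.toLinearMap.baseChange (CSym n) := rfl
  have hD₂' : ∀ x, e₂ (D₂ x) = M.d (e₂ x) := fun x => e₂.apply_symm_apply _
  -- In the trivialization by `C`, the linear part of `D₂` is the differential of `Φ(C)`.
  obtain ⟨f, hf, hDf, hf₀⟩ := exists_conjugation b hnd hε' D₂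
    ((hε'.baseChange (R := CSym n)).anticomm_of_odd (hε'.baseChange (R := CSym n)) hC
      D₂.toAddMonoidHom fun i x hx => he₂' _ _ (M.d_mem i _ (he₂ i x hx)))
    (fun x => e₂.injective (by rw [hD₂', hD₂', M.d_d, map_smul]))
    (by rw [hD₂, homCoeff_baseChange_comp, homCoeff_comp_baseChange, h₀, LinearMap.zero_comp,
      LinearMap.comp_zero])
    (fun k => by
      rw [hD₂, homCoeff_baseChange_comp, homCoeff_comp_baseChange]
      refine LinearMap.ext fun x => ?_
      change e.symm (homCoeff D (Finsupp.single k 1) (e x)) = _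
      rw [← hek, e.symm_apply_apply])
  have := ClMod.finiteDimensional b C
  let e₃ := (LinearEquiv.ofBijective f (bijective_of_homCoeff_zero f hf₀)).trans e₂
  have he₃ : ∀ i, ∀ x ∈ (C.piece i).baseChange (CSym n), e₃ x ∈ M.piece i := fun i x hx =>
    he₂ i _ ((hε'.baseChange (R := CSym n)).even_of_comm (hε'.baseChange (R := CSym n)) hC
      f.toAddMonoidHom hf i x hx)
  refine ⟨C, ⟨MF.mkIso (M := behObj b Q C) e₃ he₃ (symm_mem_piece hC M.isCompl e₃ he₃) fun x => ?_⟩⟩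
  exact (hD₂' (f x)).symm.trans (congrArg e₂ (hDf x))

/-- Every object is homotopy equivalent to a minimal factorization, and those are isomorphic to some
`Φ(A)` already before passing to homotopy classes. -/
theorem behHMF_essSurj (hnd : (QuadraticMap.associated (R := ℂ) Q).Nondegenerate) :
    (behHMF.{u} b Q).EssSurj where
  mem_essImage X := by
    obtain ⟨M⟩ := X
    obtain ⟨M', hM', ⟨i⟩⟩ := M.exists_minimal
    obtain ⟨A, ⟨j⟩⟩ := hM'.exists_beh_iso b hnd
    exact ⟨A, ⟨(CategoryTheory.Quotient.functor _).mapIso j ≪≫ i.symm⟩⟩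

theorem behHMF_isEquivalence (hnd : (QuadraticMap.associated (R := ℂ) Q).Nondegenerate) :
    (behHMF.{u} b Q).IsEquivalence where
  faithful := behHMF_faithful b Q
  full := behHMF_full b hnd
  essSurj := behHMF_essSurj b hnd

end Deformation

/-! ### Additivity and linearity of the induced functors -/

section Linearity

variable {Ghat : Type*} [Group Ghat] {π : Ghat →* ℤˣ}
variable {C : Type u₁} [Category.{v₁} C] [Preadditive C] [Linear ℂ C]
variable {D : Type u₂} [Category.{v₂} D] [Preadditive D] [Linear ℂ D]
variable {P : RealTwoRep π C} {P' : RealTwoRep π D} {F : C ⥤ D}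

theorem RealEquivariant.fixed_additive (η : RealEquivariant P P' F) [F.Additive] :
    η.fixed.Additive where
  map_add := Subtype.ext F.map_add

theorem RealEquivariant.fixed_linear (η : RealEquivariant P P' F) [F.Additive] [F.Linear ℂ] :
    η.fixed.Linear ℝ where
  map_smul f r := Subtype.ext (F.map_smul (r : ℂ) f.1)

variable {V : Type v} [AddCommGroup V] [Module ℂ V] {n : ℕ} (b : Module.Basis (Fin n) ℂ V)
  (Q : QuadraticForm ℂ V)

theorem beh_additive : (beh.{u} b Q).Additive where
  map_add {_ _ f g} := Subtype.ext (LinearMap.baseChange_add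
    (f.1.restrictScalars ℂ) (g.1.restrictScalars ℂ))

theorem beh_linear : (beh.{u} b Q).Linear ℂ where
  map_smul f c := MF.hom_ext fun x => by
    change (c • (f.1.restrictScalars ℂ)).baseChange (CSym n) x =
      algebraMap ℂ (CSym n) c • behMap f x
    rw [LinearMap.baseChange_smul, algebraMap_smul]
    rfl

theorem behHMF_additive : (behHMF.{u} b Q).Additive :=
  haveI := beh_additive.{u} b Q
  inferInstance

theorem behHMF_linear : (behHMF.{u} b Q).Linear ℂ where
  map_smul f c := congrArg (CategoryTheory.Quotient.functor
    (MF.nullHomotopic (R := CSym n) (W := quadSeries b Q)).rel).map ((beh_linear b Q).map_smul f c)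

end Linearity

end RealMF

theorem mainTheorem5 {Ghat : Type*} [Group Ghat] [Finite Ghat] (π : Ghat →* ℤˣ)
    {V : Type*} [AddCommGroup V] [Module ℂ V] {n : ℕ} (b : Module.Basis (Fin n) ℂ V)
    (ρ : RealRep π V) (Q : QuadraticForm ℂ V)
    (hnd : (QuadraticMap.associated (R := ℂ) Q).Nondegenerate) (hQ : ρ.Invariant Q) :
    ∃ η : RealEquivariant (ClMod.twoRep.{u} hQ) (mfTwoRep.{u} b hQ) (beh.{u} b Q),
      (∀ (σ : Ghat) (A : ClMod.{u} Q) (r : CSym n) (a : A.carrier),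
        ((η.η σ).hom.app A).1 (r ⊗ₜ[ℂ] toTwisted (cliffordAction hQ) σ A.carrier a) =
          toTwisted (csymAction b ρ) σ (CSym n ⊗[ℂ] A.carrier)
            ((csymAction b ρ).act σ⁻¹ r ⊗ₜ[ℂ] a)) ∧
      (η.comp (toHMFEquivariant b hQ)).fixed.Additive ∧
      (η.comp (toHMFEquivariant b hQ)).fixed.Linear ℝ ∧
      (η.comp (toHMFEquivariant b hQ)).fixed.IsEquivalence := by
  have := behHMF_additive.{u} b Q
  have := behHMF_linear.{u} b Q
  have := behHMF_isEquivalence.{u} b hnd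
  -- The formula on pure tensors is definitional, as `untwist` is lifted from exactly this
  -- assignment.
  exact ⟨behEquivariant b hQ, fun _ _ _ _ => rfl, RealEquivariant.fixed_additive _,
    RealEquivariant.fixed_linear _, RealEquivariant.fixed_isEquivalence _⟩
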